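/- All Banach spaces are complex. For a Banach space $X$, let $\mathcal F(X)$ be the algebra of approximable operators on $X$, i.e. the operator-norm closure, in the bounded operators on $X$, of the bounded operators with finite-dimensional range. A finite biorthogonal system of length $n$ in $X$ consists of $x_1,\dots,x_n\in X$ and $x_1^*,\dots,x_n^*\in X^*$ with $x_j^*(x_i)=\delta_{ij}$; it defines a map $E:M_n(\mathbb C)\to\mathcal F(X)$ by $E((a_{ij}))(y)=\sum_{i,j}a_{ij}\,x_j^*(y)\,x_i$. An irreducible $(n\times n)$-matrix group is a finite subgroup of $GL_n(\mathbb C)$ whose linear span is $M_n(\mathbb C)$. The space $X$ has property $(\mathbb A)$ if there is a net of finite biorthogonal systems in $X$, of lengths $n_\lambda$ and with corresponding maps $E_\lambda:M_{n_\lambda}(\mathbb C)\to\mathcal F(X)$ $(\lambda\in\Lambda)$, such that, with $P_\lambda=E_\lambda(I_{n_\lambda})$, (i) $P_\lambda x\to x$ in norm for every $x\in X$; (ii) $x^*\circ P_\lambda\to x^*$ in norm for every $x^*\in X^*$; (iii) for each $\lambda$ there is an irreducible $(n_\lambda\times n_\lambda)$-matrix group $\mathcal G_\lambda$ such that $\sup\{\|E_\lambda(g)\|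 : g\in\mathcal G_\lambda,\ \lambda\in\Lambda\}<\infty$. A Banach algebra $\mathcal A$ is amenable if, for every Banach $\mathcal A$-bimodule $E$ (a Banach space that is an $\mathcal A$-bimodule with jointly bounded bilinear actions), every continuous linear $D:\mathcal A\to E^*$ with $D(ab)=a.D(b)+D(a).b$ for all $a,b\in\mathcal A$ is of the form $D(a)=a.f-f.a$ for some $f\in E^*$, where $(a.f)(x)=f(x.a)$ and $(f.a)(x)=f(a.x)$. Theorem 4.7. Let $K$ be a compact Hausdorff space, let $(\Omega,\Sigma,\mu)$ be a measure space and let $1\le p\le\infty$. Then the spaces $C(K)$ and $L_p(\mu)$ of complex-valued functions have property $(\mathbb A)$, and the Banach algebras $\mathcal F(C(K))$ and $\mathcal F(L_p(\mu))$ are amenable. -/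

import Mathlib

open Filter Topology MeasureTheory
open scoped ENNReal

universe u v w

/-! ### Approximable operators -/

/-- The algebra `F(X)` of bounded operators on `X` with finite-dimensional range. -/
def finiteRankOperators (X : Type u) [NormedAddCommGroup X] [NormedSpace ℂ X] :
    NonUnitalSubalgebra ℂ (X →L[ℂ] X) where
  carrier := {T | FiniteDimensional ℂ (LinearMap.range (T : X →ₗ[ℂ] X))}
  add_mem' := by
    intro S T hS hT
    simp only [Set.mem_ofPred_eq] at hS hT ⊢
    exact Submodule.finiteDimensional_of_le
      (LinearMap.range_add_le (S : X →ₗ[ℂ] X) (T : X →ₗ[ℂ] X))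
  zero_mem' := by
    have h : LinearMap.range ((0 : X →L[ℂ] X) : X →ₗ[ℂ] X) = ⊥ := LinearMap.range_zero
    simp only [Set.mem_ofPred_eq]
    rw [h]
    infer_instance
  mul_mem' := by
    intro S T hS _
    simp only [Set.mem_ofPred_eq] at hS ⊢
    exact Submodule.finiteDimensional_of_le
      (LinearMap.range_comp_le_range (T : X →ₗ[ℂ] X) (S : X →ₗ[ℂ] X))
  smul_mem' := by
    intro c T hT
    simp only [Set.mem_ofPred_eq] at hT ⊢
    refine Submodule.finiteDimensional_of_le
      (S₂ := LinearMap.range (T : X →ₗ[ℂ] X)) ?_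
    rintro _ ⟨x, rfl⟩
    exact ⟨c • x, by simp⟩

/-- The algebra of approximable operators on `X`: the operator-norm closure of the
finite-rank operators. -/
noncomputable def approximableOperators (X : Type u) [NormedAddCommGroup X] [NormedSpace ℂ X] :
    NonUnitalSubalgebra ℂ (X →L[ℂ] X) :=
  (finiteRankOperators X).topologicalClosure

/-- The operator norm restricted to the approximable operators is a norm over `ℂ`. -/
noncomputable instance approximableOperators.normedSpace (X : Type u) [NormedAddCommGroup X]
    [NormedSpace ℂ X] : NormedSpace ℂ (approximableOperators X) where
  norm_smul_le c T := norm_smul_le c (T : X →L[ℂ] X)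

instance approximableOperators.completeSpace (X : Type u) [NormedAddCommGroup X]
    [NormedSpace ℂ X] [CompleteSpace X] : CompleteSpace (approximableOperators X) :=
  (NonUnitalSubalgebra.isClosed_topologicalClosure (finiteRankOperators X)).completeSpace_coe

/-! ### Amenable Banach algebras -/

/-- A bimodule structure on `E` over the (possibly non-unital) algebra `A`, with jointly bounded
actions: `lact a x` is `a.x` and `ract a x` is `x.a`. A continuous linear map
`A →L[ℂ] E →L[ℂ] E` is the same as a bilinear map `A × E → E` with
`‖φ a x‖ ≤ K * ‖a‖ * ‖x‖` for some constant `K`. -/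
structure BanachBimodule (A : Type u) [NonUnitalNormedRing A] [NormedSpace ℂ A]
    (E : Type v) [NormedAddCommGroup E] [NormedSpace ℂ E] where
  lact : A →L[ℂ] E →L[ℂ] E
  ract : A →L[ℂ] E →L[ℂ] E
  lact_mul : ∀ (a b : A) (x : E), lact (a * b) x = lact a (lact b x)
  ract_mul : ∀ (a b : A) (x : E), ract (a * b) x = ract b (ract a x)
  lact_ract : ∀ (a b : A) (x : E), lact a (ract b x) = ract b (lact a x)

namespace BanachBimodule

variable {A : Type u} [NonUnitalNormedRing A] [NormedSpace ℂ A]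
  {E : Type v} [NormedAddCommGroup E] [NormedSpace ℂ E]

/-- The dual bimodule: `⟨a.f, x⟩ = ⟨f, x.a⟩` and `⟨f.a, x⟩ = ⟨f, a.x⟩`. -/
noncomputable def dual (M : BanachBimodule A E) : BanachBimodule A (StrongDual ℂ E) where
  lact := ((ContinuousLinearMap.compL ℂ E E ℂ).flip).comp M.ract
  ract := ((ContinuousLinearMap.compL ℂ E E ℂ).flip).comp M.lact
  lact_mul a b f := by ext x; simp [M.ract_mul]
  ract_mul a b f := by ext x; simp [M.lact_mul]
  lact_ract a b f := by ext x; simp [M.lact_ract]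

theorem dual_lact_apply (M : BanachBimodule A E) (a : A) (f : StrongDual ℂ E) (x : E) :
    M.dual.lact a f x = f (M.ract a x) := rfl

theorem dual_ract_apply (M : BanachBimodule A E) (a : A) (f : StrongDual ℂ E) (x : E) :
    M.dual.ract a f x = f (M.lact a x) := rfl

/-- `D (ab) = a.D(b) + D(a).b`. -/
def IsDerivation (M : BanachBimodule A E) (D : A →L[ℂ] E) : Prop :=
  ∀ a b : A, D (a * b) = M.lact a (D b) + M.ract b (D a)

/-- `D a = a.x - x.a` for some fixed `x`. -/
def IsInner (M : BanachBimodule A E) (D : A →L[ℂ] E) : Prop :=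
  ∃ x : E, ∀ a : A, D a = M.lact a x - M.ract a x

end BanachBimodule

/-- The Banach algebra `A` is amenable: every continuous derivation from `A` into the dual of a
Banach `A`-bimodule is inner. (The bimodules range over the universe `v`, which is arbitrary.) -/
def IsAmenable (A : Type u) [NonUnitalNormedRing A] [NormedSpace ℂ A]
    [IsScalarTower ℂ A A] [SMulCommClass ℂ A A] [CompleteSpace A] : Prop :=
  ∀ (E : Type v) [NormedAddCommGroup E] [NormedSpace ℂ E] [CompleteSpace E]
    (M : BanachBimodule A E) (D : A →L[ℂ] StrongDual ℂ E),
    M.dual.IsDerivation D → M.dual.IsInner D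

/-! ### Property (𝔸) -/

/-- An irreducible `n × n` matrix group: a finite subgroup of `GL n ℂ` spanning all matrices. -/
def IsIrreducibleMatrixGroup {n : ℕ} (G : Subgroup (Matrix.GeneralLinearGroup (Fin n) ℂ)) : Prop :=
  (G : Set (Matrix.GeneralLinearGroup (Fin n) ℂ)).Finite ∧
  Submodule.span ℂ
    ((fun g : Matrix.GeneralLinearGroup (Fin n) ℂ => (g : Matrix (Fin n) (Fin n) ℂ)) ''
      (G : Set (Matrix.GeneralLinearGroup (Fin n) ℂ))) = ⊤

/-- A finite biorthogonal system of length `n` in `X`: `⟨x i, x* j⟩ = δ i j`. -/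
structure BiorthogonalSystem (X : Type u) [NormedAddCommGroup X] [NormedSpace ℂ X] (n : ℕ) where
  vec : Fin n → X
  func : Fin n → StrongDual ℂ X
  biorthogonal : ∀ i j, func j (vec i) = if i = j then 1 else 0

/-- The finite-rank operator `E(a) = ∑ i j, a i j • x i ⊗ x* j`, that is,
`y ↦ ∑ i j, a i j • x* j (y) • x i`. -/
noncomputable def BiorthogonalSystem.lift {X : Type u} [NormedAddCommGroup X] [NormedSpace ℂ X]
    {n : ℕ} (B : BiorthogonalSystem X n) (a : Matrix (Fin n) (Fin n) ℂ) : X →L[ℂ] X :=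
  ∑ i, ∑ j, a i j • (B.func j).smulRight (B.vec i)

theorem BiorthogonalSystem.lift_mem {X : Type u} [NormedAddCommGroup X] [NormedSpace ℂ X]
    {n : ℕ} (B : BiorthogonalSystem X n) (a : Matrix (Fin n) (Fin n) ℂ) :
    B.lift a ∈ approximableOperators X := by
  refine (finiteRankOperators X).le_topologicalClosure ?_
  refine sum_mem fun i _ => sum_mem fun j _ => SMulMemClass.smul_mem _ ?_
  change FiniteDimensional ℂ _
  refine Submodule.finiteDimensional_of_le (S₂ := Submodule.span ℂ {B.vec i}) ?_
  rintro _ ⟨x, rfl⟩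
  exact Submodule.smul_mem _ _ (Submodule.mem_span_singleton_self _)

/-- Property (𝔸) of a Banach space `X`. The net is indexed by a nonempty directed set `ι`; with
`P k = E_k (I)`, the adjoint of `P k` sends the functional `f` to `f ∘ P k`. -/
def HasPropertyA (X : Type u) [NormedAddCommGroup X] [NormedSpace ℂ X] [CompleteSpace X] : Prop :=
  ∃ (ι : Type u) (_ : Preorder ι) (_ : Nonempty ι) (_ : IsDirectedOrder ι)
    (n : ι → ℕ) (B : ∀ k, BiorthogonalSystem X (n k)),
    (∀ x : X, Tendsto (fun k => (B k).lift 1 x) atTop (𝓝 x)) ∧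
    (∀ f : StrongDual ℂ X, Tendsto (fun k => f.comp ((B k).lift 1)) atTop (𝓝 f)) ∧
    ∃ G : ∀ k, Subgroup (Matrix.GeneralLinearGroup (Fin (n k)) ℂ),
      (∀ k, IsIrreducibleMatrixGroup (G k)) ∧
      ∃ C : ℝ, ∀ k, ∀ g ∈ G k, ‖(B k).lift (g : Matrix (Fin (n k)) (Fin (n k)) ℂ)‖ ≤ C

/-! Property (𝔸) gives amenability by averaging over groups. For a finite matrix group `G` the
tensor `|G|⁻¹ ∑ g ⊗ g⁻¹` commutes with every element of `G`, hence with the span of `G`, which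
irreducibility makes the whole matrix algebra. Transported by the maps `E_k`, these tensors have
norm at most `C²` and product `P_k`, and they commute with every compression `P_k T P_k`, because
that operator lies in the image of `E_k`. Conditions (i) and (ii) make `P_k` a two-sided approximate
identity of the approximable operators. So the tensors form a bounded approximate diagonal, and
Johnson's argument (`IsAmenable.of_approximateDiagonal`) shows that derivations into dual bimodules
are inner.

Property (𝔸) is always verified with signed permutation matrices. By `HasPropertyA.of_local` it is
enough to approximate finitely many vectors and functionals at once by the spans of a biorthogonal
system on which all signed permutations are uniformly bounded, as they are on the unit vector basis
of a finite-dimensional `ℓ_p`.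

For `1 < p < ∞` such a system consists of normalized indicators of common level sets of simple
functions in `L_p` and `L_q`. The duality of `L_p` and `L_q` over an arbitrary measure comes from
norm attainment (`Lp.exists_norming`, `Lp.exists_density`).

For `p = 1` a functional need not have a global density, but it has a bounded one on the support of
each integrable function. Rounding these densities gives cells that are coherent from one support to
another (`CellMap`).

For `C(K)` the given functionals are dominated by one finite measure and so have bounded densities.
Cells on which functions and densities are nearly constant yield averages as functionals and a
partition of unity as vectors. These are nearly biorthogonal, and inverting a matrix close to the
identity makes them exactly so.

Finally, `L∞` is a commutative C⋆-algebra, hence isometric to some `C(K)` by the Gelfand transform.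
-/

/-- Banach–Alaoglu along an ultrafilter: bounded families of functionals have pointwise limits. -/
theorem StrongDual.exists_tendsto_of_bounded {ι : Type*} (U : Ultrafilter ι) {E : Type*}
    [NormedAddCommGroup E] [NormedSpace ℂ E] (f : ι → StrongDual ℂ E) (C : ℝ)
    (hf : ∀ k, ‖f k‖ ≤ C) :
    ∃ g : StrongDual ℂ E, ∀ x, Tendsto (fun k => f k x) U (𝓝 (g x)) := by
  have hK := WeakDual.isCompact_closedBall (𝕜 := ℂ) (0 : StrongDual ℂ E) C
  let F : ι → WeakDual ℂ E := fun k => StrongDual.toWeakDual (f k)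
  have hF : ∀ k, F k ∈ WeakDual.toStrongDual ⁻¹' Metric.closedBall (0 : StrongDual ℂ E) C := by
    intro k
    simpa [F] using hf k
  obtain ⟨g, -, hg⟩ := hK.ultrafilter_le_nhds (U.map F)
    (by
      rw [Ultrafilter.coe_map, le_principal_iff, mem_map]
      exact univ_mem' hF)
  refine ⟨WeakDual.toStrongDual g, fun x => ?_⟩
  have h1 : Tendsto F U (𝓝 g) := hg
  exact ((WeakDual.eval_continuous x).tendsto g).comp h1

/-! ### Approximate diagonals and amenability. -/

section Diagonal

variable {A : Type u} [NonUnitalNormedRing A] [NormedSpace ℂ A]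
    {ι : Type*} {l : Filter ι} {κ : ι → Type*} [∀ k, Fintype (κ k)]
    {c : ι → ℂ} {u v : ∀ k, κ k → A} {C : ℝ} {P : ι → A}

/-- Finite sums of elementary tensors that commute with the compressions `P k * a * P k` commute
asymptotically with `a`. -/
theorem tendsto_diagonal_commutator
    (hbound : ∀ k, ‖c k‖ * ∑ i, ‖u k i‖ * ‖v k i‖ ≤ C)
    (hu : ∀ k i, P k * u k i = u k i) (hv : ∀ k i, v k i * P k = v k i)
    (a : A) (hleft : Tendsto (fun k => P k * a) l (𝓝 a))
    (hright : Tendsto (fun k => a * P k) l (𝓝 a)) (F : A →L[ℂ] A →L[ℂ] ℂ)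
    (hcomm : ∀ k, ∑ i, F (P k * a * P k * u k i) (v k i) =
      ∑ i, F (u k i) (v k i * (P k * a * P k))) :
    Tendsto (fun k => c k * ∑ i, (F (a * u k i) (v k i) - F (u k i) (v k i * a))) l (𝓝 0) := by
  -- As `u = P u` and `v = v P`, replacing `a` by its compression costs only the errors `a - P a`
  -- and `a - a P`; the compressed part commutes exactly.
  have hdecomp : ∀ k i, F (a * u k i) (v k i) - F (u k i) (v k i * a) =
      (F (P k * a * P k * u k i) (v k i) - F (u k i) (v k i * (P k * a * P k))) +
      (F ((a - P k * a) * u k i) (v k i) - F (u k i) (v k i * (a - a * P k))) := by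
    intro k i
    have h1 : P k * a * P k * u k i = P k * a * u k i := by rw [mul_assoc, hu]
    have h2 : v k i * (P k * a * P k) = v k i * (a * P k) := by
      rw [← mul_assoc, ← mul_assoc, hv, mul_assoc]
    rw [h1, h2]
    simp only [sub_mul, mul_sub, map_sub, sub_apply]
    ring
  have hest : ∀ k, ‖c k * ∑ i, (F (a * u k i) (v k i) - F (u k i) (v k i * a))‖ ≤
      ‖F‖ * C * (‖a - P k * a‖ + ‖a - a * P k‖) := by
    intro k
    simp only [hdecomp]
    rw [Finset.sum_add_distrib, Finset.sum_sub_distrib, hcomm k, sub_self, zero_add]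
    calc _ ≤ ‖c k‖ * ∑ i, ‖F‖ * (‖a - P k * a‖ + ‖a - a * P k‖) * (‖u k i‖ * ‖v k i‖) := by
          rw [norm_mul]
          gcongr
          refine (norm_sum_le _ _).trans (Finset.sum_le_sum fun i _ => ?_)
          refine (norm_sub_le _ _).trans ?_
          have e1 := F.le_opNorm₂ ((a - P k * a) * u k i) (v k i)
          have e2 := F.le_opNorm₂ (u k i) (v k i * (a - a * P k))
          have e5 : ‖F‖ * ‖(a - P k * a) * u k i‖ * ‖v k i‖ ≤
              ‖F‖ * (‖a - P k * a‖ * ‖u k i‖) * ‖v k i‖ := by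
            gcongr
            exact norm_mul_le _ _
          have e6 : ‖F‖ * ‖u k i‖ * ‖v k i * (a - a * P k)‖ ≤
              ‖F‖ * ‖u k i‖ * (‖v k i‖ * ‖a - a * P k‖) := by
            gcongr
            exact norm_mul_le _ _
          linarith
      _ = ‖F‖ * (‖a - P k * a‖ + ‖a - a * P k‖) * (‖c k‖ * ∑ i, ‖u k i‖ * ‖v k i‖) := by
          rw [← Finset.mul_sum]; ring
      _ ≤ ‖F‖ * (‖a - P k * a‖ + ‖a - a * P k‖) * C := by
          gcongr
          exact hbound k
      _ = _ := by ring
  refine squeeze_zero_norm hest ?_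
  have h1 : Tendsto (fun k => ‖a - P k * a‖) l (𝓝 0) := by
    have := (tendsto_const_nhds (x := a)).sub hleft
    rw [sub_self] at this
    simpa using this.norm
  have h2 : Tendsto (fun k => ‖a - a * P k‖) l (𝓝 0) := by
    have := (tendsto_const_nhds (x := a)).sub hright
    rw [sub_self] at this
    simpa using this.norm
  simpa using (h1.add h2).const_mul (‖F‖ * C)

/-- A Banach algebra with a bounded approximate diagonal, given by finite sums
`c k • ∑ i, u k i ⊗ v k i` of elementary tensors, is amenable when the products `P k` of these
tensors form a two-sided approximate identity whose compressions commute with the tensors. -/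
theorem IsAmenable.of_approximateDiagonal [IsScalarTower ℂ A A] [SMulCommClass ℂ A A]
    [CompleteSpace A] [NeBot l]
    (hbound : ∀ k, ‖c k‖ * ∑ i, ‖u k i‖ * ‖v k i‖ ≤ C)
    (hP : ∀ k, c k • ∑ i, u k i * v k i = P k)
    (hu : ∀ k i, P k * u k i = u k i) (hv : ∀ k i, v k i * P k = v k i)
    (hleft : ∀ a, Tendsto (fun k => P k * a) l (𝓝 a))
    (hright : ∀ a, Tendsto (fun k => a * P k) l (𝓝 a))
    (hcomm : ∀ (a : A) (F : A →L[ℂ] A →L[ℂ] ℂ) (k : ι),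
      ∑ i, F (P k * a * P k * u k i) (v k i) = ∑ i, F (u k i) (v k i * (P k * a * P k))) :
    IsAmenable.{u, w} A := by
  intro E _ _ _ M D hD
  let U : Ultrafilter ι := Ultrafilter.of l
  have hU : (U : Filter ι) ≤ l := Ultrafilter.of_le l
  have hPbound : ∀ k, ‖P k‖ ≤ C := by
    intro k
    rw [← hP, norm_smul]
    refine le_trans ?_ (hbound k)
    gcongr
    exact (norm_sum_le _ _).trans (Finset.sum_le_sum fun i _ => norm_mul_le _ _)
  -- Johnson's construction: apply `u ⊗ v ↦ u.D(v)` to the approximate diagonal. A weak* limit `f`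
  -- implements `D` up to maps annihilated by the left action of `A`.
  let fk : ι → StrongDual ℂ E := fun k => c k • ∑ i, M.dual.lact (u k i) (D (v k i))
  have hfk : ∀ k, ‖fk k‖ ≤ ‖M.dual.lact‖ * ‖D‖ * C := by
    intro k
    calc ‖fk k‖ ≤ ‖c k‖ * ∑ i, ‖M.dual.lact‖ * ‖D‖ * (‖u k i‖ * ‖v k i‖) := by
          rw [norm_smul]
          gcongr
          refine (norm_sum_le _ _).trans (Finset.sum_le_sum fun i _ => ?_)
          calc ‖M.dual.lact (u k i) (D (v k i))‖
              ≤ ‖M.dual.lact‖ * ‖u k i‖ * ‖D (v k i)‖ :=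
                ContinuousLinearMap.le_opNorm₂ _ _ _
            _ ≤ ‖M.dual.lact‖ * ‖u k i‖ * (‖D‖ * ‖v k i‖) := by
                gcongr
                exact D.le_opNorm _
            _ = _ := by ring
      _ = ‖M.dual.lact‖ * ‖D‖ * (‖c k‖ * ∑ i, ‖u k i‖ * ‖v k i‖) := by
          rw [← Finset.mul_sum]; ring
      _ ≤ _ := by gcongr; exact hbound k
  obtain ⟨f, hf⟩ := StrongDual.exists_tendsto_of_bounded U fk _ hfk
  have hmain : ∀ a x, Tendsto (fun k => D a (M.ract (P k) x)) U
      (𝓝 (f (M.ract a x) - f (M.lact a x))) := by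
    intro a x
    let F : A →L[ℂ] A →L[ℂ] ℂ :=
      ((ContinuousLinearMap.compL ℂ A (StrongDual ℂ E) ℂ).flip D).comp
        ((ContinuousLinearMap.apply ℂ ℂ : E →L[ℂ] StrongDual ℂ E →L[ℂ] ℂ).comp (M.ract.flip x))
    have hF : ∀ a b, F a b = D b (M.ract a x) := fun a b => rfl
    have h1 := (hf (M.ract a x)).sub (hf (M.lact a x))
    have hdiag := tendsto_diagonal_commutator hbound hu hv a (hleft a) (hright a) F (hcomm a F)
    have h2 := h1.sub (hdiag.mono_left hU)
    rw [sub_zero] at h2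
    refine h2.congr fun k => ?_
    -- The derivation rule splits off `D a` acting through `u v`, and these products add up to `P
    -- k`.
    have hDa : ∀ i, D (v k i * a) (M.ract (u k i) x) =
        D a (M.ract (u k i * v k i) x) + D (v k i) (M.lact a (M.ract (u k i) x)) := by
      intro i
      rw [hD]
      simp [BanachBimodule.dual_lact_apply, BanachBimodule.dual_ract_apply, M.ract_mul]
    simp only [fk, ← hP, smul_apply, sum_apply, map_smul,
      map_sum, BanachBimodule.dual_lact_apply, smul_eq_mul, hF, hDa, M.lact_ract,
      Finset.sum_sub_distrib, Finset.sum_add_distrib, M.ract_mul]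
    ring
  -- `E` is not assumed essential, so `x.P k` need not tend to `x` and a second correction is
  -- needed. The remainder `D'` satisfies `b.D'(a) = 0`, hence `D'(ab) = D'(a).b`. A weak* limit `ψ`
  -- of `D'(P k)` then has `ψ.b = D'(b)` and `b.ψ = 0`.
  let D' : A →L[ℂ] StrongDual ℂ E := D - (M.dual.lact.flip f - M.dual.ract.flip f)
  have hD'app : ∀ a x, D' a x = D a x - (f (M.ract a x) - f (M.lact a x)) := fun a x => rfl
  have hD'zero : ∀ a b x, D' a (M.ract b x) = 0 := by
    intro a b x
    have h1 := hmain a (M.ract b x)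
    have h2 : Tendsto (fun k => D a (M.ract (P k) (M.ract b x))) U (𝓝 (D a (M.ract b x))) := by
      have h3 : Continuous fun y : A => D a (M.ract y x) := by fun_prop
      have h4 := (h3.tendsto b).comp ((hright b).mono_left hU)
      refine h4.congr fun k => ?_
      simp [M.ract_mul]
    rw [hD'app, tendsto_nhds_unique h1 h2, sub_self]
  have hD'mul : ∀ a b x, D' (a * b) x = D' a (M.lact b x) := by
    intro a b x
    have h0 := hD'zero b a x
    rw [hD'app] at h0
    rw [hD'app, hD'app, hD]
    simp only [add_apply, BanachBimodule.dual_lact_apply,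
      BanachBimodule.dual_ract_apply, M.ract_mul, M.lact_mul, M.lact_ract] at *
    linear_combination h0
  obtain ⟨ψ, hψ⟩ := StrongDual.exists_tendsto_of_bounded U (fun k => D' (P k)) (‖D'‖ * C)
    (fun k => (D'.le_opNorm _).trans (by gcongr; exact hPbound k))
  refine ⟨f - ψ, fun b => ?_⟩
  ext x
  have h1 : ψ (M.lact b x) = D' b x := by
    have h3 : Continuous fun y : A => D' y x := by fun_prop
    have h4 := (h3.tendsto b).comp ((hleft b).mono_left hU)
    refine tendsto_nhds_unique (hψ _) (h4.congr fun k => ?_)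
    exact hD'mul _ _ _
  have h2 : ψ (M.ract b x) = 0 := by
    refine tendsto_nhds_unique (hψ _) ?_
    simp only [hD'zero]
    exact tendsto_const_nhds
  rw [hD'app] at h1
  simp only [sub_apply, BanachBimodule.dual_lact_apply,
      BanachBimodule.dual_ract_apply, h1, h2]
  ring

end Diagonal

/-! ### The matrix algebra of a biorthogonal system. -/

namespace BiorthogonalSystem

variable {X : Type u} [NormedAddCommGroup X] [NormedSpace ℂ X] {n : ℕ}

theorem lift_apply (B : BiorthogonalSystem X n) (a : Matrix (Fin n) (Fin n) ℂ) (y : X) :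
    B.lift a y = ∑ i, ∑ j, (a i j * B.func j y) • B.vec i := by
  simp [lift, smul_smul]

/-- `BiorthogonalSystem.lift` as a linear map into the approximable operators. -/
noncomputable def liftₗ (B : BiorthogonalSystem X n) :
    Matrix (Fin n) (Fin n) ℂ →ₗ[ℂ] approximableOperators X where
  toFun a := ⟨B.lift a, B.lift_mem a⟩
  map_add' a b := by
    ext y
    simp [lift_apply, add_mul, add_smul, Finset.sum_add_distrib]
  map_smul' c a := by
    ext y
    simp [lift_apply, mul_assoc, mul_smul, Finset.smul_sum]

theorem func_lift_apply (B : BiorthogonalSystem X n) (a : Matrix (Fin n) (Fin n) ℂ) (i : Fin n)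
    (y : X) : B.func i (B.lift a y) = ∑ j, a i j * B.func j y := by
  simp only [lift_apply, map_sum, map_smul, B.biorthogonal, smul_eq_mul, mul_ite, mul_one,
    mul_zero]
  rw [Finset.sum_comm]
  simp

theorem liftₗ_mul (B : BiorthogonalSystem X n) (a b : Matrix (Fin n) (Fin n) ℂ) :
    B.liftₗ (a * b) = B.liftₗ a * B.liftₗ b := by
  ext y
  change B.lift (a * b) y = B.lift a (B.lift b y)
  rw [lift_apply, lift_apply]
  simp only [func_lift_apply, Matrix.mul_apply, Finset.sum_mul, Finset.mul_sum, Finset.sum_smul,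
    mul_assoc]
  refine Finset.sum_congr rfl fun i _ => Finset.sum_comm

/-- The operator `P T P` lies in the image of the matrix algebra. -/
theorem exists_liftₗ_eq_compression (B : BiorthogonalSystem X n) (T : approximableOperators X) :
    ∃ a, B.liftₗ 1 * T * B.liftₗ 1 = B.liftₗ a := by
  refine ⟨Matrix.of fun i j => B.func i ((T : X →L[ℂ] X) (B.vec j)), ?_⟩
  ext y
  change B.lift 1 ((T : X →L[ℂ] X) (B.lift 1 y)) = B.lift _ y
  simp only [lift_apply, Matrix.one_apply, ite_mul, one_mul, zero_mul, ite_smul, zero_smul,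
    Finset.sum_ite_eq, Finset.mem_univ, if_true, map_sum, map_smul, Matrix.of_apply,
    Finset.smul_sum, smul_smul]
  rw [Finset.sum_comm]
  simp only [mul_comm]

end BiorthogonalSystem

/-! ### Approximate identities in the approximable operators. -/

section ApproximateIdentity

variable {X : Type u} [NormedAddCommGroup X] [NormedSpace ℂ X] {ι : Type*} {l : Filter ι}
  {P : ι → approximableOperators X} {C : ℝ}

/-- A finite-rank operator is a finite sum of elementary operators `f i ⊗ x i`. -/
theorem exists_eq_sum_smulRight {T : X →L[ℂ] X} (hT : T ∈ finiteRankOperators X) :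
    ∃ (m : ℕ) (f : Fin m → StrongDual ℂ X) (x : Fin m → X), T = ∑ i, (f i).smulRight (x i) := by
  have : FiniteDimensional ℂ (LinearMap.range (T : X →ₗ[ℂ] X)) := hT
  let b := Module.finBasis ℂ (LinearMap.range (T : X →ₗ[ℂ] X))
  let T' : X →L[ℂ] LinearMap.range (T : X →ₗ[ℂ] X) := T.codRestrict _ fun x => ⟨x, rfl⟩
  refine ⟨_, fun i => (LinearMap.toContinuousLinearMap (b.coord i)).comp T', fun i => b i, ?_⟩
  ext y
  have h := congrArg Subtype.val (b.sum_repr (T' y))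
  simp only [sum_apply, ContinuousLinearMap.smulRight_apply]
  rw [AddSubmonoidClass.coe_finsetSum] at h
  exact h.symm

/-- A uniformly Lipschitz family converges on the closure once it converges on a dense set; this
reduces both multiplications by `P k` to finite rank. -/
theorem tendsto_of_approximable (Q : approximableOperators X → ι → (X →L[ℂ] X))
    (hQ : ∀ k S T, ‖Q S k - Q T k‖ ≤ C * ‖S - T‖) 
    (h : ∀ T : approximableOperators X, (T : X →L[ℂ] X) ∈ finiteRankOperators X →
      Tendsto (Q T) l (𝓝 (T : X →L[ℂ] X))) (T : approximableOperators X) :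
    Tendsto (Q T) l (𝓝 (T : X →L[ℂ] X)) := by
  rw [Metric.tendsto_nhds]
  intro ε hε
  have hT : (T : X →L[ℂ] X) ∈ closure (finiteRankOperators X : Set (X →L[ℂ] X)) := T.2
  obtain ⟨S, hS, hST⟩ := Metric.mem_closure_iff.1 hT (ε / (2 * (|C| + 1))) (by positivity)
  let S' : approximableOperators X := ⟨S, (finiteRankOperators X).le_topologicalClosure hS⟩
  have hd : ‖T - S'‖ < ε / (2 * (|C| + 1)) := by
    rw [dist_eq_norm] at hST
    exact hST
  filter_upwards [(Metric.tendsto_nhds.1 (h S' hS)) (ε / 2) (by positivity)] with k hk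
  rw [dist_eq_norm] at hk ⊢
  have h1 : ‖Q T k - Q S' k‖ ≤ |C| * ‖T - S'‖ :=
    (hQ k T S').trans (by gcongr; exact le_abs_self C)
  have h2 : ‖(T : X →L[ℂ] X) - (S' : X →L[ℂ] X)‖ = ‖T - S'‖ := rfl
  have h3 : Q T k - (T : X →L[ℂ] X) = (Q T k - Q S' k) + (Q S' k - (S' : X →L[ℂ] X)) -
      ((T : X →L[ℂ] X) - (S' : X →L[ℂ] X)) := by abel
  have h4 : (|C| + 1) * ‖T - S'‖ < ε / 2 := by
    rw [lt_div_iff₀ (by positivity)] at hd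
    linarith
  calc _ ≤ ‖Q T k - Q S' k‖ + ‖Q S' k - (S' : X →L[ℂ] X)‖ +
        ‖(T : X →L[ℂ] X) - (S' : X →L[ℂ] X)‖ := by
        rw [h3]
        exact (norm_sub_le _ _).trans (by gcongr; exact norm_add_le _ _)
    _ < ε := by rw [h2]; linarith

/-- Left multiplication of `f ⊗ x` by `P k` moves only `x`, so strong convergence of `P k` is
enough. -/
theorem tendsto_mul_left_approximable (hC : ∀ k, ‖P k‖ ≤ C)
    (hP : ∀ x, Tendsto (fun k => (P k : X →L[ℂ] X) x) l (𝓝 x)) (T : approximableOperators X) :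
    Tendsto (fun k => P k * T) l (𝓝 T) := by
  rw [tendsto_subtype_rng]
  refine tendsto_of_approximable (C := C) (fun T k => (P k : X →L[ℂ] X) * (T : X →L[ℂ] X))
    (fun k S T => ?_) (fun T hT => ?_) T
  · rw [← mul_sub]
    refine (norm_mul_le _ _).trans ?_
    exact mul_le_mul_of_nonneg_right (hC k) (norm_nonneg _)
  · obtain ⟨m, f, x, h⟩ := exists_eq_sum_smulRight hT
    have h1 : ∀ k, (P k : X →L[ℂ] X) * (T : X →L[ℂ] X) =
        ∑ i, (f i).smulRight ((P k : X →L[ℂ] X) (x i)) := by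
      intro k
      rw [h]
      ext y
      simp
    simp only [h1]
    rw [h]
    refine tendsto_finsetSum _ fun i _ => ?_
    have h2 : Continuous fun y : X => (f i).smulRight y :=
      (ContinuousLinearMap.smulRightL ℂ X X (f i)).continuous
    exact (h2.tendsto _).comp (hP _)

/-- Right multiplication of `f ⊗ x` by `P k` moves only `f`; this is where norm convergence of the
adjoints is used. -/
theorem tendsto_mul_right_approximable (hC : ∀ k, ‖P k‖ ≤ C)
    (hP : ∀ f : StrongDual ℂ X, Tendsto (fun k => f.comp (P k : X →L[ℂ] X)) l (𝓝 f))
    (T : approximableOperators X) :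
    Tendsto (fun k => T * P k) l (𝓝 T) := by
  rw [tendsto_subtype_rng]
  refine tendsto_of_approximable (C := C) (fun T k => (T : X →L[ℂ] X) * (P k : X →L[ℂ] X))
    (fun k S T => ?_) (fun T hT => ?_) T
  · rw [← sub_mul]
    refine (norm_mul_le _ _).trans ?_
    rw [mul_comm]
    exact mul_le_mul_of_nonneg_right (hC k) (norm_nonneg _)
  · obtain ⟨m, f, x, h⟩ := exists_eq_sum_smulRight hT
    have h1 : ∀ k, (T : X →L[ℂ] X) * (P k : X →L[ℂ] X) =
        ∑ i, ((f i).comp (P k : X →L[ℂ] X)).smulRight (x i) := by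
      intro k
      rw [h]
      ext y
      simp
    simp only [h1]
    rw [h]
    refine tendsto_finsetSum _ fun i _ => ?_
    have h2 : Continuous fun g : StrongDual ℂ X => g.smulRight (x i) :=
      ((ContinuousLinearMap.smulRightL ℂ X X).flip (x i)).continuous
    exact (h2.tendsto _).comp (hP _)

end ApproximateIdentity

/-! ### Amenability from property (𝔸). -/

/-- The averaged diagonal of a matrix group commutes with the span of the group. -/
theorem sum_group_apply_mul_eq {n : ℕ} (G : Subgroup (Matrix.GeneralLinearGroup (Fin n) ℂ))
    [Fintype G] (hG : IsIrreducibleMatrixGroup G)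
    (F : Matrix (Fin n) (Fin n) ℂ →ₗ[ℂ] Matrix (Fin n) (Fin n) ℂ →ₗ[ℂ] ℂ)
    (a : Matrix (Fin n) (Fin n) ℂ) :
    ∑ g : G, F (a * ((g : Matrix.GeneralLinearGroup (Fin n) ℂ) : Matrix (Fin n) (Fin n) ℂ))
      (((g⁻¹ : G) : Matrix.GeneralLinearGroup (Fin n) ℂ) : Matrix (Fin n) (Fin n) ℂ) =
    ∑ g : G, F ((g : Matrix.GeneralLinearGroup (Fin n) ℂ) : Matrix (Fin n) (Fin n) ℂ)
      ((((g⁻¹ : G) : Matrix.GeneralLinearGroup (Fin n) ℂ) : Matrix (Fin n) (Fin n) ℂ) * a) := by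
  have ha : a ∈ Submodule.span ℂ
    ((fun g : Matrix.GeneralLinearGroup (Fin n) ℂ => (g : Matrix (Fin n) (Fin n) ℂ)) ''
      (G : Set (Matrix.GeneralLinearGroup (Fin n) ℂ))) := by
    rw [hG.2]; trivial
  induction ha using Submodule.span_induction with
  | mem x hx =>
    obtain ⟨h, hh, rfl⟩ := hx
    -- Substituting `g' = h g` gives `g⁻¹ = g'⁻¹ h`, which carries `h` from the left leg of the
    -- tensor to the right one.
    refine Fintype.sum_equiv (Equiv.mulLeft (⟨h, hh⟩ : G)) _ _ fun g => ?_
    simp [mul_inv_rev, Matrix.mul_assoc]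
  | zero => simp
  | add x y _ _ hx hy =>
    simp only [add_mul, mul_add, map_add, LinearMap.add_apply, Finset.sum_add_distrib, hx, hy]
  | smul c x _ hx =>
    simp only [smul_mul_assoc, mul_smul_comm, map_smul, LinearMap.smul_apply,
      ← Finset.smul_sum, hx]

theorem HasPropertyA.isAmenable {X : Type u} [NormedAddCommGroup X] [NormedSpace ℂ X]
    [CompleteSpace X] (h : HasPropertyA X) : IsAmenable.{u, w} (approximableOperators X) := by
  obtain ⟨ι, _, _, _, n, B, hP, hP', G, hG, C, hC⟩ := h
  have : ∀ k, Fintype (G k) := fun k => (hG k).1.fintype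
  have hC0 : 0 ≤ C := (norm_nonneg _).trans (hC (Classical.arbitrary ι) 1 (one_mem _))
  let m : ∀ k, G k → Matrix (Fin (n k)) (Fin (n k)) ℂ := fun k g =>
    ((g : Matrix.GeneralLinearGroup (Fin (n k)) ℂ) : Matrix (Fin (n k)) (Fin (n k)) ℂ)
  have hcard : ∀ k, (Fintype.card (G k) : ℂ) ≠ 0 := fun k => by
    exact_mod_cast Fintype.card_ne_zero
  have hone : ∀ k (g : G k), m k g * m k g⁻¹ = 1 := fun k g => by simp [m]
  have hprod : ∀ k, (Fintype.card (G k) : ℂ)⁻¹ •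
      ∑ g : G k, (B k).liftₗ (m k g) * (B k).liftₗ (m k g⁻¹) = (B k).liftₗ 1 := by
    intro k
    simp only [← BiorthogonalSystem.liftₗ_mul, hone, Finset.sum_const, Finset.card_univ]
    rw [← Nat.cast_smul_eq_nsmul ℂ, smul_smul, inv_mul_cancel₀ (hcard k), one_smul]
  have hnorm : ∀ k (g : G k), ‖(B k).liftₗ (m k g)‖ ≤ C := fun k g => hC k g g.2
  have hP1 : ∀ k, ‖(B k).liftₗ 1‖ ≤ C := fun k => by simpa [m] using hnorm k 1
  have hsum : ∀ k, ‖(Fintype.card (G k) : ℂ)⁻¹‖ * ∑ g : G k,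
      ‖(B k).liftₗ (m k g)‖ * ‖(B k).liftₗ (m k g⁻¹)‖ ≤ C * C := by
    intro k
    calc _ ≤ ‖(Fintype.card (G k) : ℂ)⁻¹‖ * ∑ g : G k, C * C := by
          gcongr
          · exact hnorm k _
          · exact hnorm k _
      _ = C * C := by
          have := hcard k
          simp only [Finset.sum_const, Finset.card_univ, nsmul_eq_mul, norm_inv,
            Complex.norm_natCast]
          rw [← mul_assoc, inv_mul_cancel₀ (by exact_mod_cast this), one_mul]
  have hleft := fun T => tendsto_mul_left_approximable (l := atTop)
    (P := fun k => (B k).liftₗ 1) (C := C) hP1 hP T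
  have hright := fun T => tendsto_mul_right_approximable (l := atTop)
    (P := fun k => (B k).liftₗ 1) (C := C) hP1 hP' T
  have hPm : ∀ k a, (B k).liftₗ 1 * (B k).liftₗ a = (B k).liftₗ a := fun k a => by
    rw [← BiorthogonalSystem.liftₗ_mul, one_mul]
  have hmP : ∀ k a, (B k).liftₗ a * (B k).liftₗ 1 = (B k).liftₗ a := fun k a => by
    rw [← BiorthogonalSystem.liftₗ_mul, mul_one]
  refine IsAmenable.of_approximateDiagonal (l := (atTop : Filter ι)) (κ := fun k => G k)
    (c := fun k => (Fintype.card (G k) : ℂ)⁻¹) (u := fun k g => (B k).liftₗ (m k g))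
    (v := fun k g => (B k).liftₗ (m k g⁻¹)) (C := C * C) (P := fun k => (B k).liftₗ 1)
    hsum hprod (fun k g => hPm k _) (fun k g => hmP k _) hleft hright ?_
  intro T F k
  -- The compression is `E_k(a)` for a matrix `a`, so the required commutation is that of the group
  -- average with matrices.
  obtain ⟨a, ha⟩ := (B k).exists_liftₗ_eq_compression T
  let F' : Matrix (Fin (n k)) (Fin (n k)) ℂ →ₗ[ℂ] Matrix (Fin (n k)) (Fin (n k)) ℂ →ₗ[ℂ] ℂ :=
    LinearMap.mk₂ ℂ (fun a b => F ((B k).liftₗ a) ((B k).liftₗ b)) (by intros; simp)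
      (by intros; simp) (by intros; simp) (by intros; simp)
  have := sum_group_apply_mul_eq (G k) (hG k) F' a
  simp only [F', LinearMap.mk₂_apply] at this
  simp only [ha, ← BiorthogonalSystem.liftₗ_mul]
  exact this

/-! ### Signed permutation matrices -/

section SignedPerm

variable {n : ℕ}

/-- The matrix of the map `y ↦ (s i • y (σ i))`. -/
def signedPermMatrix (s : Fin n → ℤˣ) (σ : Equiv.Perm (Fin n)) : Matrix (Fin n) (Fin n) ℂ :=
  Matrix.of fun i j => if σ i = j then ((s i : ℤ) : ℂ) else 0

theorem signedPermMatrix_mul (s t : Fin n → ℤˣ) (σ τ : Equiv.Perm (Fin n)) :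
    signedPermMatrix s σ * signedPermMatrix t τ =
      signedPermMatrix (fun i => s i * t (σ i)) (σ.trans τ) := by
  ext i j
  simp only [signedPermMatrix, Matrix.mul_apply, Matrix.of_apply, ite_mul, zero_mul,
    Finset.sum_ite_eq, Finset.mem_univ, if_true, Equiv.trans_apply]
  split_ifs <;> simp_all

theorem signedPermMatrix_one : signedPermMatrix (fun _ : Fin n => 1) 1 = 1 := by
  ext i j
  simp [signedPermMatrix, Matrix.one_apply]

/-- The group of signed permutation matrices. -/
def signedPermGroup (n : ℕ) : Subgroup (Matrix.GeneralLinearGroup (Fin n) ℂ) where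
  carrier := {g | ∃ s σ, (g : Matrix (Fin n) (Fin n) ℂ) = signedPermMatrix s σ}
  mul_mem' := by
    rintro g h ⟨s, σ, hg⟩ ⟨t, τ, hh⟩
    exact ⟨_, _, by rw [Units.val_mul, hg, hh, signedPermMatrix_mul]⟩
  one_mem' := ⟨fun _ => 1, 1, by rw [signedPermMatrix_one]; rfl⟩
  inv_mem' := by
    rintro g ⟨s, σ, hg⟩
    refine ⟨fun i => s (σ.symm i), σ.symm, ?_⟩
    refine Units.inv_eq_of_mul_eq_one_right ?_
    rw [hg, signedPermMatrix_mul, ← signedPermMatrix_one]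
    congr 1
    · funext i
      simp
    · ext i
      simp

theorem exists_mem_signedPermGroup (s : Fin n → ℤˣ) (σ : Equiv.Perm (Fin n)) :
    ∃ g ∈ signedPermGroup n, (g : Matrix (Fin n) (Fin n) ℂ) = signedPermMatrix s σ := by
  refine ⟨⟨signedPermMatrix s σ, signedPermMatrix (fun i => s (σ.symm i)) σ.symm, ?_, ?_⟩,
    ⟨s, σ, rfl⟩, rfl⟩
  all_goals
    rw [signedPermMatrix_mul, ← signedPermMatrix_one]
    congr 1
    · funext i
      simp
    · ext i
      simp

theorem isIrreducibleMatrixGroup_signedPermGroup (n : ℕ) :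
    IsIrreducibleMatrixGroup (signedPermGroup n) := by
  constructor
  · have h : (Set.range fun p : (Fin n → ℤˣ) × Equiv.Perm (Fin n) =>
        signedPermMatrix p.1 p.2).Finite := Set.finite_range _
    refine (h.preimage (f := fun g : Matrix.GeneralLinearGroup (Fin n) ℂ =>
      (g : Matrix (Fin n) (Fin n) ℂ)) Units.val_injective.injOn).subset ?_
    rintro g ⟨s, σ, hg⟩
    exact ⟨(s, σ), hg.symm⟩
  · rw [eq_top_iff]
    rintro a -
    have hmem : ∀ (s : Fin n → ℤˣ) (σ : Equiv.Perm (Fin n)), signedPermMatrix s σ ∈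
        Submodule.span ℂ
          ((fun g : Matrix.GeneralLinearGroup (Fin n) ℂ => (g : Matrix (Fin n) (Fin n) ℂ)) ''
          (signedPermGroup n : Set (Matrix.GeneralLinearGroup (Fin n) ℂ))) := by
      intro s σ
      obtain ⟨g, hg, h⟩ := exists_mem_signedPermGroup s σ
      exact Submodule.subset_span ⟨g, hg, h⟩
    rw [Matrix.matrix_eq_sum_single a]
    refine Submodule.sum_mem _ fun i _ => Submodule.sum_mem _ fun j _ => ?_
    -- Flipping the sign of row `i` alone cancels all other rows in the difference and doubles row
    -- `i`; the swap puts the surviving entry in column `j`.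
    have h : Matrix.single i j (a i j) = (a i j / 2) •
        (signedPermMatrix (fun _ => 1) (Equiv.swap i j) -
          signedPermMatrix (fun k => if k = i then -1 else 1) (Equiv.swap i j)) := by
      ext k l
      by_cases hk : k = i
      · subst hk
        by_cases hl : j = l
        · subst hl
          simp [signedPermMatrix]
          ring
        · simp [signedPermMatrix, Matrix.single, hl]
      · simp [signedPermMatrix, Matrix.single, hk, Ne.symm hk]
    rw [h]
    exact Submodule.smul_mem _ _ (Submodule.sub_mem _ (hmem _ _) (hmem _ _))

end SignedPerm

/-! ### A local criterion for property (𝔸). -/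

variable {X : Type u} [NormedAddCommGroup X] [NormedSpace ℂ X]

theorem BiorthogonalSystem.lift_one_apply {n : ℕ} (B : BiorthogonalSystem X n) (y : X) :
    B.lift 1 y = ∑ i, B.func i y • B.vec i := by
  simp [lift_apply, Matrix.one_apply]

theorem BiorthogonalSystem.lift_signedPermMatrix_apply {n : ℕ} (B : BiorthogonalSystem X n)
    (s : Fin n → ℤˣ) (σ : Equiv.Perm (Fin n)) (y : X) :
    B.lift (signedPermMatrix s σ) y = ∑ i, ((s i : ℤ) : ℂ) • B.func (σ i) y • B.vec i := by
  simp [lift_apply, signedPermMatrix, smul_smul]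

/-- A Banach space in which finitely many vectors and finitely many functionals can be
approximated by the spans of uniformly symmetric finite biorthogonal systems has property (𝔸). -/
theorem HasPropertyA.of_biorthogonalSystem [CompleteSpace X] (C : ℝ)
    (h : ∀ (F : Finset X) (Φ : Finset (StrongDual ℂ X)) (ε : ℝ), 0 < ε →
      ∃ (n : ℕ) (B : BiorthogonalSystem X n),
        (∀ s σ, ‖B.lift (signedPermMatrix s σ)‖ ≤ C) ∧
        (∀ y ∈ F, ∃ c : Fin n → ℂ, ‖y - ∑ i, c i • B.vec i‖ ≤ ε) ∧
        (∀ φ ∈ Φ, ∃ c : Fin n → ℂ, ‖φ - ∑ i, c i • B.func i‖ ≤ ε)) :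
    HasPropertyA X := by
  classical
  have hC : 0 ≤ C := by
    obtain ⟨n, B, hB, -⟩ := h ∅ ∅ 1 one_pos
    exact (norm_nonneg _).trans (hB (fun _ => 1) 1)
  have h' : ∀ k : Finset X × Finset (StrongDual ℂ X) × ℕ,
      ∃ (n : ℕ) (B : BiorthogonalSystem X n),
        (∀ s σ, ‖B.lift (signedPermMatrix s σ)‖ ≤ C) ∧
        (∀ y ∈ k.1, ‖B.lift 1 y - y‖ ≤ 1 / (k.2.2 + 1 : ℝ)) ∧
        (∀ φ ∈ k.2.1, ‖φ.comp (B.lift 1) - φ‖ ≤ 1 / (k.2.2 + 1 : ℝ)) := by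
    intro k
    -- `P` fixes the span of the system, so for `v` in it `P y - y = P (y - v) - (y - v)` has norm
    -- at most `(1 + C) ‖y - v‖`; hence the divisor `1 + C`.
    obtain ⟨n, B, hB, hF, hΦ⟩ := h k.1 k.2.1 (1 / (k.2.2 + 1 : ℝ) / (1 + C)) (by positivity)
    have hP : ‖B.lift 1‖ ≤ C := by rw [← signedPermMatrix_one]; exact hB _ _
    refine ⟨n, B, hB, fun y hy => ?_, fun φ hφ => ?_⟩
    · obtain ⟨c, hc⟩ := hF y hy
      set v := ∑ i, c i • B.vec i with hv
      have hPv : B.lift 1 v = v := by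
        rw [B.lift_one_apply]
        simp [hv, B.biorthogonal]
      have h1 : B.lift 1 y - y = B.lift 1 (y - v) - (y - v) := by
        rw [map_sub, hPv]; abel
      rw [le_div_iff₀ (by positivity)] at hc
      calc _ ≤ ‖B.lift 1 (y - v)‖ + ‖y - v‖ := by rw [h1]; exact norm_sub_le _ _
        _ ≤ C * ‖y - v‖ + ‖y - v‖ := by
          gcongr
          exact (ContinuousLinearMap.le_opNorm _ _).trans (by gcongr)
        _ = ‖y - v‖ * (1 + C) := by ring
        _ ≤ _ := hc
    · obtain ⟨c, hc⟩ := hΦ φ hφ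
      set v := ∑ i, c i • B.func i with hv
      have hPv : v.comp (B.lift 1) = v := by
        ext y
        rw [ContinuousLinearMap.comp_apply, B.lift_one_apply]
        simp [hv, B.biorthogonal, mul_comm]
      have h1 : φ.comp (B.lift 1) - φ = (φ - v).comp (B.lift 1) - (φ - v) := by
        rw [ContinuousLinearMap.sub_comp, hPv]; abel
      rw [le_div_iff₀ (by positivity)] at hc
      calc _ ≤ ‖(φ - v).comp (B.lift 1)‖ + ‖φ - v‖ := by rw [h1]; exact norm_sub_le _ _
        _ ≤ ‖φ - v‖ * C + ‖φ - v‖ := by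
          gcongr
          exact (ContinuousLinearMap.opNorm_comp_le _ _).trans (by gcongr)
        _ = ‖φ - v‖ * (1 + C) := by ring
        _ ≤ _ := hc
  choose n B hB hF hΦ using h'
  -- The net is indexed by the finite sets to be approximated and the accuracy `1 / (N + 1)`, in the
  -- product order.
  refine ⟨Finset X × Finset (StrongDual ℂ X) × ℕ, inferInstance, inferInstance, inferInstance,
    n, B, fun x => ?_, fun f => ?_, fun k => signedPermGroup (n k),
    fun k => isIrreducibleMatrixGroup_signedPermGroup _, C, ?_⟩
  · rw [Metric.tendsto_atTop]
    intro ε hε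
    obtain ⟨N, hN⟩ := exists_nat_one_div_lt hε
    refine ⟨({x}, ∅, N), fun k hk => ?_⟩
    rw [dist_eq_norm]
    refine (hF k x (hk.1 (Finset.mem_singleton_self x))).trans_lt (lt_of_le_of_lt ?_ hN)
    have : N ≤ k.2.2 := hk.2.2
    gcongr
  · rw [Metric.tendsto_atTop]
    intro ε hε
    obtain ⟨N, hN⟩ := exists_nat_one_div_lt hε
    refine ⟨(∅, {f}, N), fun k hk => ?_⟩
    rw [dist_eq_norm]
    refine (hΦ k f (hk.2.1 (Finset.mem_singleton_self f))).trans_lt (lt_of_le_of_lt ?_ hN)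
    have : N ≤ k.2.2 := hk.2.2
    gcongr
  · rintro k g ⟨s, σ, hg⟩
    rw [hg]
    exact hB k s σ

/-- `HasPropertyA.of_biorthogonalSystem` with systems indexed by arbitrary finite types. -/
theorem HasPropertyA.of_local [CompleteSpace X] (C : ℝ)
    (h : ∀ (F : Finset X) (Φ : Finset (StrongDual ℂ X)) (ε : ℝ), 0 < ε →
      ∃ (ι : Type v) (_ : Fintype ι) (_ : DecidableEq ι) (x : ι → X) (f : ι → StrongDual ℂ X),
        (∀ i j, f j (x i) = if i = j then 1 else 0) ∧
        (∀ (s : ι → ℤˣ) (σ : Equiv.Perm ι) (y : X),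
          ‖∑ i, ((s i : ℤ) : ℂ) • f (σ i) y • x i‖ ≤ C * ‖y‖) ∧
        (∀ y ∈ F, ∃ c : ι → ℂ, ‖y - ∑ i, c i • x i‖ ≤ ε) ∧
        (∀ φ ∈ Φ, ∃ c : ι → ℂ, ‖φ - ∑ i, c i • f i‖ ≤ ε)) :
    HasPropertyA X := by
  -- The pointwise estimate does not force `C ≥ 0`, whereas a bound for an operator norm must be
  -- nonnegative.
  refine HasPropertyA.of_biorthogonalSystem (max C 0) fun F Φ ε hε => ?_
  obtain ⟨ι, _, _, x, f, hxf, hC, hF, hΦ⟩ := h F Φ ε hε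
  let e := (Fintype.equivFin ι).symm
  refine ⟨Fintype.card ι, ⟨fun i => x (e i), fun i => f (e i), fun i j => ?_⟩, ?_, ?_, ?_⟩
  · simp [hxf]
  · intro s σ
    refine ContinuousLinearMap.opNorm_le_bound _ (le_max_right _ _) fun y => ?_
    refine le_trans ?_ ((hC (fun i => s (e.symm i)) ((e.symm.trans σ).trans e) y).trans
      (by gcongr; exact le_max_left _ _))
    rw [BiorthogonalSystem.lift_signedPermMatrix_apply, ← Equiv.sum_comp e]
    simp
  · intro y hy
    obtain ⟨c, hc⟩ := hF y hy
    refine ⟨fun i => c (e i), ?_⟩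
    rwa [Equiv.sum_comp e fun i => c i • x i]
  · intro φ hφ
    obtain ⟨c, hc⟩ := hΦ φ hφ
    refine ⟨fun i => c (e i), ?_⟩
    rwa [Equiv.sum_comp e fun i => c i • f i]

/-! ### Bounded densities of functionals on `L¹`. -/

section L1Dual

variable {Ω : Type*} [MeasurableSpace Ω]

/-- The inclusion of `L²` into `L¹` for a finite measure. -/
theorem exists_L2_to_L1 (ν : Measure Ω) [IsFiniteMeasure ν] :
    ∃ T : Lp ℂ 2 ν →L[ℂ] Lp ℂ 1 ν, ∀ y, T y =ᵐ[ν] y := by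
  have h12 : (1 : ℝ≥0∞) ≤ 2 := one_le_two
  let T : Lp ℂ 2 ν →ₗ[ℂ] Lp ℂ 1 ν :=
    { toFun := fun y => ((Lp.memLp y).mono_exponent h12).toLp y
      map_add' := fun y z => by
        rw [← MemLp.toLp_add]
        exact MemLp.toLp_congr _ _ (Lp.coeFn_add y z)
      map_smul' := fun c y => by
        rw [RingHom.id_apply, ← MemLp.toLp_const_smul]
        exact MemLp.toLp_congr _ _ (Lp.coeFn_smul c y) }
  refine ⟨T.mkContinuous ((ν Set.univ ^ (1 / (1 : ℝ≥0∞).toReal - 1 / (2 : ℝ≥0∞).toReal)).toReal)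
    fun y => ?_, fun y => ((Lp.memLp y).mono_exponent h12).coeFn_toLp⟩
  change ‖((Lp.memLp y).mono_exponent h12).toLp y‖ ≤ _
  rw [Lp.norm_toLp, Lp.norm_def, mul_comm, ← ENNReal.toReal_mul]
  refine ENNReal.toReal_mono ?_ (eLpNorm_le_eLpNorm_mul_rpow_measure_univ h12
    (Lp.aestronglyMeasurable y))
  refine ENNReal.mul_ne_top (Lp.eLpNorm_ne_top y) (ENNReal.rpow_ne_top_of_nonneg ?_ ?_)
  · norm_num
  · exact measure_ne_top ν _

/-- A function whose integrals over measurable sets are bounded by multiples of the measure is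
essentially bounded. -/
theorem ae_norm_le_of_norm_setIntegral_le {ν : Measure Ω} [IsFiniteMeasure ν] {h : Ω → ℂ}
    (hi : Integrable h ν) (C : ℝ)
    (hC : ∀ s, MeasurableSet s → ‖∫ x in s, h x ∂ν‖ ≤ C * ν.real s) :
    ∀ᵐ x ∂ν, ‖h x‖ ≤ 2 * C := by
  -- Used for `c = ±1, ±i`: real and imaginary parts are each at most `C` in modulus, which explains
  -- the factor `2`.
  have key : ∀ c : ℂ, ‖c‖ = 1 → ∀ᵐ x ∂ν, (c * h x).re ≤ C := by
    intro c hc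
    refine ae_le_of_forall_setIntegral_le (hi.const_mul c).re (integrable_const C) fun s hs _ => ?_
    have h1 : ∫ x in s, (c * h x).re ∂ν = (c * ∫ x in s, h x ∂ν).re := by
      rw [← integral_const_mul]
      exact integral_re (hi.const_mul c).integrableOn
    rw [h1]
    refine (Complex.re_le_norm _).trans ?_
    rw [norm_mul, hc, one_mul]
    refine (hC s hs).trans (le_of_eq ?_)
    simp [mul_comm]
  filter_upwards [key 1 (by simp), key (-1) (by simp), key Complex.I (by simp),
    key (-Complex.I) (by simp)] with x h1 h2 h3 h4
  simp only [one_mul, neg_mul, Complex.neg_re, Complex.mul_re, Complex.I_re, Complex.I_im,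
    zero_mul, zero_sub, neg_neg] at h1 h2 h3 h4
  refine (Complex.norm_le_abs_re_add_abs_im _).trans ?_
  have := abs_le.2 ⟨by linarith, h1⟩
  have := abs_le.2 ⟨by linarith, h4⟩
  linarith

/-- Functionals on `L¹` of a finite measure are given by bounded measurable functions. -/
theorem exists_density_of_isFiniteMeasure (ν : Measure Ω) [IsFiniteMeasure ν]
    (φ : StrongDual ℂ (Lp ℂ 1 ν)) :
    ∃ h : Ω → ℂ, Measurable h ∧ (∀ x, ‖h x‖ ≤ 2 * ‖φ‖) ∧
      ∀ y : Lp ℂ 1 ν, φ y = ∫ x, h x * y x ∂ν := by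
  obtain ⟨T, hT⟩ := exists_L2_to_L1 ν
  -- `L²` of a finite measure maps into `L¹`, so the Riesz representation in Hilbert space yields a
  -- density; testing on indicators bounds it afterwards.
  let g : Lp ℂ 2 ν := (InnerProductSpace.toDual ℂ (Lp ℂ 2 ν)).symm (φ.comp T)
  have hg : ∀ y, φ (T y) = inner ℂ g y := fun y => by simp [g]
  have hTind : ∀ (s : Set Ω) (hs : MeasurableSet s) (c : ℂ),
      T (indicatorConstLp 2 hs (measure_ne_top ν s) c) =
        indicatorConstLp 1 hs (measure_ne_top ν s) c := by
    intro s hs c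
    refine Lp.ext ?_
    filter_upwards [hT (indicatorConstLp 2 hs (measure_ne_top ν s) c),
      indicatorConstLp_coeFn (p := 2) (hs := hs) (hμs := measure_ne_top ν s) (c := c),
      indicatorConstLp_coeFn (p := 1) (hs := hs) (hμs := measure_ne_top ν s) (c := c)]
      with x h1 h2 h3
    rw [h1, h2, h3]
  let h₀ : Ω → ℂ := fun x => star (g x)
  have hgi : Integrable g ν := (Lp.memLp g).integrable one_le_two
  have hi : Integrable h₀ ν := (Complex.conjLIE.toContinuousLinearEquiv :
    ℂ →L[ℝ] ℂ).integrable_comp hgi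
  have hφind : ∀ (s : Set Ω) (hs : MeasurableSet s) (c : ℂ),
      φ (indicatorConstLp 1 hs (measure_ne_top ν s) c) = c * ∫ x in s, h₀ x ∂ν := by
    intro s hs c
    rw [← hTind, hg, ← inner_conj_symm, L2.inner_indicatorConstLp_eq_setIntegral_inner,
      ← integral_conj, ← integral_const_mul]
    refine integral_congr_ae (ae_of_all _ fun x => ?_)
    simp [h₀, mul_comm]
  have hbound := ae_norm_le_of_norm_setIntegral_le hi ‖φ‖ fun s hs => by
    have h1 := hφind s hs 1
    rw [one_mul] at h1
    rw [← h1]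
    refine (φ.le_opNorm _).trans ?_
    gcongr
    rw [norm_indicatorConstLp one_ne_zero ENNReal.one_ne_top]
    simp
  let h₁ := hi.1.mk h₀
  have h₁m : Measurable h₁ := hi.1.measurable_mk
  -- The bound fails only on a null set; cutting that set off makes it hold everywhere.
  let h : Ω → ℂ := {x | ‖h₁ x‖ ≤ 2 * ‖φ‖}.indicator h₁
  have hS : MeasurableSet {x | ‖h₁ x‖ ≤ 2 * ‖φ‖} := measurableSet_le h₁m.norm measurable_const
  have hm : Measurable h := h₁m.indicator hS
  have hle : ∀ x, ‖h x‖ ≤ 2 * ‖φ‖ := by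
    intro x
    by_cases hx : ‖h₁ x‖ ≤ 2 * ‖φ‖
    · simp [h, hx]
    · simp [h, hx]
  have hae : h =ᵐ[ν] h₀ := by
    filter_upwards [hbound, hi.1.ae_eq_mk] with x hx1 hx2
    have : ‖h₁ x‖ ≤ 2 * ‖φ‖ :=
      (congrArg norm hx2).symm.trans_le hx1
    simp only [h, Set.indicator, Set.mem_ofPred_eq, this, if_true]
    exact hx2.symm
  have hLp : MemLp h ∞ ν := memLp_top_of_bound hm.aestronglyMeasurable _ (ae_of_all _ hle)
  let Ψ : StrongDual ℂ (Lp ℂ 1 ν) :=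
    (ContinuousLinearMap.mul ℂ ℂ).lpPairing ν ∞ 1 (hLp.toLp h)
  have hΨ : ∀ y, Ψ y = ∫ x, h x * y x ∂ν := by
    intro y
    rw [ContinuousLinearMap.lpPairing_eq_integral]
    refine integral_congr_ae ?_
    filter_upwards [hLp.coeFn_toLp] with x hx
    simp [hx]
  refine ⟨h, hm, hle, fun y => ?_⟩
  rw [← hΨ]
  induction y using Lp.induction ENNReal.one_ne_top with
  | indicatorConst c hs hμs =>
    rename_i s
    rw [Lp.simpleFunc.coe_indicatorConst, hφind s hs c, hΨ, ← integral_const_mul,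
      ← integral_indicator hs]
    refine integral_congr_ae ?_
    filter_upwards [hae, indicatorConstLp_coeFn (p := 1) (hs := hs) (hμs := hμs.ne) (c := c)]
      with x h1 h2
    rw [h1, h2]
    by_cases hx : x ∈ s <;> simp [hx, mul_comm]
  | add hf hg _ h1 h2 => rw [map_add, map_add, h1, h2]
  | isClosed => exact isClosed_eq φ.continuous Ψ.continuous

/-- A functional on `L¹(μ)` is given by a bounded measurable function on the functions that live
on the support of a fixed integrable function `w`. -/
theorem exists_density_on_support {μ : Measure Ω} (φ : StrongDual ℂ (Lp ℂ 1 μ))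
    (w : Ω → ℂ) (hw : Integrable w μ) :
    ∃ h : Ω → ℂ, Measurable h ∧ (∀ x, ‖h x‖ ≤ 2 * ‖φ‖) ∧
      ∀ y : Lp ℂ 1 μ, (∀ᵐ x ∂μ, w x = 0 → y x = 0) → φ y = ∫ x, h x * y x ∂μ := by
  have hwm : StronglyMeasurable (hw.1.mk w) := hw.1.stronglyMeasurable_mk
  let d : Ω → NNReal := fun x => ‖hw.1.mk w x‖₊
  have hd : Measurable d := hwm.measurable.nnnorm
  -- The measure `|w| μ` is finite, and multiplication by `|w|` maps its `L¹` isometrically into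
  -- `L¹(μ)`, reaching every function that vanishes where `w` does.
  let ν := μ.withDensity fun x => d x
  have hfin : IsFiniteMeasure ν := by
    refine isFiniteMeasure_withDensity ?_
    have := (hw.congr hw.1.ae_eq_mk).2
    exact this.ne
  let T : Lp ℂ 1 ν →L[ℂ] Lp ℂ 1 μ := LinearMap.mkContinuous
    { toFun := withDensitySMulLI (E := ℂ) μ hd
      map_add' := map_add _
      map_smul' := fun c y => by
        have hy := memL1_smul_of_L1_withDensity hd y
        simp only [withDensitySMulLI_apply, RingHom.id_apply]
        rw [← MemLp.toLp_const_smul]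
        refine MemLp.toLp_congr _ _ ?_
        filter_upwards [(ae_withDensity_iff hd.coe_nnreal_ennreal).1 (Lp.coeFn_smul c y)]
          with x hx
        rcases eq_or_ne (d x) 0 with h0 | h0
        · simp [h0]
        · rw [hx (by simpa using h0)]
          simp only [Pi.smul_apply]
          rw [smul_comm] } 1 fun y => by
        rw [one_mul]
        exact ((withDensitySMulLI (E := ℂ) μ hd).norm_map y).le
  have hTn : ∀ y, ‖T y‖ ≤ 1 * ‖y‖ := fun y => by
    rw [one_mul]
    exact ((withDensitySMulLI (E := ℂ) μ hd).norm_map y).le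
  have hTa : ∀ y, T y =ᵐ[μ] fun x => d x • y x := fun y =>
    (memL1_smul_of_L1_withDensity hd y).coeFn_toLp
  obtain ⟨h, hm, hb, hh⟩ := exists_density_of_isFiniteMeasure ν (φ.comp T)
  refine ⟨h, hm, fun x => (hb x).trans ?_, fun y hy => ?_⟩
  · gcongr
    refine (ContinuousLinearMap.opNorm_comp_le _ _).trans ?_
    have := T.opNorm_le_bound zero_le_one hTn
    exact mul_le_of_le_one_right (norm_nonneg _) this
  · have hdy : ∀ᵐ x ∂μ, d x • ((d x)⁻¹ • y x) = y x := by
      filter_upwards [hy, hw.1.ae_eq_mk] with x h1 h2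
      rcases eq_or_ne (d x) 0 with h0 | h0
      · have : w x = 0 := by rw [h2]; simpa [d] using h0
        simp [h1 this]
      · rw [smul_smul, mul_inv_cancel₀ h0, one_smul]
    have hyL : Integrable (fun x => (d x)⁻¹ • y x) ν := by
      rw [integrable_withDensity_iff_integrable_smul hd]
      exact (L1.integrable_coeFn y).congr (hdy.mono fun x hx => hx.symm)
    have hyT : T (hyL.toL1 _) = y := by
      refine Lp.ext ?_
      filter_upwards [hTa (hyL.toL1 _), hdy,
        (ae_withDensity_iff hd.coe_nnreal_ennreal).1 hyL.coeFn_toL1] with x h1 h2 h3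
      rw [h1, ← h2]
      rcases eq_or_ne (d x) 0 with h0 | h0
      · simp [h0]
      · rw [h3 (by simpa using h0)]
    have := hh (hyL.toL1 _)
    rw [ContinuousLinearMap.comp_apply, hyT] at this
    rw [this, integral_withDensity_eq_integral_smul hd]
    refine integral_congr_ae ?_
    filter_upwards [hdy, (ae_withDensity_iff hd.coe_nnreal_ennreal).1 hyL.coeFn_toL1] with x h2 h3
    rcases eq_or_ne (d x) 0 with h0 | h0
    · rw [← h2]; simp [h0]
    · rw [h3 (by simpa using h0), ← mul_smul_comm, h2]

end L1Dual

/-! ### Rounding complex values to a finite set. -/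

section Rounding

/-- A simple function on `ℂ` approximating the identity on a disc. -/
theorem exists_simpleFunc_norm_sub_le (M : ℝ) {ε : ℝ} (hε : 0 < ε) :
    ∃ r : SimpleFunc ℂ ℂ, ∀ z, ‖z‖ ≤ M → ‖r z - z‖ ≤ ε := by
  obtain ⟨t, ht⟩ := (isCompact_closedBall (0 : ℂ) M).elim_finite_subcover
    (fun k : ℕ => Metric.ball (TopologicalSpace.denseSeq ℂ k) ε) (fun _ => Metric.isOpen_ball)
    (fun z _ => by
      obtain ⟨k, hk⟩ := (TopologicalSpace.denseRange_denseSeq ℂ).exists_dist_lt z hε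
      exact Set.mem_iUnion.2 ⟨k, hk⟩)
  refine ⟨SimpleFunc.nearestPt (TopologicalSpace.denseSeq ℂ) (t.sup id), fun z hz => ?_⟩
  obtain ⟨k, hk, hz'⟩ := Set.mem_iUnion₂.1 (ht (mem_closedBall_zero_iff.2 hz))
  have h1 := SimpleFunc.edist_nearestPt_le (TopologicalSpace.denseSeq ℂ) z
    (Finset.le_sup (f := id) hk)
  rw [← dist_eq_norm]
  rw [edist_dist, edist_dist, ENNReal.ofReal_le_ofReal_iff dist_nonneg] at h1
  refine h1.trans ?_
  rw [dist_comm]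
  exact (Metric.mem_ball.1 hz').le

end Rounding

/-! ### Coherent cells for `L¹` of an arbitrary measure. -/

section CellMap

variable {Ω : Type*} [MeasurableSpace Ω] {μ : Measure Ω} {S : Type*}

/-- A family of measurable maps into `S`, indexed by the integrable functions, which are defined
on the supports of these functions and agree where the supports overlap. -/
structure CellMap (μ : Measure Ω) (S : Type*) where
  toFun : Lp ℂ 1 μ → Ω → S
  measurableSet_preimage : ∀ y v, MeasurableSet (toFun y ⁻¹' {v})
  ae_eq : ∀ y u : Lp ℂ 1 μ, (∀ᵐ x ∂μ, u x = 0 → y x = 0) →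
    ∀ᵐ x ∂μ, y x ≠ 0 → toFun y x = toFun u x

namespace CellMap

variable (C : CellMap μ S)

/-- The two cells agree almost everywhere off the zeros of `y`, and at the zeros the integrand
vanishes. Hence several functions can be tested on the cells of one common `u`. -/
theorem setIntegral_eq {y u : Lp ℂ 1 μ} (h : ∀ᵐ x ∂μ, u x = 0 → y x = 0) (v : S) :
    ∫ x in C.toFun y ⁻¹' {v}, y x ∂μ = ∫ x in C.toFun u ⁻¹' {v}, y x ∂μ := by
  rw [← integral_indicator (C.measurableSet_preimage _ _),
    ← integral_indicator (C.measurableSet_preimage _ _)]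
  refine integral_congr_ae ?_
  filter_upwards [C.ae_eq y u h] with x hx
  by_cases h0 : y x = 0
  · simp [Set.indicator, h0]
  · have : x ∈ C.toFun y ⁻¹' {v} ↔ x ∈ C.toFun u ⁻¹' {v} := by
      rw [Set.mem_preimage, Set.mem_preimage, hx h0]
    by_cases hxm : x ∈ C.toFun y ⁻¹' {v}
    · rw [Set.indicator_of_mem hxm, Set.indicator_of_mem (this.1 hxm)]
    · rw [Set.indicator_of_notMem hxm, Set.indicator_of_notMem fun h => hxm (this.2 h)]

theorem norm_setIntegral_le (y : Lp ℂ 1 μ) (s : Set Ω) : ‖∫ x in s, y x ∂μ‖ ≤ ‖y‖ := by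
  refine (norm_integral_le_integral_norm _).trans ?_
  rw [L1.norm_eq_integral_norm]
  exact setIntegral_le_integral (L1.integrable_coeFn y).norm (ae_of_all _ fun _ => norm_nonneg _)

/-- The functional integrating over the cell `v`. -/
noncomputable def functional (v : S) : StrongDual ℂ (Lp ℂ 1 μ) :=
  LinearMap.mkContinuous
    { toFun := fun y => ∫ x in C.toFun y ⁻¹' {v}, y x ∂μ
      map_add' := fun y z => by
        -- `|y| + |z|` vanishes only where `y` and `z` both do, so its cells serve `y`, `z` and `y +
        -- z` together and additivity becomes that of one integral.
        have hi : Integrable (fun x => ((‖y x‖ + ‖z x‖ : ℝ) : ℂ)) μ :=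
          ((L1.integrable_coeFn y).norm.add (L1.integrable_coeFn z).norm).ofReal
        let u : Lp ℂ 1 μ := hi.toL1 _
        have hu : ∀ᵐ x ∂μ, u x = 0 → y x = 0 ∧ z x = 0 := by
          filter_upwards [hi.coeFn_toL1] with x hx h0
          rw [hx, Complex.ofReal_eq_zero] at h0
          have h1 := norm_nonneg (y x)
          have h2 := norm_nonneg (z x)
          exact ⟨norm_eq_zero.1 (by linarith), norm_eq_zero.1 (by linarith)⟩
        have hyz : ∀ᵐ x ∂μ, u x = 0 → (y + z) x = 0 := by
          filter_upwards [hu, Lp.coeFn_add y z] with x h1 h2 h0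
          rw [h2, Pi.add_apply, (h1 h0).1, (h1 h0).2, add_zero]
        rw [C.setIntegral_eq hyz, C.setIntegral_eq (hu.mono fun x hx h0 => (hx h0).1),
          C.setIntegral_eq (hu.mono fun x hx h0 => (hx h0).2),
          ← integral_add (L1.integrable_coeFn y).integrableOn (L1.integrable_coeFn z).integrableOn]
        exact integral_congr_ae (ae_restrict_of_ae (Lp.coeFn_add y z))
      map_smul' := fun c y => by
        have h : ∀ᵐ x ∂μ, y x = 0 → (c • y) x = 0 := by
          filter_upwards [Lp.coeFn_smul c y] with x h1 h0
          rw [h1, Pi.smul_apply, h0, smul_zero]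
        rw [C.setIntegral_eq h, RingHom.id_apply, ← integral_smul]
        exact integral_congr_ae (ae_restrict_of_ae (Lp.coeFn_smul c y)) } 1 fun y => by
      rw [one_mul]
      exact norm_setIntegral_le y _

theorem functional_apply (v : S) (y : Lp ℂ 1 μ) :
    C.functional v y = ∫ x in C.toFun y ⁻¹' {v}, y x ∂μ := rfl

theorem sum_norm_setIntegral [Fintype S] (y : Lp ℂ 1 μ) :
    ∑ v, ∫ x in C.toFun y ⁻¹' {v}, ‖y x‖ ∂μ = ‖y‖ := by
  rw [← integral_iUnion_fintype (fun v => C.measurableSet_preimage y v) (fun v v' h => ?_)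
    (fun v => (L1.integrable_coeFn y).norm.integrableOn), ← Set.preimage_iUnion]
  · rw [L1.norm_eq_integral_norm, Set.iUnion_of_singleton, Set.preimage_univ, setIntegral_univ]
  · exact (Set.disjoint_singleton.2 h).preimage _

theorem sum_norm_functional_le [Fintype S] (y : Lp ℂ 1 μ) :
    ∑ v, ‖C.functional v y‖ ≤ ‖y‖ := by
  rw [← C.sum_norm_setIntegral y]
  exact Finset.sum_le_sum fun v _ => norm_integral_le_integral_norm _

theorem integrable_part (u : Lp ℂ 1 μ) (v : S) :
    Integrable ((C.toFun u ⁻¹' {v}).indicator fun x => ((‖u x‖ : ℝ) : ℂ)) μ :=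
  (L1.integrable_coeFn u).norm.ofReal.indicator (C.measurableSet_preimage _ _)

/-- The restriction of the modulus of `u` to the cell `v`. -/
noncomputable def part (u : Lp ℂ 1 μ) (v : S) : Lp ℂ 1 μ := (C.integrable_part u v).toL1 _

theorem coeFn_part (u : Lp ℂ 1 μ) (v : S) :
    C.part u v =ᵐ[μ] (C.toFun u ⁻¹' {v}).indicator fun x => ((‖u x‖ : ℝ) : ℂ) :=
  (C.integrable_part u v).coeFn_toL1

theorem norm_part (u : Lp ℂ 1 μ) (v : S) :
    ‖C.part u v‖ = ∫ x in C.toFun u ⁻¹' {v}, ‖u x‖ ∂μ := by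
  rw [L1.norm_eq_integral_norm, ← integral_indicator (C.measurableSet_preimage _ _)]
  refine integral_congr_ae ?_
  filter_upwards [C.coeFn_part u v] with x hx
  rw [hx]
  by_cases h : x ∈ C.toFun u ⁻¹' {v}
  · rw [Set.indicator_of_mem h, Set.indicator_of_mem h]; simp
  · rw [Set.indicator_of_notMem h, Set.indicator_of_notMem h, norm_zero]

theorem functional_part [DecidableEq S] (u : Lp ℂ 1 μ) (v v' : S) :
    C.functional v' (C.part u v) = if v = v' then (‖C.part u v‖ : ℂ) else 0 := by
  have h : ∀ᵐ x ∂μ, u x = 0 → C.part u v x = 0 := by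
    filter_upwards [C.coeFn_part u v] with x hx h0
    rw [hx, Set.indicator_apply_eq_zero]
    simp [h0]
  rw [functional_apply, C.setIntegral_eq h, C.norm_part, ← integral_complex_ofReal,
    setIntegral_congr_ae (C.measurableSet_preimage u v')
      ((C.coeFn_part u v).mono fun x hx _ => hx)]
  split_ifs with hv
  · subst hv
    refine setIntegral_congr_fun (C.measurableSet_preimage u v) fun x hx => ?_
    exact Set.indicator_of_mem hx _
  · refine setIntegral_eq_zero_of_forall_eq_zero fun x hx => ?_
    refine Set.indicator_of_notMem (fun hx' => hv ?_) _
    rw [Set.mem_preimage, Set.mem_singleton_iff] at hx hx'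
    rw [← hx, ← hx']

/-- The integral of `y` over its cell is at most the norm of the part of `y` there. So cells that
carry no nonzero part can be dropped from the system. -/
theorem functional_eq_zero {v : S} (h : ∀ u, C.part u v = 0) : C.functional v = 0 := by
  ext y
  rw [functional_apply, zero_apply, ← norm_le_zero_iff]
  refine (norm_integral_le_integral_norm _).trans (le_of_eq ?_)
  rw [← C.norm_part, h, norm_zero]

/-- The unit vectors carried by the cells, together with the integrals over the cells, form a
biorthogonal system; one can prescribe the function `w` that the vectors are made from. -/
theorem exists_unit_vectors [DecidableEq S] (w : Lp ℂ 1 μ) :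
    ∃ x : {v // ∃ u, C.part u v ≠ 0} → Lp ℂ 1 μ, (∀ i, ‖x i‖ = 1) ∧
      (∀ i j, C.functional j.1 (x i) = if i = j then 1 else 0) ∧
      ∀ i, C.part w i.1 = (‖C.part w i.1‖ : ℂ) • x i := by
  -- Normalizing a part of `w` itself wherever it is nonzero puts all parts of `w` into the span of
  -- the unit vectors.
  have h : ∀ i : {v // ∃ u, C.part u v ≠ 0}, ∃ u, C.part u i.1 ≠ 0 ∧
      (C.part w i.1 ≠ 0 → u = w) := by
    rintro ⟨v, u, hu⟩
    by_cases hw : C.part w v = 0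
    · exact ⟨u, hu, fun h => absurd hw h⟩
    · exact ⟨w, hw, fun _ => rfl⟩
  choose u hu huw using h
  have hn : ∀ i, (‖C.part (u i) i.1‖ : ℂ) ≠ 0 := fun i => by
    exact_mod_cast norm_ne_zero_iff.2 (hu i)
  refine ⟨fun i => (‖C.part (u i) i.1‖ : ℂ)⁻¹ • C.part (u i) i.1, fun i => ?_, fun i j => ?_,
    fun i => ?_⟩
  · rw [norm_smul, norm_inv, Complex.norm_real, norm_norm]
    exact inv_mul_cancel₀ (norm_ne_zero_iff.2 (hu i))
  · rw [map_smul, C.functional_part]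
    by_cases hij : i = j
    · subst hij
      simp [hn i]
    · have : i.1 ≠ j.1 := fun h => hij (Subtype.ext h)
      simp [hij, this]
  · by_cases hw : C.part w i.1 = 0
    · simp [hw]
    · have := huw i hw
      have hn' := hn i
      beta_reduce
      rw [this] at hn' ⊢
      rw [smul_smul, mul_inv_cancel₀ hn', one_smul]

theorem integral_apply_mul [Fintype S] (c : S → ℂ) (y : Lp ℂ 1 μ) :
    Integrable (fun x => c (C.toFun y x) * y x) μ ∧
    ∫ x, c (C.toFun y x) * y x ∂μ = ∑ v, c v * C.functional v y := by
  have hcell : ∀ v, Set.EqOn (fun x => c (C.toFun y x) * y x) (fun x => c v * y x)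
      (C.toFun y ⁻¹' {v}) := fun v x hx => by
    rw [Set.mem_preimage, Set.mem_singleton_iff] at hx
    simp only [hx]
  have hint : ∀ v, IntegrableOn (fun x => c (C.toFun y x) * y x) (C.toFun y ⁻¹' {v}) μ := by
    intro v
    rw [integrableOn_congr_fun (hcell v) (C.measurableSet_preimage y v)]
    exact ((L1.integrable_coeFn y).const_mul _).integrableOn
  have hU : (⋃ v, C.toFun y ⁻¹' {v}) = Set.univ := by
    rw [← Set.preimage_iUnion, Set.iUnion_of_singleton, Set.preimage_univ]
  constructor
  · rw [← integrableOn_univ, ← hU]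
    exact integrableOn_finite_iUnion.2 hint
  · rw [← setIntegral_univ, ← hU, integral_iUnion_fintype
      (fun v => C.measurableSet_preimage y v) (fun v v' h => ?_) hint]
    · refine Finset.sum_congr rfl fun v _ => ?_
      rw [functional_apply, ← integral_const_mul]
      exact setIntegral_congr_fun (C.measurableSet_preimage y v) (hcell v)
    · exact (Set.disjoint_singleton.2 h).preimage _

/-- The combination has density `c ∘ C.toFun y` against `y`, so uniform closeness of densities
bounds the norm, as if the dual of `L¹` were `L∞`. -/
theorem norm_sub_sum_smul_functional_le [Fintype S] (φ : StrongDual ℂ (Lp ℂ 1 μ)) (c : S → ℂ)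
    {δ : ℝ} (hδ : 0 ≤ δ)
    (h : ∀ y : Lp ℂ 1 μ, ∃ h : Ω → ℂ, Measurable h ∧ (∃ M, ∀ x, ‖h x‖ ≤ M) ∧
      (∀ x, ‖c (C.toFun y x) - h x‖ ≤ δ) ∧ φ y = ∫ x, h x * y x ∂μ) :
    ‖φ - ∑ v, c v • C.functional v‖ ≤ δ := by
  refine ContinuousLinearMap.opNorm_le_bound _ hδ fun y => ?_
  obtain ⟨h, hm, ⟨M, hM⟩, hle, hφ⟩ := h y
  have h1 := C.integral_apply_mul c y
  have h2 : (φ - ∑ v, c v • C.functional v) y =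
      ∫ x, (h x * y x - c (C.toFun y x) * y x) ∂μ := by
    rw [integral_sub ((L1.integrable_coeFn y).bdd_mul hm.aestronglyMeasurable (ae_of_all _ hM))
      h1.1, h1.2, ← hφ]
    simp
  rw [h2, L1.norm_eq_integral_norm, ← integral_const_mul]
  refine norm_integral_le_of_norm_le ((L1.integrable_coeFn y).norm.const_mul _)
    (ae_of_all _ fun x => ?_)
  rw [← sub_mul, norm_mul, norm_sub_rev]
  gcongr
  exact hle x

theorem coeFn_sum_smul_part [Fintype S] (c : S → ℂ) (w : Lp ℂ 1 μ) :
    (∑ v, c v • C.part w v : Lp ℂ 1 μ) =ᵐ[μ] fun x => c (C.toFun w x) * ‖w x‖ := by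
  have h1 : (∑ v, c v • C.part w v : Lp ℂ 1 μ) =ᵐ[μ] fun x => ∑ v, c v * C.part w v x := by
    filter_upwards [Lp.coeFn_finsetSum Finset.univ fun v => c v • C.part w v,
      ae_all_iff.2 fun v => Lp.coeFn_smul (c v) (C.part w v)] with x h1 h2
    rw [h1, Finset.sum_apply]
    exact Finset.sum_congr rfl fun v _ => h2 v
  filter_upwards [h1, ae_all_iff.2 fun v => C.coeFn_part w v] with x hx hp
  rw [hx, Finset.sum_eq_single (C.toFun w x)]
  · rw [hp, Set.indicator_of_mem (by simp)]
  · intro v _ hv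
    rw [hp, Set.indicator_of_notMem, mul_zero]
    exact fun h => hv (Set.mem_singleton_iff.1 h).symm
  · simp

end CellMap

/-- A bounded function is determined on the support of an integrable function `y` by its integrals
against the functions that live on this support. -/
theorem ae_mul_eq_of_forall_integral_eq {h h' : Ω → ℂ} (hm : Measurable h) (hm' : Measurable h')
    (hb : ∃ M, ∀ x, ‖h x‖ ≤ M) (hb' : ∃ M, ∀ x, ‖h' x‖ ≤ M) (y : Lp ℂ 1 μ)
    (H : ∀ z : Lp ℂ 1 μ, (∀ᵐ x ∂μ, y x = 0 → z x = 0) → ∫ x, h x * z x ∂μ = ∫ x, h' x * z x ∂μ) :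
    ∀ᵐ x ∂μ, h x * y x = h' x * y x := by
  have hint : ∀ g : Ω → ℂ, Measurable g → (∃ M, ∀ x, ‖g x‖ ≤ M) →
      Integrable (fun x => g x * y x) μ := fun g hg ⟨M, hM⟩ =>
    (L1.integrable_coeFn y).bdd_mul hg.aestronglyMeasurable (ae_of_all _ hM)
  refine Integrable.ae_eq_of_forall_setIntegral_eq _ _ (hint h hm hb) (hint h' hm' hb')
    fun s hs _ => ?_
  have hi := (L1.integrable_coeFn y).indicator hs
  have hae := hi.coeFn_toL1
  have e : ∀ g : Ω → ℂ, ∫ x, g x * (hi.toL1 _) x ∂μ = ∫ x in s, g x * y x ∂μ := by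
    intro g
    rw [← integral_indicator hs]
    refine integral_congr_ae ?_
    filter_upwards [hae] with x hx
    rw [hx]
    by_cases hxs : x ∈ s <;> simp [hxs]
  rw [← e, ← e]
  refine H _ ?_
  filter_upwards [hae] with x hx h0
  rw [hx, Set.indicator_apply_eq_zero]
  exact fun _ => h0

/-- Finitely many functionals on `L¹` have uniformly small oscillation on the cells of a finite
cell map. -/
theorem exists_cellMap {J : Type*} [Fintype J] (Θ : J → StrongDual ℂ (Lp ℂ 1 μ)) {ε : ℝ}
    (hε : 0 < ε) :
    ∃ (R : Finset ℂ) (C : CellMap μ (J → R)), ∀ (y : Lp ℂ 1 μ) (j : J),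
      ∃ h : Ω → ℂ, Measurable h ∧ (∃ M, ∀ x, ‖h x‖ ≤ M) ∧
        (∀ x, ‖(C.toFun y x j : ℂ) - h x‖ ≤ ε) ∧
        ∀ z : Lp ℂ 1 μ, (∀ᵐ x ∂μ, y x = 0 → z x = 0) → Θ j z = ∫ x, h x * z x ∂μ := by
  have hdens := fun (y : Lp ℂ 1 μ) (j : J) =>
    exists_density_on_support (Θ j) y (L1.integrable_coeFn y)
  choose h hm hb hh using hdens
  -- The radius bounds all the densities at once, so a single rounding serves every functional and
  -- every support.
  obtain ⟨r, hr⟩ := exists_simpleFunc_norm_sub_le (∑ j, 2 * ‖Θ j‖) hε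
  have hb' : ∀ y j x, ‖h y j x‖ ≤ ∑ j, 2 * ‖Θ j‖ := fun y j x => (hb y j x).trans
    (Finset.single_le_sum (f := fun j => 2 * ‖Θ j‖) (fun i _ => by positivity)
      (Finset.mem_univ j))
  refine ⟨r.range, ⟨fun y x j => ⟨r (h y j x), r.mem_range_self _⟩, fun y v => ?_,
    fun y u hyu => ?_⟩, fun y j => ⟨h y j, hm y j, ⟨_, hb' y j⟩, fun x => hr _ (hb' y j x), hh y j⟩⟩
  · have : (fun x => (fun j => ⟨r (h y j x), r.mem_range_self _⟩ : J → r.range)) ⁻¹' {v} =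
        ⋂ j, (fun x => r (h y j x)) ⁻¹' {(v j : ℂ)} := by
      ext x
      simp [funext_iff, Subtype.ext_iff]
    rw [this]
    exact MeasurableSet.iInter fun j => (r.measurable.comp (hm y j)) (measurableSet_singleton _)
  · have key : ∀ j, ∀ᵐ x ∂μ, h y j x * y x = h u j x * y x := by
      intro j
      refine ae_mul_eq_of_forall_integral_eq (hm y j) (hm u j) ⟨_, hb' y j⟩ ⟨_, hb' u j⟩ y
        fun z hz => ?_
      rw [← hh y j z hz, ← hh u j]
      filter_upwards [hz, hyu] with x h1 h2 h3
      exact h1 (h2 h3)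
    filter_upwards [ae_all_iff.2 key] with x hx h0
    funext j
    have : h y j x = h u j x := mul_right_cancel₀ h0 (hx j)
    simp [this]

end CellMap

/-! ### Property (𝔸) for `L¹`. -/

section

variable {Ω : Type u} [MeasurableSpace Ω]

theorem hasPropertyA_L1 (μ : Measure Ω) : HasPropertyA (Lp ℂ 1 μ) := by
  classical
  refine HasPropertyA.of_local.{u, u} 1 fun F Φ ε hε => ?_
  let w₀ : Ω → ℝ := fun x => ∑ f ∈ F, ‖f x‖
  have hw₀m : Measurable w₀ :=
    Finset.measurable_fun_sum _ fun f _ => (Lp.stronglyMeasurable f).measurable.norm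
  have hw₀ : Integrable (fun x => (w₀ x : ℂ)) μ :=
    (integrable_finsetSum _ fun f _ => (L1.integrable_coeFn f).norm).ofReal
  have hle : ∀ f ∈ F, ∀ x, ‖f x‖ ≤ w₀ x := fun f hf x =>
    Finset.single_le_sum (f := fun f : Lp ℂ 1 μ => ‖f x‖) (fun _ _ => norm_nonneg _) hf
  let w : Lp ℂ 1 μ := hw₀.toL1 _
  have hw : w =ᵐ[μ] fun x => (w₀ x : ℂ) := hw₀.coeFn_toL1
  -- Each `f` becomes `k f` times the common majorant `w₀`. Where `w₀ = 0` the quotient is `0` by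
  -- convention and `f` vanishes as well.
  let k : F → Ω → ℂ := fun f x => f.1 x / w₀ x
  have hkm : ∀ f, Measurable (k f) := fun f =>
    (Lp.stronglyMeasurable f.1).measurable.div (Complex.measurable_ofReal.comp hw₀m)
  have hk1 : ∀ f x, ‖k f x‖ ≤ 1 := fun f x => by
    have h0 : 0 ≤ w₀ x := Finset.sum_nonneg fun _ _ => norm_nonneg _
    rw [norm_div, Complex.norm_real, Real.norm_of_nonneg h0]
    exact div_le_one_of_le₀ (hle f.1 f.2 x) h0
  have hkw : ∀ f x, k f x * w₀ x = f.1 x := fun f x => by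
    by_cases h0 : (w₀ x : ℂ) = 0
    · rw [h0, mul_zero]
      have := hle f.1 f.2 x
      rw [Complex.ofReal_eq_zero.1 h0] at this
      exact (norm_le_zero_iff.1 this).symm
    · exact div_mul_cancel₀ _ h0
  have hkL : ∀ f, MemLp (k f) ∞ μ := fun f =>
    memLp_top_of_bound (hkm f).aestronglyMeasurable _ (ae_of_all _ (hk1 f))
  -- Treating the quotients as functionals lets one cell map control the oscillation of both the
  -- vectors and the functionals.
  let κ : F → StrongDual ℂ (Lp ℂ 1 μ) := fun f =>
    (ContinuousLinearMap.mul ℂ ℂ).lpPairing μ ∞ 1 ((hkL f).toLp (k f))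
  have hκ : ∀ f y, κ f y = ∫ x, k f x * y x ∂μ := fun f y => by
    rw [ContinuousLinearMap.lpPairing_eq_integral]
    refine integral_congr_ae ?_
    filter_upwards [(hkL f).coeFn_toLp] with x hx
    simp [hx]
  -- The first term serves the functionals; the second serves the vectors, whose error is at most `δ
  -- ‖w‖`.
  have hδ : 0 < min ε (ε / (‖w‖ + 1)) := by positivity
  obtain ⟨R, C, hC⟩ := exists_cellMap
    (Sum.elim κ (fun φ => φ.1) : F ⊕ Φ → StrongDual ℂ (Lp ℂ 1 μ)) hδ
  obtain ⟨x, hx1, hxf, hxw⟩ := C.exists_unit_vectors w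
  refine ⟨{v // ∃ u, C.part u v ≠ 0}, inferInstance, inferInstance, x,
    fun i => C.functional i.1, hxf, fun s σ y => ?_, fun f hf => ?_, fun φ hφ => ?_⟩
  · rw [one_mul]
    -- The vectors have norm one, so it suffices to bound the `ℓ¹` norm of the coordinates, which
    -- signs and permutations preserve.
    refine le_trans ?_ (C.sum_norm_functional_le y)
    calc _ ≤ ∑ i, ‖C.functional (σ i).1 y‖ := by
          refine (norm_sum_le _ _).trans (Finset.sum_le_sum fun i _ => ?_)
          rw [norm_smul, norm_smul, hx1, mul_one]
          refine mul_le_of_le_one_left (norm_nonneg _) ?_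
          rcases Int.units_eq_one_or (s i) with h | h <;> simp [h]
      _ = ∑ i : {v // ∃ u, C.part u v ≠ 0}, ‖C.functional i.1 y‖ :=
          Equiv.sum_comp σ fun i => ‖C.functional i.1 y‖
      _ ≤ _ := by
          rw [← Fintype.sum_subtype_add_sum_subtype (fun v => ∃ u, C.part u v ≠ 0)]
          exact le_add_of_nonneg_right (Finset.sum_nonneg fun _ _ => norm_nonneg _)
  · refine ⟨fun i => (i.1 (Sum.inl ⟨f, hf⟩) : ℂ) * ‖C.part w i.1‖, ?_⟩
    have h1 : ∑ i : {v // ∃ u, C.part u v ≠ 0},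
        ((i.1 (Sum.inl ⟨f, hf⟩) : ℂ) * ‖C.part w i.1‖) • x i =
        ∑ v, (v (Sum.inl ⟨f, hf⟩) : ℂ) • C.part w v := by
      rw [← Fintype.sum_subtype_add_sum_subtype (fun v => ∃ u, C.part u v ≠ 0),
        Finset.sum_eq_zero (s := (Finset.univ : Finset {v // ¬∃ u, C.part u v ≠ 0})), add_zero]
      · refine Finset.sum_congr rfl fun i _ => ?_
        rw [mul_smul, ← hxw]
      · rintro ⟨v, hv⟩ -
        have : C.part w v = 0 := by
          by_contra h
          exact hv ⟨w, h⟩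
        simp [this]
    rw [h1, L1.norm_eq_integral_norm]
    obtain ⟨h, hm, hb, hr, hh⟩ := hC w (Sum.inl ⟨f, hf⟩)
    have hhk := ae_mul_eq_of_forall_integral_eq hm (hkm ⟨f, hf⟩) hb ⟨1, hk1 _⟩ w
      fun z hz => by
        rw [← hh z hz, ← hκ]
        rfl
    calc _ ≤ ∫ x, ε / (‖w‖ + 1) * ‖w x‖ ∂μ := by
          refine integral_mono_ae (L1.integrable_coeFn _).norm
            ((L1.integrable_coeFn w).norm.const_mul _) ?_
          filter_upwards [hw, hhk, Lp.coeFn_sub f (∑ v, (v (Sum.inl ⟨f, hf⟩) : ℂ) • C.part w v),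
            C.coeFn_sum_smul_part (fun v => (v (Sum.inl ⟨f, hf⟩) : ℂ)) w] with x e1 e2 e3 e4
          have h0 : 0 ≤ w₀ x := Finset.sum_nonneg fun _ _ => norm_nonneg _
          have e5 : ((‖w x‖ : ℝ) : ℂ) = w x := by
            rw [e1, Complex.norm_real, Real.norm_of_nonneg h0]
          have e6 : f x = h x * w x := by
            rw [e2, e1]
            exact (hkw ⟨f, hf⟩ x).symm
          rw [e3, Pi.sub_apply, e4, e5, e6, ← sub_mul, norm_mul, norm_sub_rev]
          gcongr
          exact (hr x).trans (min_le_right _ _)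
      _ = ε / (‖w‖ + 1) * ‖w‖ := by rw [integral_const_mul, ← L1.norm_eq_integral_norm]
      _ ≤ ε := by
          rw [div_mul_eq_mul_div, div_le_iff₀ (by positivity)]
          nlinarith [norm_nonneg w]
  · refine ⟨fun i => (i.1 (Sum.inr ⟨φ, hφ⟩) : ℂ), ?_⟩
    have h1 : ∑ i : {v // ∃ u, C.part u v ≠ 0},
        (i.1 (Sum.inr ⟨φ, hφ⟩) : ℂ) • C.functional i.1 =
        ∑ v, (v (Sum.inr ⟨φ, hφ⟩) : ℂ) • C.functional v := by
      rw [← Fintype.sum_subtype_add_sum_subtype (fun v => ∃ u, C.part u v ≠ 0),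
        Finset.sum_eq_zero (s := (Finset.univ : Finset {v // ¬∃ u, C.part u v ≠ 0})), add_zero]
      rintro ⟨v, hv⟩ -
      have : C.functional v = 0 := C.functional_eq_zero (by simpa using hv)
      ext y
      simp [this]
    rw [h1]
    refine (C.norm_sub_sum_smul_functional_le φ (fun v => (v (Sum.inr ⟨φ, hφ⟩) : ℂ)) hδ.le
      fun y => ?_).trans (min_le_left _ _)
    obtain ⟨h, hm, hb, hr, hh⟩ := hC y (Sum.inr ⟨φ, hφ⟩)
    exact ⟨h, hm, hb, hr, hh y (ae_of_all _ fun _ => id)⟩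

end

/-! ### Dominating functionals on `C(K)` by a measure. -/

section RieszDomination

variable {K : Type*} [TopologicalSpace K]

/-- The real parts of the rotations of a complex function, as a function on `Circle × K`. -/
noncomputable def rotationRe : C(K, ℂ) →ₗ[ℝ] C(Circle × K, ℝ) where
  toFun g := ⟨fun p => ((p.1 : ℂ) * g p.2).re, by fun_prop⟩
  map_add' g h := by ext p; simp [mul_add]
  map_smul' c g := by ext p; simp; ring

theorem rotationRe_apply (g : C(K, ℂ)) (p : Circle × K) :
    rotationRe g p = ((p.1 : ℂ) * g p.2).re := rfl

theorem rotationRe_injective : Function.Injective (rotationRe : C(K, ℂ) →ₗ[ℝ] _) := by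
  rw [← LinearMap.ker_eq_bot, LinearMap.ker_eq_bot']
  intro g hg
  ext x
  have h1 := DFunLike.congr_fun hg ((1 : Circle), x)
  have h2 := DFunLike.congr_fun hg (Circle.exp (Real.pi / 2), x)
  simp only [rotationRe_apply, Circle.coe_one, one_mul, Circle.coe_exp, ContinuousMap.zero_apply,
    Complex.ofReal_div, Complex.ofReal_ofNat, Complex.exp_pi_div_two_mul_I] at h1 h2
  simp only [Complex.mul_re, Complex.I_re, Complex.I_im, zero_mul, one_mul, zero_sub,
    neg_eq_zero] at h2
  exact Complex.ext h1 h2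

variable [CompactSpace K]

/-- Rotating `g x` onto the positive axis attains `‖g x‖` as a real part. Thus a one-sided supremum
controls the norm, as the Hahn–Banach majorant requires. -/
theorem norm_le_iSup_rotationRe (g : C(K, ℂ)) : ‖g‖ ≤ ⨆ p, rotationRe g p := by
  have hbdd : BddAbove (Set.range fun p => rotationRe g p) :=
    (isCompact_range (rotationRe g).continuous).bddAbove
  rcases isEmpty_or_nonempty K with hK | hK
  · rw [Real.iSup_of_isEmpty, ContinuousMap.norm_le _ le_rfl]
    exact fun x => isEmptyElim x
  · obtain ⟨x₀⟩ := id hK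
    rw [ContinuousMap.norm_le_of_nonempty]
    intro x
    obtain ⟨c, hc, hcx⟩ := Complex.exists_norm_eq_mul_self (g x)
    refine le_ciSup_of_le hbdd ((⟨c, mem_sphere_zero_iff_norm.2 hc⟩ : Circle), x) ?_
    rw [rotationRe_apply]
    change ‖g x‖ ≤ (c * g x).re
    rw [← hcx, Complex.ofReal_re]

/-- Every functional on `C(K, ℂ)` is dominated by a positive functional. -/
theorem exists_positive_dominating (φ : StrongDual ℂ C(K, ℂ)) :
    ∃ Λ : C(K, ℝ) →ₗ[ℝ] ℝ, (∀ u, 0 ≤ u → 0 ≤ Λ u) ∧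
      ∀ (g : C(K, ℂ)) (u : C(K, ℝ)), (∀ x, ‖g x‖ ≤ u x) → ‖φ g‖ ≤ Λ u := by
  let e := LinearEquiv.ofInjective (rotationRe : C(K, ℂ) →ₗ[ℝ] _) rotationRe_injective
  let f : C(Circle × K, ℝ) →ₗ.[ℝ] ℝ :=
    ⟨LinearMap.range rotationRe, (Complex.reLm.comp (φ.toLinearMap.restrictScalars ℝ)).comp
      e.symm.toLinearMap⟩
  have hf : ∀ g, f ⟨rotationRe g, g, rfl⟩ = (φ g).re := by
    intro g
    change (φ (e.symm ⟨rotationRe g, g, rfl⟩)).re = _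
    congr 2
    exact e.symm_apply_apply g
  have hbdd : ∀ F : C(Circle × K, ℝ), BddAbove (Set.range F) := fun F =>
    (isCompact_range F.continuous).bddAbove
  -- The majorant uses the supremum of `F`, not its norm: it is nonpositive at `-F` for `F ≥ 0`,
  -- which forces the extension to be positive.
  obtain ⟨Λ, hΛ, hΛN⟩ := exists_extension_of_le_sublinear f (fun F => ‖φ‖ * ⨆ p, F p)
    (fun c hc F => by
      simp only [ContinuousMap.smul_apply, smul_eq_mul]
      rw [← Real.mul_iSup_of_nonneg hc.le]
      ring)
    (fun F G => by
      rw [← mul_add]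
      gcongr
      rcases isEmpty_or_nonempty (Circle × K) with hK | hK
      · simp
      · exact ciSup_le fun p => add_le_add (le_ciSup (hbdd F) p) (le_ciSup (hbdd G) p))
    (by
      rintro ⟨_, g, rfl⟩
      rw [hf]
      refine (Complex.re_le_norm _).trans ((φ.le_opNorm g).trans ?_)
      gcongr
      exact norm_le_iSup_rotationRe g)
  have hpos : ∀ F, 0 ≤ F → 0 ≤ Λ F := by
    intro F hF
    have h1 := hΛN (-F)
    rw [map_neg] at h1
    have h2 : ⨆ p, (-F) p ≤ 0 := Real.iSup_nonpos fun p => by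
      simpa using hF p
    nlinarith [norm_nonneg φ]
  let snd : C(Circle × K, K) := ⟨Prod.snd, continuous_snd⟩
  -- The dominating functional is the extension restricted to functions independent of the circle
  -- variable. If `‖g‖ ≤ u` pointwise, every rotated real part of `g` lies below `u`.
  refine ⟨Λ.comp
    ({ toFun := fun u => u.comp snd
       map_add' := fun _ _ => rfl
       map_smul' := fun _ _ => rfl } : C(K, ℝ) →ₗ[ℝ] C(Circle × K, ℝ)), fun u hu => hpos _ fun p => hu p.2, fun g u hgu => ?_⟩
  obtain ⟨c, hc, hcφ⟩ := Complex.exists_norm_eq_mul_self (φ g)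
  have h1 : ‖φ g‖ = Λ (rotationRe (c • g)) := by
    have := hΛ ⟨rotationRe (c • g), c • g, rfl⟩
    rw [this, hf, map_smul, smul_eq_mul, ← hcφ, Complex.ofReal_re]
  have h2 := hpos (u.comp snd - rotationRe (c • g)) fun p => by
    change 0 ≤ u p.2 - ((p.1 : ℂ) * (c * g p.2)).re
    have h3 := (Complex.re_le_norm ((p.1 : ℂ) * (c * g p.2))).trans_eq
      (by rw [norm_mul, norm_mul, hc, Circle.norm_coe, one_mul, one_mul])
    linarith [hgu p.2]
  rw [map_sub] at h2
  rw [h1]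
  exact sub_nonneg.1 h2

variable [MeasurableSpace K] [BorelSpace K]

/-- Finitely many functionals on `C(K, ℂ)` are dominated by the `L¹`-norm of a finite regular
measure. -/
theorem exists_measure_dominating [T2Space K] (Φ : Finset (StrongDual ℂ C(K, ℂ))) :
    ∃ ν : Measure K, ν.Regular ∧ ∀ φ ∈ Φ, ∀ g : C(K, ℂ), ‖φ g‖ ≤ ∫ x, ‖g x‖ ∂ν := by
  choose Λ hΛ hφΛ using fun φ : StrongDual ℂ C(K, ℂ) => exists_positive_dominating φ
  let L : CompactlySupportedContinuousMap K ℝ →ₗ[ℝ] ℝ :=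
    (∑ φ ∈ Φ, Λ φ).comp
      ({ toFun := fun u => u.toContinuousMap
         map_add' := fun _ _ => rfl
         map_smul' := fun _ _ => rfl } : CompactlySupportedContinuousMap K ℝ →ₗ[ℝ] C(K, ℝ))
  have hL : ∀ u, L u = ∑ φ ∈ Φ, Λ φ u.toContinuousMap := fun u => by simp [L]
  let L' := PositiveLinearMap.mk₀ L fun u hu => by
    rw [hL]
    exact Finset.sum_nonneg fun φ _ => hΛ φ _ fun x => hu x
  refine ⟨RealRMK.rieszMeasure L', inferInstance, fun φ hφ g => ?_⟩
  let u : C(K, ℝ) := ⟨fun x => ‖g x‖, by fun_prop⟩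
  have h1 := RealRMK.integral_rieszMeasure L'
    (CompactlySupportedContinuousMap.continuousMapEquiv u)
  have h2 : L' (CompactlySupportedContinuousMap.continuousMapEquiv u) = ∑ φ ∈ Φ, Λ φ u := hL _
  rw [h2] at h1
  change ∫ x, ‖g x‖ ∂_ = _ at h1
  rw [h1]
  refine (hφΛ φ g u fun _ => le_rfl).trans ?_
  exact Finset.single_le_sum (f := fun φ => Λ φ u) (fun ψ _ => hΛ ψ u fun x => norm_nonneg _) hφ

/-- A functional on `C(K, ℂ)` dominated by the `L¹`-norm of a measure has a bounded density. -/
theorem exists_density_of_dominated (ν : Measure K) [IsFiniteMeasure ν]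
    (φ : StrongDual ℂ C(K, ℂ)) (hφ : ∀ g : C(K, ℂ), ‖φ g‖ ≤ ∫ x, ‖g x‖ ∂ν) :
    ∃ h : K → ℂ, Measurable h ∧ (∃ M, ∀ x, ‖h x‖ ≤ M) ∧
      ∀ g : C(K, ℂ), φ g = ∫ x, h x * g x ∂ν := by
  let T : C(K, ℂ) →L[ℂ] Lp ℂ 1 ν := ContinuousMap.toLp 1 ν ℂ
  have hT : ∀ g, T g =ᵐ[ν] g := fun g => ContinuousMap.coeFn_toLp ν g
  have hTn : ∀ g, ∫ x, ‖g x‖ ∂ν = ‖T g‖ := fun g => by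
    rw [L1.norm_eq_integral_norm]
    refine integral_congr_ae ?_
    filter_upwards [hT g] with x hx
    rw [hx]
  -- By domination `φ` factors through the image of `C(K)` in `L¹(ν)` with norm at most one;
  -- Hahn–Banach extends it to `L¹(ν)`, where densities exist.
  have hker : LinearMap.ker T.toLinearMap ≤ LinearMap.ker φ.toLinearMap := by
    intro g hg
    have h1 := hφ g
    have h2 : T g = 0 := hg
    rw [hTn, h2, norm_zero] at h1
    exact norm_le_zero_iff.1 h1
  let ψ₀ : LinearMap.range T.toLinearMap →ₗ[ℂ] ℂ :=
    ((LinearMap.ker T.toLinearMap).liftQ φ.toLinearMap hker).comp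
      T.toLinearMap.quotKerEquivRange.symm.toLinearMap
  have hψ₀ : ∀ g, ψ₀ ⟨T g, g, rfl⟩ = φ g := by
    intro g
    have h1 : T.toLinearMap.quotKerEquivRange.symm ⟨T g, g, rfl⟩ = Submodule.Quotient.mk g := by
      rw [LinearEquiv.symm_apply_eq]
      rfl
    change (LinearMap.ker T.toLinearMap).liftQ φ.toLinearMap hker
      (T.toLinearMap.quotKerEquivRange.symm ⟨T g, g, rfl⟩) = _
    rw [h1]
    rfl
  let ψ₁ : StrongDual ℂ (LinearMap.range T.toLinearMap) := ψ₀.mkContinuous 1 (by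
    rintro ⟨_, g, rfl⟩
    rw [one_mul]
    exact (congrArg norm (hψ₀ g)).trans_le ((hφ g).trans_eq (hTn g)))
  obtain ⟨ψ, hψ, -⟩ := exists_extension_norm_eq _ ψ₁
  obtain ⟨h, hm, hb, hh⟩ := exists_density_of_isFiniteMeasure ν ψ
  refine ⟨h, hm, ⟨_, hb⟩, fun g => ?_⟩
  have h1 := hh (T g)
  have h2 : ψ (T g) = φ g := (hψ ⟨T g, g, rfl⟩).trans (hψ₀ g)
  rw [← h2, h1]
  refine integral_congr_ae ?_
  filter_upwards [hT g] with x hx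
  rw [hx]

end RieszDomination

/-! ### Correcting an almost biorthogonal system. -/

section Perturbation

/-- A system of vectors equivalent to the basis of `ℓ∞` which is biorthogonal up to a small error
to a system of functionals can be made biorthogonal without changing the spans. -/
theorem exists_biorthogonal_of_norm_sub_le {X ι : Type*} [NormedAddCommGroup X] [NormedSpace ℂ X]
    [Fintype ι] [DecidableEq ι] (u : ι → X) (q : ι → StrongDual ℂ X)
    (hu : ∀ c : ι → ℂ, ‖∑ i, c i • u i‖ ≤ ‖c‖)
    (hq : ∀ c : ι → ℂ, ‖(fun i => q i (∑ j, c j • u j)) - c‖ ≤ 1 / 2 * ‖c‖) :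
    ∃ x : ι → X, (∀ i j, q j (x i) = if i = j then 1 else 0) ∧
      (∀ c : ι → ℂ, ‖∑ i, c i • x i‖ ≤ 2 * ‖c‖) ∧
      ∀ c : ι → ℂ, ∃ c' : ι → ℂ, ∑ i, c i • u i = ∑ i, c' i • x i := by
  let J : (ι → ℂ) →ₗ[ℂ] X := Fintype.linearCombination ℂ u
  have hJ : ∀ c, J c = ∑ i, c i • u i := fun c => Fintype.linearCombination_apply ℂ u c
  -- This is the matrix `q i (u j)`. It lies within `1/2` of the identity on `ℓ∞`, so it is
  -- invertible with inverse of norm at most `2`; composing `J` with the inverse gives the corrected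
  -- vectors.
  let T : (ι → ℂ) →ₗ[ℂ] (ι → ℂ) := (LinearMap.pi fun i => (q i).toLinearMap).comp J
  have hT : ∀ c i, T c i = q i (∑ j, c j • u j) := fun c i => by
    rw [← hJ]
    rfl
  have hTc : ∀ c, ‖T c - c‖ ≤ 1 / 2 * ‖c‖ := fun c => by
    have := hq c
    simp only [← hT] at this
    exact this
  have hTn : ∀ c, ‖c‖ ≤ 2 * ‖T c‖ := fun c => by
    have h1 := norm_sub_norm_le c (T c)
    rw [norm_sub_rev] at h1
    linarith [hTc c]
  have hinj : Function.Injective T := by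
    rw [← LinearMap.ker_eq_bot, LinearMap.ker_eq_bot']
    intro c hc
    have := hTn c
    rw [hc, norm_zero, mul_zero] at this
    exact norm_le_zero_iff.1 this
  let e := LinearEquiv.ofInjectiveEndo T hinj
  have he : ∀ c, T (e.symm c) = c := fun c => e.apply_symm_apply c
  have hsum : ∀ c : ι → ℂ, ∑ i, c i • J (e.symm (Pi.single i 1)) = J (e.symm c) := fun c => by
    simp only [← map_smul, ← map_sum]
    congr 2
    ext j
    simp [Finset.sum_apply, Pi.single_apply]
  refine ⟨fun i => J (e.symm (Pi.single i 1)), fun i j => ?_, fun c => ?_, fun c => ⟨T c, ?_⟩⟩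
  · beta_reduce
    rw [hJ, ← hT, he, Pi.single_apply]
    simp only [eq_comm]
  · rw [hsum, hJ]
    refine (hu _).trans ((hTn _).trans ?_)
    rw [he]
  · rw [hsum, ← hJ]
    congr 1
    exact (e.symm_apply_apply c).symm

end Perturbation

/-! ### Property (𝔸) for `C(K)`. -/

section ContinuousFunctions

/-- The complex function with given real values. -/
def ContinuousMap.toComplex {K : Type*} [TopologicalSpace K] (ρ : C(K, ℝ)) : C(K, ℂ) :=
  ⟨fun x => (ρ x : ℂ), by fun_prop⟩

variable {K : Type u} [TopologicalSpace K]

/-- The matrix `a i j = q i (ρ j)` has nonnegative entries, row sums one and diagonal at least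
`3/4`. Row `i` of the error is `∑ a i j (c j - c i)`, whose off-diagonal weight is at most `1/4` and
whose differences are at most `2 ‖c‖`. -/
theorem norm_average_matrix_sub_le {ι : Type*} [Fintype ι] {ρ : ι → C(K, ℝ)} (hρ : ∀ i, 0 ≤ ρ i)
    (hsum : ∀ x, ∑ i, ρ i x = 1) {q : ι → StrongDual ℂ C(K, ℂ)} (hq1 : ∀ i, q i 1 = 1)
    (hqpos : ∀ i, ∀ ρ : C(K, ℝ), 0 ≤ ρ → ∃ a : ℝ, 0 ≤ a ∧ q i ρ.toComplex = a)
    (hqρ : ∀ i, 3 / 4 ≤ (q i (ρ i).toComplex).re) (c : ι → ℂ) :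
    ‖(fun i => q i (∑ j, c j • (ρ j).toComplex)) - c‖ ≤ 1 / 2 * ‖c‖ := by
  classical
  choose a ha hqa using fun i j => hqpos i (ρ j) (hρ j)
  have hone : ∑ j, (ρ j).toComplex = 1 := by
    ext x
    have := congrArg (fun r : ℝ => (r : ℂ)) (hsum x)
    simpa [ContinuousMap.toComplex] using this
  have hasum : ∀ i, ∑ j, a i j = 1 := fun i => by
    have h := hq1 i
    rw [← hone, map_sum] at h
    simp only [hqa] at h
    exact_mod_cast h
  have hdiag : ∀ i, 3 / 4 ≤ a i i := fun i => by simpa [hqa] using hqρ i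
  refine (pi_norm_le_iff_of_nonneg (by positivity)).2 fun i => ?_
  have h1 : q i (∑ j, c j • (ρ j).toComplex) - c i = ∑ j, (a i j : ℂ) * (c j - c i) := by
    simp only [mul_sub, Finset.sum_sub_distrib, ← Finset.sum_mul]
    have : (∑ j, (a i j : ℂ)) = 1 := by exact_mod_cast hasum i
    rw [this, one_mul, map_sum]
    simp only [map_smul, hqa, smul_eq_mul, mul_comm]
  calc ‖q i (∑ j, c j • (ρ j).toComplex) - c i‖ ≤ ∑ j, ‖(a i j : ℂ) * (c j - c i)‖ := by
        rw [h1]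
        exact norm_sum_le _ _
    _ ≤ ∑ j, if j = i then 0 else a i j * (2 * ‖c‖) := by
        refine Finset.sum_le_sum fun j _ => ?_
        split_ifs with hji
        · simp [hji]
        · rw [norm_mul, Complex.norm_real, Real.norm_of_nonneg (ha i j)]
          refine mul_le_mul_of_nonneg_left ?_ (ha i j)
          refine (norm_sub_le _ _).trans ?_
          linarith [norm_le_pi_norm c i, norm_le_pi_norm c j]
    _ = (1 - a i i) * (2 * ‖c‖) := by
        rw [← hasum i, ← Finset.add_sum_erase _ _ (Finset.mem_univ i),
          ← Finset.add_sum_erase _ (fun j => a i j) (Finset.mem_univ i), if_pos rfl, zero_add,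
          add_sub_cancel_left, Finset.sum_mul]
        exact Finset.sum_congr rfl fun j hj => if_neg (Finset.ne_of_mem_erase hj)
    _ ≤ 1 / 2 * ‖c‖ := by
        nlinarith [hdiag i, norm_nonneg c]

variable [CompactSpace K]

/-- A partition of unity on a compact space subordinate to an open cover whose members are shrunk
so that the functions are constant on given compact sets. -/
theorem exists_partitionOfUnity_eq_one [T2Space K] {ι : Type*} [Fintype ι] (U κ : ι → Set K)
    (hU : ∀ i, IsOpen (U i)) (hκ : ∀ i, IsCompact (κ i)) (hκU : ∀ i, κ i ⊆ U i)
    (hdisj : ∀ i j, i ≠ j → Disjoint (κ i) (κ j)) (hcover : ∀ x, ∃ i, x ∈ U i) :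
    ∃ ρ : ι → C(K, ℝ), (∀ i, 0 ≤ ρ i) ∧ (∀ x, ∑ i, ρ i x = 1) ∧
      (∀ i, ∀ x ∈ κ i, ρ i x = 1) ∧ ∀ i x, ρ i x ≠ 0 → x ∈ U i := by
  classical
  -- Removing the other compact sets from `U i` leaves a cover, since the sets `κ j` are disjoint;
  -- on `κ i` only the `i`-th function can be nonzero.
  let V : ι → Set K := fun i => U i \ ⋃ j ∈ {j | j ≠ i}, κ j
  have hV : ∀ i, IsOpen (V i) := fun i => (hU i).sdiff
    (Set.Finite.isClosed_biUnion (Set.toFinite _) fun j _ => (hκ j).isClosed)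
  have hVc : Set.univ ⊆ ⋃ i, V i := by
    intro x _
    rw [Set.mem_iUnion]
    by_cases h : ∃ i, x ∈ κ i
    · obtain ⟨i, hi⟩ := h
      refine ⟨i, hκU i hi, fun hx => ?_⟩
      obtain ⟨j, hj, hxj⟩ := Set.mem_iUnion₂.1 hx
      exact Set.disjoint_left.1 (hdisj j i hj) hxj hi
    · obtain ⟨i, hi⟩ := hcover x
      refine ⟨i, hi, fun hx => ?_⟩
      obtain ⟨j, hj, hxj⟩ := Set.mem_iUnion₂.1 hx
      exact h ⟨j, hxj⟩
  obtain ⟨ρ, hρ⟩ := PartitionOfUnity.exists_isSubordinate isClosed_univ V hV hVc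
  have hsupp : ∀ i x, ρ i x ≠ 0 → x ∈ V i := fun i x hx => hρ i (subset_tsupport _ hx)
  have hsum : ∀ x, ∑ i, ρ i x = 1 := fun x => by
    rw [← finsum_eq_sum_of_fintype]
    exact ρ.sum_eq_one (Set.mem_univ x)
  refine ⟨fun i => ρ i, fun i x => ρ.nonneg i x, hsum, fun i x hx => ?_,
    fun i x hx => (hsupp i x hx).1⟩
  rw [← hsum x, Finset.sum_eq_single i]
  · intro j _ hji
    by_contra h
    exact (hsupp j x h).2 (Set.mem_iUnion₂.2 ⟨i, hji.symm, hx⟩)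
  · simp

variable [MeasurableSpace K] [BorelSpace K]

theorem integrable_continuousMap (ν : Measure K) [IsFiniteMeasure ν] (g : C(K, ℂ)) :
    Integrable g ν :=
  Integrable.of_bound g.continuous.measurable.aestronglyMeasurable ‖g‖
    (ae_of_all _ fun x => g.norm_coe_le_norm x)

/-- The average over a measurable set `A` (or a point evaluation, if `A` is a null set), together
with a compact subset of `A` which carries most of it. -/
theorem exists_average_functional [T2Space K] (ν : Measure K) [ν.Regular] {A : Set K}
    (hA : MeasurableSet A) (hne : A.Nonempty) :
    ∃ (κ : Set K) (q : StrongDual ℂ C(K, ℂ)), IsCompact κ ∧ κ ⊆ A ∧ (∀ g, ‖q g‖ ≤ ‖g‖) ∧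
      (∀ g : C(K, ℂ), (ν.real A : ℂ) * q g = ∫ x in A, g x ∂ν) ∧ q 1 = 1 ∧
      (∀ ρ : C(K, ℝ), 0 ≤ ρ → ∃ a : ℝ, 0 ≤ a ∧ q ρ.toComplex = a) ∧
      (∀ ρ : C(K, ℝ), 0 ≤ ρ → (∀ x ∈ κ, ρ x = 1) → 3 / 4 ≤ (q ρ.toComplex).re) := by
  -- On a null cell the averaging identity reads `0 = 0`, so a point evaluation will do and keeps `q
  -- 1 = 1`.
  by_cases h0 : ν A = 0
  · obtain ⟨t, ht⟩ := hne
    refine ⟨{t}, ContinuousMap.evalCLM ℂ t, isCompact_singleton, Set.singleton_subset_iff.2 ht,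
      fun g => g.norm_coe_le_norm t, fun g => ?_, rfl, fun ρ hρ => ⟨ρ t, hρ t, rfl⟩,
      fun ρ _ h => ?_⟩
    · rw [Measure.real, h0, Measure.restrict_eq_zero.2 h0]
      simp
    · change 3 / 4 ≤ ((ρ t : ℝ) : ℂ).re
      rw [Complex.ofReal_re, h t rfl]
      norm_num
  · have hpos : 0 < ν.real A := ENNReal.toReal_pos h0 (measure_ne_top ν A)
    have hposC : (ν.real A : ℂ) ≠ 0 := by exact_mod_cast hpos.ne'
    -- Inner regularity captures three quarters of `A`; the missing quarter, doubled, is the `1/2`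
    -- allowed in the perturbation argument.
    have hlt : ENNReal.ofReal (3 / 4 * ν.real A) < ν A := by
      rw [ENNReal.ofReal_lt_iff_lt_toReal (by positivity) (measure_ne_top ν A)]
      change _ < ν.real A
      linarith
    obtain ⟨κ, hκA, hκ, hκm⟩ := hA.exists_lt_isCompact_of_ne_top (measure_ne_top ν A) hlt
    have hκr : 3 / 4 * ν.real A ≤ ν.real κ :=
      ((ENNReal.ofReal_lt_iff_lt_toReal (by positivity) (measure_ne_top ν κ)).1 hκm).le
    have hbound : ∀ g : C(K, ℂ), ‖(ν.real A : ℂ)⁻¹ * ∫ x in A, g x ∂ν‖ ≤ 1 * ‖g‖ := by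
      intro g
      rw [norm_mul, norm_inv, Complex.norm_real, Real.norm_of_nonneg hpos.le, one_mul,
        inv_mul_le_iff₀ hpos, mul_comm]
      exact norm_setIntegral_le_of_norm_le_const (measure_lt_top ν A)
        fun x _ => g.norm_coe_le_norm x
    let q : StrongDual ℂ C(K, ℂ) := LinearMap.mkContinuous
      { toFun := fun g => (ν.real A : ℂ)⁻¹ * ∫ x in A, g x ∂ν
        map_add' := fun g g' => by
          rw [← mul_add, ← integral_add (integrable_continuousMap ν g).integrableOn
            (integrable_continuousMap ν g').integrableOn]
          rfl
        map_smul' := fun c g => by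
          simp only [RingHom.id_apply, smul_eq_mul, ContinuousMap.smul_apply, integral_const_mul]
          ring } 1 hbound
    have hq : ∀ g, q g = (ν.real A : ℂ)⁻¹ * ∫ x in A, g x ∂ν := fun g => rfl
    have hqρ : ∀ ρ : C(K, ℝ), q ρ.toComplex = (((ν.real A)⁻¹ * ∫ x in A, ρ x ∂ν : ℝ) : ℂ) := by
      intro ρ
      rw [hq]
      push_cast
      congr 1
      exact integral_ofReal
    refine ⟨κ, q, hκ, hκA, fun g => (hbound g).trans_eq (one_mul _), fun g => ?_, ?_, fun ρ hρ => ?_,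
      fun ρ hρ h => ?_⟩
    · rw [hq, mul_inv_cancel_left₀ hposC]
    · rw [hq]
      simp [hposC]
    · exact ⟨_, mul_nonneg (inv_nonneg.2 hpos.le) (integral_nonneg fun x => hρ x), hqρ ρ⟩
    · rw [hqρ, Complex.ofReal_re, le_inv_mul_iff₀ hpos, mul_comm]
      refine hκr.trans ?_
      have h1 : ν.real κ = ∫ x in κ, ρ x ∂ν := by
        rw [setIntegral_congr_fun hκ.measurableSet (g := fun _ => (1 : ℝ)) fun x hx => h x hx]
        simp
      rw [h1]
      have hi : Integrable ρ ν := Integrable.of_bound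
        ρ.continuous.measurable.aestronglyMeasurable ‖ρ‖ (ae_of_all _ fun x => ρ.norm_coe_le_norm x)
      exact setIntegral_mono_set hi.integrableOn (ae_of_all _ fun x => hρ x)
        (LE.le.eventuallyLE hκA)

end ContinuousFunctions

/-- Averages over cells are contractive functionals and a partition of unity spans a contractive
image of `ℓ∞`; the constant `2` is the cost of exact biorthogonality. -/
theorem hasPropertyA_continuousMap (K : Type u) [TopologicalSpace K] [CompactSpace K] [T2Space K] :
    HasPropertyA C(K, ℂ) := by
  classical
  let _ : MeasurableSpace K := borel K
  have : BorelSpace K := ⟨rfl⟩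
  refine HasPropertyA.of_local.{u, u} 2 fun F Φ ε hε => ?_
  obtain ⟨ν, hν, hνΦ⟩ := exists_measure_dominating Φ
  have hdens := fun φ : Φ => exists_density_of_dominated ν φ.1 (hνΦ φ.1 φ.2)
  choose h hm hb hh using hdens
  choose M hM using hb
  let b : F ⊕ Φ → K → ℂ := Sum.elim (fun f => f.1) h
  have hbm : ∀ j, Measurable (b j) := by
    rintro (f | φ)
    · exact f.1.continuous.measurable
    · exact hm φ
  let N : F ⊕ Φ → ℝ := Sum.elim (fun f => ‖f.1‖) fun φ => |M φ|
  have hbN : ∀ j x, ‖b j x‖ ≤ ∑ j, N j := by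
    intro j x
    refine le_trans ?_ (Finset.single_le_sum (f := N) ?_ (Finset.mem_univ j))
    · rcases j with f | φ
      · exact f.1.norm_coe_le_norm x
      · exact (hM φ x).trans (le_abs_self _)
    · rintro (f | φ) -
      · exact norm_nonneg _
      · exact abs_nonneg _
  have hδ : 0 < min (ε / 2) (ε / (ν.real Set.univ + 1)) := by positivity
  set δ := min (ε / 2) (ε / (ν.real Set.univ + 1)) with hδdef
  obtain ⟨r, hr⟩ := exists_simpleFunc_norm_sub_le (∑ j, N j) hδ
  have hrb : ∀ j x, ‖r (b j x) - b j x‖ ≤ δ := fun j x => hr _ (hbN j x)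
  let cell : K → (F ⊕ Φ → r.range) := fun x j => ⟨r (b j x), r.mem_range_self _⟩
  let A : (F ⊕ Φ → r.range) → Set K := fun v => cell ⁻¹' {v}
  have hcell : ∀ v x, x ∈ A v → ∀ j, (v j : ℂ) = r (b j x) := fun v x hx j => by
    rw [← show cell x = v from hx]
  have hA : ∀ v, MeasurableSet (A v) := fun v => by
    have : A v = ⋂ j, (fun x => r (b j x)) ⁻¹' {(v j : ℂ)} := Set.ext fun x => by
      rw [Set.mem_iInter]
      exact ⟨fun hx j => (hcell v x hx j).symm, fun hx => funext fun j => Subtype.ext (hx j)⟩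
    rw [this]
    exact MeasurableSet.iInter fun j => (r.measurable.comp (hbm j)) (measurableSet_singleton _)
  -- Empty cells are dropped because a normalized functional on a null cell needs a point to
  -- evaluate at.
  let ι := {v // (A v).Nonempty}
  choose κ q hκ hκA hqn hqA hq1 hqpos hqκ using
    fun i : ι => exists_average_functional ν (hA i.1) i.2
  -- Only the continuous functions `f` enter, so that `U i` is open; `2 * δ` leaves room for the
  -- whole cell, where the error is at most `δ`.
  let U : ι → Set K := fun i => ⋂ f : F, {x | ‖f.1 x - i.1 (Sum.inl f)‖ < 2 * δ}
  have hAU : ∀ i : ι, A i.1 ⊆ U i := fun i x hx => Set.mem_iInter.2 fun f => by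
    have h1 := hrb (Sum.inl f) x
    have h2 := hcell i.1 x hx (Sum.inl f)
    rw [← h2, norm_sub_rev] at h1
    exact lt_of_le_of_lt h1 (by linarith)
  obtain ⟨ρ, hρ0, hρ1, hρκ, hρU⟩ := exists_partitionOfUnity_eq_one U κ
    (fun i => isOpen_iInter_of_finite fun f => isOpen_lt (by fun_prop) continuous_const) hκ
    (fun i => (hκA i).trans (hAU i))
    (fun i j hij => Set.disjoint_left.2 fun x hx hx' => hij (Subtype.ext
      ((show cell x = i.1 from hκA i hx).symm.trans (hκA j hx'))))
    (fun x => ⟨⟨cell x, x, rfl⟩, hAU ⟨cell x, x, rfl⟩ rfl⟩)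
  have hρa : ∀ (c : ι → ℂ) x, (∑ i, c i • (ρ i).toComplex : C(K, ℂ)) x = ∑ i, c i * ρ i x :=
    fun c x => by simp [ContinuousMap.toComplex]
  have hnsum : ∀ (c : ι → ℂ) (B : ℝ) x, (∀ i, ρ i x ≠ 0 → ‖c i‖ ≤ B) →
      ‖∑ i, c i * (ρ i x : ℂ)‖ ≤ B := fun c B x hc => by
    calc _ ≤ ∑ i, B * ρ i x := by
          refine (norm_sum_le _ _).trans (Finset.sum_le_sum fun i _ => ?_)
          rw [norm_mul, Complex.norm_real,
            Real.norm_of_nonneg (show 0 ≤ ρ i x from hρ0 i x)]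
          by_cases h0 : ρ i x = 0
          · simp [h0]
          · exact mul_le_mul_of_nonneg_right (hc i h0) (hρ0 i x)
      _ = B := by rw [← Finset.mul_sum, hρ1, mul_one]
  obtain ⟨x, hxq, hxn, hxspan⟩ := exists_biorthogonal_of_norm_sub_le
    (fun i => (ρ i).toComplex) q (fun c => (ContinuousMap.norm_le _ (norm_nonneg c)).2 fun x => by
      rw [hρa]
      exact hnsum c _ x fun i _ => norm_le_pi_norm c i)
    (norm_average_matrix_sub_le hρ0 hρ1 hq1 hqpos fun i => hqκ i _ (hρ0 i) (hρκ i))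
  refine ⟨ι, inferInstance, inferInstance, x, q, hxq, fun s σ y => ?_, fun f hf => ?_,
    fun φ hφ => ?_⟩
  · simp only [smul_smul]
    refine (hxn _).trans ?_
    gcongr
    refine (pi_norm_le_iff_of_nonneg (norm_nonneg _)).2 fun i => ?_
    rw [norm_mul]
    refine (mul_le_of_le_one_left (norm_nonneg _) ?_).trans (hqn (σ i) y)
    rcases Int.units_eq_one_or (s i) with h | h <;> simp [h]
  · obtain ⟨c', hc'⟩ := hxspan fun i => (i.1 (Sum.inl ⟨f, hf⟩) : ℂ)
    refine ⟨c', ?_⟩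
    rw [← hc', ContinuousMap.norm_le _ hε.le]
    intro x
    have h1 : (f - ∑ i : ι, (i.1 (Sum.inl ⟨f, hf⟩) : ℂ) • (ρ i).toComplex) x =
        ∑ i : ι, (f x - (i.1 (Sum.inl ⟨f, hf⟩) : ℂ)) * (ρ i x : ℂ) := by
      have : (∑ i : ι, (ρ i x : ℂ)) = 1 := by exact_mod_cast hρ1 x
      rw [ContinuousMap.sub_apply, hρa]
      simp only [sub_mul, Finset.sum_sub_distrib, ← Finset.mul_sum, this, mul_one]
    rw [h1]
    refine hnsum _ _ x fun i hi => ?_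
    have h2 := Set.mem_iInter.1 (hρU i x hi) ⟨f, hf⟩
    have h3 : ‖f x - (i.1 (Sum.inl ⟨f, hf⟩) : ℂ)‖ < 2 * δ := h2
    linarith [min_le_left (ε / 2) (ε / (ν.real Set.univ + 1))]
  · refine ⟨fun i => (i.1 (Sum.inr ⟨φ, hφ⟩) : ℂ) * ν.real (A i.1), ?_⟩
    refine ContinuousLinearMap.opNorm_le_bound _ hε.le fun g => ?_
    let d : K → ℂ := fun x => r (h ⟨φ, hφ⟩ x)
    have hdm : Measurable d := r.measurable.comp (hm _)
    have hdi : Integrable (fun x => d x * g x) ν := by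
      obtain ⟨D, hD⟩ := r.exists_forall_norm_le
      exact (integrable_continuousMap ν g).bdd_mul hdm.aestronglyMeasurable
        (ae_of_all _ fun x => hD (h ⟨φ, hφ⟩ x))
    have h1 : ∑ i : ι, ((i.1 (Sum.inr ⟨φ, hφ⟩) : ℂ) * ν.real (A i.1)) * q i g =
        ∫ x, d x * g x ∂ν := by
      have hU : (⋃ i : ι, A i.1) = Set.univ :=
        Set.eq_univ_of_forall fun x => Set.mem_iUnion.2 ⟨⟨cell x, x, rfl⟩, rfl⟩
      rw [← setIntegral_univ, ← hU, integral_iUnion_fintype (s := fun i : ι => A i.1)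
        (fun i => hA i.1)
        (fun i j hij => Set.disjoint_left.2 fun x hx hx' => hij (Subtype.ext
          ((show cell x = i.1 from hx).symm.trans hx'))) (fun i => hdi.integrableOn)]
      refine Finset.sum_congr rfl fun i _ => ?_
      rw [mul_assoc, hqA, ← integral_const_mul]
      refine setIntegral_congr_fun (hA i.1) fun x hx => ?_
      simp only [hcell i.1 x hx (Sum.inr ⟨φ, hφ⟩)]
      rfl
    have h2 : (φ - ∑ i : ι, ((i.1 (Sum.inr ⟨φ, hφ⟩) : ℂ) * ν.real (A i.1)) • q i) g =
        ∫ x, (h ⟨φ, hφ⟩ x * g x - d x * g x) ∂ν := by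
      rw [integral_sub ((integrable_continuousMap ν g).bdd_mul (hm _).aestronglyMeasurable
        (ae_of_all _ (hM ⟨φ, hφ⟩))) hdi, ← hh, ← h1]
      simp
    rw [h2]
    refine (norm_integral_le_of_norm_le_const (C := δ * ‖g‖) (ae_of_all _ fun x => ?_)).trans ?_
    · rw [← sub_mul, norm_mul, norm_sub_rev]
      gcongr
      · exact hrb (Sum.inr ⟨φ, hφ⟩) x
      · exact g.norm_coe_le_norm x
    · have h3 : δ * (ν.real Set.univ + 1) ≤ ε := by
        rw [← le_div_iff₀ (by positivity)]
        exact min_le_right _ _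
      have h4 : 0 ≤ ν.real Set.univ := measureReal_nonneg
      nlinarith [norm_nonneg g]

/-! ### `L∞` as a space of continuous functions. -/

section Linfty

variable {Ω : Type*} [MeasurableSpace Ω] {μ : Measure Ω}

theorem Linfty.ae_norm_le (f : Lp ℂ ∞ μ) : ∀ᵐ x ∂μ, ‖f x‖ ≤ ‖f‖ := by
  filter_upwards [ae_le_eLpNormEssSup (f := f) (μ := μ)] with x hx
  rw [Lp.norm_def, eLpNorm_exponent_top, ← toReal_enorm]
  refine ENNReal.toReal_mono ?_ hx
  rw [← eLpNorm_exponent_top]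
  exact Lp.eLpNorm_ne_top f

theorem Linfty.norm_le (f : Lp ℂ ∞ μ) {C : ℝ} (hC : 0 ≤ C) (h : ∀ᵐ x ∂μ, ‖f x‖ ≤ C) : ‖f‖ ≤ C := by
  rw [Lp.norm_def, eLpNorm_exponent_top]
  exact ENNReal.toReal_le_of_le_ofReal hC (eLpNormEssSup_le_of_ae_bound h)

/-- Pointwise multiplication on `L∞`. -/
noncomputable abbrev Linfty.mul (f g : Lp ℂ ∞ μ) : Lp ℂ ∞ μ := f • g

theorem Linfty.coeFn_mul (f g : Lp ℂ ∞ μ) : Linfty.mul f g =ᵐ[μ] fun x => f x * g x :=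
  Lp.coeFn_lpSMul f g

/-- The constant function `1` in `L∞`. -/
noncomputable def Linfty.one : Lp ℂ ∞ μ := (memLp_top_const (1 : ℂ)).toLp _

theorem Linfty.coeFn_one : (Linfty.one : Lp ℂ ∞ μ) =ᵐ[μ] fun _ => 1 :=
  (memLp_top_const (1 : ℂ)).coeFn_toLp

theorem Linfty.one_mul (f : Lp ℂ ∞ μ) : Linfty.mul Linfty.one f = f := by
  refine Lp.ext ?_
  filter_upwards [Linfty.coeFn_mul Linfty.one f, Linfty.coeFn_one] with x h1 h2
  rw [h1, h2, _root_.one_mul]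

theorem Linfty.mul_comm (f g : Lp ℂ ∞ μ) : Linfty.mul f g = Linfty.mul g f := by
  refine Lp.ext ?_
  filter_upwards [Linfty.coeFn_mul f g, Linfty.coeFn_mul g f] with x h1 h2
  rw [h1, h2, _root_.mul_comm]

theorem Linfty.mul_assoc (f g h : Lp ℂ ∞ μ) :
    Linfty.mul (Linfty.mul f g) h = Linfty.mul f (Linfty.mul g h) := by
  refine Lp.ext ?_
  filter_upwards [Linfty.coeFn_mul f g, Linfty.coeFn_mul g h,
    Linfty.coeFn_mul (Linfty.mul f g) h, Linfty.coeFn_mul f (Linfty.mul g h)] with x h1 h2 h3 h4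
  rw [h3, h4, h1, h2, _root_.mul_assoc]

/-- The space `L∞` as a normed commutative ring. -/
noncomputable abbrev Linfty.normedCommRing : NormedCommRing (Lp ℂ ∞ μ) where
  __ := (inferInstance : NormedAddCommGroup (Lp ℂ ∞ μ))
  mul := Linfty.mul
  one := Linfty.one
  mul_assoc := Linfty.mul_assoc
  one_mul := Linfty.one_mul
  mul_one f := (Linfty.mul_comm f Linfty.one).trans (Linfty.one_mul f)
  left_distrib f g h := Lp.add_smul f g h
  right_distrib f g h := Lp.smul_add f g h
  zero_mul f := Lp.zero_smul ℂ ∞ f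
  mul_zero f := Lp.smul_zero ℂ ∞ f
  mul_comm := Linfty.mul_comm
  norm_mul_le f g := Lp.norm_smul_le f g

/-- The space `L∞` as a commutative C⋆-algebra. -/
noncomputable abbrev Linfty.commCStarAlgebra : CommCStarAlgebra (Lp ℂ ∞ μ) :=
  letI : NormedCommRing (Lp ℂ ∞ μ) := Linfty.normedCommRing
  letI : Algebra ℂ (Lp ℂ ∞ μ) := Algebra.ofModule
    (fun c f g => Lp.smul_assoc c f g) (fun c f g => (Lp.smul_comm c f g).symm)
  letI : NormedAlgebra ℂ (Lp ℂ ∞ μ) := { norm_smul_le := fun c f => norm_smul_le c f }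
  letI : StarRing (Lp ℂ ∞ μ) :=
    { star_mul := fun f g => by
        refine Lp.ext ?_
        filter_upwards [Lp.coeFn_star (Linfty.mul f g), Linfty.coeFn_mul f g, Lp.coeFn_star f,
          Lp.coeFn_star g, Linfty.coeFn_mul (star g) (star f)] with x h1 h2 h3 h4 h5
        refine h1.trans (Eq.trans ?_ h5.symm)
        rw [Pi.star_apply, h2, h3, h4, StarMul.star_mul]
        rfl
      star_add := fun f g => by
        refine Lp.ext ?_
        filter_upwards [Lp.coeFn_star (f + g), Lp.coeFn_add f g, Lp.coeFn_star f,
          Lp.coeFn_star g, Lp.coeFn_add (star f) (star g)] with x h1 h2 h3 h4 h5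
        refine h1.trans (Eq.trans ?_ h5.symm)
        rw [Pi.star_apply, h2, Pi.add_apply, Pi.add_apply, h3, h4, star_add]
        rfl }
  { toNormedCommRing := inferInstance
    toStarRing := inferInstance
    toNormedAlgebra := inferInstance
    complete := CompleteSpace.complete
    norm_mul_self_le := fun f => by
      have h0 : 0 ≤ ‖Linfty.mul (star f) f‖ := norm_nonneg _
      have h : ‖f‖ ≤ √‖Linfty.mul (star f) f‖ := by
        refine Linfty.norm_le f (Real.sqrt_nonneg _) ?_
        filter_upwards [Linfty.ae_norm_le (Linfty.mul (star f) f),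
          Linfty.coeFn_mul (star f) f, Lp.coeFn_star f] with x h1 h2 h3
        rw [h2, h3, norm_mul, Pi.star_apply, norm_star] at h1
        exact Real.le_sqrt_of_sq_le (by rw [sq]; exact h1)
      calc ‖f‖ * ‖f‖ ≤ √‖Linfty.mul (star f) f‖ * √‖Linfty.mul (star f) f‖ := by gcongr
        _ = ‖Linfty.mul (star f) f‖ := Real.mul_self_sqrt h0
    star_smul := fun c f => by
      refine Lp.ext ?_
      filter_upwards [Lp.coeFn_star (c • f), Lp.coeFn_smul c f, Lp.coeFn_star f,
        Lp.coeFn_smul (star c) (star f)] with x h1 h2 h3 h4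
      refine h1.trans (Eq.trans ?_ h4.symm)
      rw [Pi.star_apply, h2, Pi.smul_apply, Pi.smul_apply, h3, star_smul]
      rfl }

end Linfty

/-- The Gelfand transform as a linear isometry from `L∞` onto a space of continuous functions. -/
theorem exists_linearIsometryEquiv_continuousMap {Ω : Type u} [MeasurableSpace Ω] (μ : Measure Ω) :
    ∃ (K : Type u) (_ : TopologicalSpace K) (_ : CompactSpace K) (_ : T2Space K),
      Nonempty (Lp ℂ ∞ μ ≃ₗᵢ[ℂ] C(K, ℂ)) := by
  let : CommCStarAlgebra (Lp ℂ ∞ μ) := Linfty.commCStarAlgebra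
  refine ⟨WeakDual.characterSpace ℂ (Lp ℂ ∞ μ), inferInstance, inferInstance, inferInstance, ⟨?_⟩⟩
  have hn : ∀ f : Lp ℂ ∞ μ, ‖gelfandStarTransform (Lp ℂ ∞ μ) f‖ = ‖f‖ := fun f =>
    (AddMonoidHomClass.isometry_iff_norm (WeakDual.gelfandTransform ℂ (Lp ℂ ∞ μ))).1
      (gelfandTransform_isometry (Lp ℂ ∞ μ)) f
  exact
    { toFun := gelfandStarTransform (Lp ℂ ∞ μ)
      invFun := (gelfandStarTransform (Lp ℂ ∞ μ)).symm
      left_inv := (gelfandStarTransform (Lp ℂ ∞ μ)).symm_apply_apply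
      right_inv := (gelfandStarTransform (Lp ℂ ∞ μ)).apply_symm_apply
      map_add' := map_add (gelfandStarTransform (Lp ℂ ∞ μ))
      map_smul' := fun c f => map_smul (gelfandStarTransform (Lp ℂ ∞ μ)) c f
      norm_map' := hn }

theorem HasPropertyA.of_linearIsometryEquiv {X Y : Type u} [NormedAddCommGroup X]
    [NormedSpace ℂ X] [CompleteSpace X] [NormedAddCommGroup Y] [NormedSpace ℂ Y] [CompleteSpace Y]
    (e : X ≃ₗᵢ[ℂ] Y) (h : HasPropertyA Y) : HasPropertyA X := by
  obtain ⟨ι, i1, i2, i3, n, B, hx, hf, G, hG, C, hC⟩ := h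
  let e' : X ≃L[ℂ] Y := e.toContinuousLinearEquiv
  have he : ∀ x, e' x = e x := fun _ => rfl
  let B' : ∀ k, BiorthogonalSystem X (n k) := fun k =>
    { vec := fun i => e.symm ((B k).vec i)
      func := fun i => ((B k).func i).comp (e' : X →L[ℂ] Y)
      biorthogonal := fun i j => by simp [he, (B k).biorthogonal] }
  have hB' : ∀ k a x, (B' k).lift a x = e.symm ((B k).lift a (e x)) := fun k a x => by
    simp [BiorthogonalSystem.lift_apply, B', he]
  refine ⟨ι, i1, i2, i3, n, B', fun x => ?_, fun f => ?_, G, hG, C, fun k g hg => ?_⟩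
  · simp only [hB']
    have h1 := (e.symm.continuous.tendsto (e x)).comp (hx (e x))
    rw [e.symm_apply_apply] at h1
    exact h1
  · have h1 := hf (f.comp (e'.symm : Y →L[ℂ] X))
    have h2 : Continuous fun φ : StrongDual ℂ Y => φ.comp (e' : X →L[ℂ] Y) :=
      ((ContinuousLinearMap.compL ℂ X Y ℂ).flip (e' : X →L[ℂ] Y)).continuous
    have h3 := (h2.tendsto _).comp h1
    have h4 : (f.comp (e'.symm : Y →L[ℂ] X)).comp (e' : X →L[ℂ] Y) = f := by
      ext x
      simp
    rw [h4] at h3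
    refine h3.congr fun k => ?_
    ext x
    simp only [Function.comp_apply, ContinuousLinearMap.comp_apply, hB']
    rfl
  · refine ContinuousLinearMap.opNorm_le_bound _ ((norm_nonneg _).trans (hC k g hg)) fun x => ?_
    rw [hB', e.symm.norm_map, ← e.norm_map x]
    exact ((B k).lift _).le_of_opNorm_le (hC k g hg) _

theorem hasPropertyA_Linfty {Ω : Type u} [MeasurableSpace Ω] (μ : Measure Ω) :
    HasPropertyA (Lp ℂ ∞ μ) := by
  obtain ⟨K, _, _, _, ⟨e⟩⟩ := exists_linearIsometryEquiv_continuousMap μ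
  exact HasPropertyA.of_linearIsometryEquiv e (hasPropertyA_continuousMap K)

/-! ### Uniform convexity and norm attainment in `L_p`. -/

/-- Strict convexity of `z ↦ ‖z‖ ^ r` at midpoints. -/
theorem norm_midpoint_rpow_lt {r : ℝ} (hr : 1 < r) {z w : ℂ} (h : z ≠ w) :
    ‖(1 / 2 : ℝ) • (z + w)‖ ^ r < (‖z‖ ^ r + ‖w‖ ^ r) / 2 := by
  by_cases hzw : ‖z‖ = ‖w‖
  · have := (norm_midpoint_lt_iff hzw).2 h
    have := Real.rpow_lt_rpow (norm_nonneg _) this (by linarith : 0 < r)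
    rw [← hzw]
    linarith
  · have h1 := (strictConvexOn_rpow hr).2 (Set.mem_Ici.2 (norm_nonneg z))
      (Set.mem_Ici.2 (norm_nonneg w)) hzw (by norm_num : (0 : ℝ) < 1 / 2)
      (by norm_num : (0 : ℝ) < 1 / 2) (by norm_num)
    have h2 : ‖(1 / 2 : ℝ) • (z + w)‖ ≤ (1 / 2 : ℝ) • ‖z‖ + (1 / 2 : ℝ) • ‖w‖ := by
      rw [norm_smul, smul_eq_mul, smul_eq_mul, ← mul_add]
      norm_num
      exact norm_add_le z w
    have h3 := Real.rpow_le_rpow (norm_nonneg _) h2 (by linarith : 0 ≤ r)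
    simp only [smul_eq_mul] at h1 h3
    linarith

/-- A quantitative form of the strict convexity of `z ↦ ‖z‖ ^ r`. -/
theorem exists_norm_sub_rpow_le {r : ℝ} (hr : 1 < r) {ε : ℝ} (hε : 0 < ε) :
    ∃ C : ℝ, 0 ≤ C ∧ ∀ z w : ℂ, ‖z - w‖ ^ r ≤ ε * (‖z‖ ^ r + ‖w‖ ^ r) +
      C * ((‖z‖ ^ r + ‖w‖ ^ r) / 2 - ‖(1 / 2 : ℝ) • (z + w)‖ ^ r) := by
  have hr0 : 0 ≤ r := by linarith
  let N : ℂ × ℂ → ℝ := fun v => ‖v.1‖ ^ r + ‖v.2‖ ^ r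
  let D : ℂ × ℂ → ℝ := fun v => N v / 2 - ‖(1 / 2 : ℝ) • (v.1 + v.2)‖ ^ r
  let S : ℂ × ℂ → ℝ := fun v => ‖v.1 - v.2‖ ^ r
  have hN : Continuous N := by
    refine Continuous.add ?_ ?_ <;> exact (by fun_prop : Continuous _).rpow_const fun _ => .inr hr0
  have hD : Continuous D := by
    refine (hN.div_const _).sub ?_
    exact (by fun_prop : Continuous _).rpow_const fun _ => .inr hr0
  have hS : Continuous S := (by fun_prop : Continuous _).rpow_const fun _ => .inr hr0
  have hDnonneg : ∀ v, 0 ≤ D v := by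
    intro v
    by_cases h : v.1 = v.2
    · simp only [D, N, h]
      rw [← two_smul ℝ v.2, smul_smul]
      norm_num
    · have := norm_midpoint_rpow_lt hr h
      simp only [D, N]
      linarith
  -- Off `T` the term `ε N` already dominates. On `T` the entries differ, so `D > 0` and compactness
  -- gives `S ≤ C D`. Homogeneity of degree `r` then carries the estimate from the sphere to all
  -- pairs.
  let T : Set (ℂ × ℂ) := Metric.sphere 0 1 ∩ {v | ε * N v ≤ S v}
  have hT : IsCompact T :=
    (isCompact_sphere 0 1).inter_right (isClosed_le (hN.const_smul ε) hS)
  have hNpos : ∀ v, v ≠ 0 → 0 < N v := by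
    intro v hv
    by_cases h1 : v.1 = 0
    · have h2 : v.2 ≠ 0 := fun h2 => hv (Prod.ext h1 h2)
      exact add_pos_of_nonneg_of_pos (by positivity)
        (Real.rpow_pos_of_pos (norm_pos_iff.2 h2) r)
    · exact add_pos_of_pos_of_nonneg (Real.rpow_pos_of_pos (norm_pos_iff.2 h1) r) (by positivity)
  obtain ⟨C, hC, hCT⟩ : ∃ C : ℝ, 0 ≤ C ∧ ∀ v ∈ T, S v ≤ C * D v := by
    rcases T.eq_empty_or_nonempty with he | hne
    · exact ⟨0, le_rfl, by simp [he]⟩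
    · have hpos : ∀ v ∈ T, 0 < D v := by
        rintro v ⟨hv1, hv2⟩
        have hv0 : v ≠ 0 := by
          rintro rfl
          simp at hv1
        have hne : v.1 ≠ v.2 := by
          intro h
          have : S v = 0 := by simp [S, h, Real.zero_rpow (by linarith : r ≠ 0)]
          have h3 := mul_pos hε (hNpos v hv0)
          have h4 : ε * N v ≤ S v := hv2
          linarith
        have := norm_midpoint_rpow_lt hr hne
        simp only [D, N]
        linarith
      obtain ⟨v₀, hv₀, hmin⟩ := hT.exists_isMinOn hne hD.continuousOn
      obtain ⟨v₁, hv₁, hmax⟩ := hT.exists_isMaxOn hne hS.continuousOn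
      have hS1 : 0 ≤ S v₁ := by positivity
      refine ⟨S v₁ / D v₀, div_nonneg hS1 (hpos v₀ hv₀).le, fun v hv => ?_⟩
      calc S v ≤ S v₁ := hmax hv
        _ = S v₁ / D v₀ * D v₀ := by field_simp [(hpos v₀ hv₀).ne']
        _ ≤ S v₁ / D v₀ * D v :=
            mul_le_mul_of_nonneg_left (hmin hv) (div_nonneg hS1 (hpos v₀ hv₀).le)
  have hsphere : ∀ v ∈ Metric.sphere (0 : ℂ × ℂ) 1, S v ≤ ε * N v + C * D v := by
    intro v hv
    by_cases h : ε * N v ≤ S v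
    · have h1 := hCT v ⟨hv, h⟩
      have h2 : 0 ≤ ε * N v := by positivity
      linarith
    · have := mul_nonneg hC (hDnonneg v)
      linarith
  refine ⟨C, hC, fun z w => ?_⟩
  by_cases h0 : (z, w) = 0
  · obtain ⟨rfl, rfl⟩ : z = 0 ∧ w = 0 := by simpa using h0
    simp [Real.zero_rpow (by linarith : r ≠ 0)]
  · have hρ : 0 < ‖(z, w)‖ := norm_pos_iff.2 h0
    set ρ := ‖(z, w)‖
    have hv := hsphere (ρ⁻¹ • (z, w)) (by
      rw [mem_sphere_zero_iff_norm, norm_smul, norm_inv, norm_norm]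
      exact inv_mul_cancel₀ hρ.ne')
    have hscale : ∀ u : ℂ, ‖ρ⁻¹ • u‖ ^ r = ρ⁻¹ ^ r * ‖u‖ ^ r := by
      intro u
      rw [norm_smul, Real.norm_of_nonneg (inv_nonneg.2 hρ.le),
        Real.mul_rpow (inv_nonneg.2 hρ.le) (norm_nonneg _)]
    have hmid : (1 / 2 : ℝ) • (ρ⁻¹ • z + ρ⁻¹ • w) = ρ⁻¹ • ((1 / 2 : ℝ) • (z + w)) := by
      rw [← smul_add, smul_comm]
    simp only [S, N, D, Prod.smul_fst, Prod.smul_snd, hmid, ← smul_sub, hscale] at hv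
    have hpos : 0 < ρ⁻¹ ^ r := Real.rpow_pos_of_pos (inv_pos.2 hρ) r
    refine le_of_mul_le_mul_left ?_ hpos
    linarith

variable {Ω : Type v} [MeasurableSpace Ω] {μ : Measure Ω} {p : ℝ≥0∞}

theorem MeasureTheory.Lp.integrable_norm_rpow (h0 : p ≠ 0) (hp : p ≠ ∞) (f : Lp ℂ p μ) :
    Integrable (fun x => ‖f x‖ ^ p.toReal) μ :=
  (Lp.memLp f).integrable_norm_rpow h0 hp

theorem MeasureTheory.Lp.norm_rpow_eq_integral (h0 : p ≠ 0) (hp : p ≠ ∞) (f : Lp ℂ p μ) :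
    ‖f‖ ^ p.toReal = ∫ x, ‖f x‖ ^ p.toReal ∂μ := by
  have hI : 0 ≤ ∫ x, ‖f x‖ ^ p.toReal ∂μ := integral_nonneg fun _ => by positivity
  rw [Lp.norm_def, (Lp.memLp f).eLpNorm_eq_integral_rpow_norm h0 hp,
    ENNReal.toReal_ofReal (by positivity), ← Real.rpow_mul hI,
    inv_mul_cancel₀ (ENNReal.toReal_pos h0 hp).ne', Real.rpow_one]

/-- Uniform convexity of `L_p` for `1 < p < ∞`, in terms of midpoints. -/
theorem MeasureTheory.Lp.exists_norm_sub_rpow_le [Fact (1 ≤ p)] (h1 : 1 < p) (hp : p ≠ ∞) {ε : ℝ}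
    (hε : 0 < ε) :
    ∃ C : ℝ, 0 ≤ C ∧ ∀ f g : Lp ℂ p μ, ‖f‖ ≤ 1 → ‖g‖ ≤ 1 → ‖f - g‖ ^ p.toReal ≤
      ε + C * (1 - ‖(1 / 2 : ℝ) • (f + g)‖ ^ p.toReal) := by
  have h0 : p ≠ 0 := (zero_lt_one.trans h1).ne'
  have hr : 1 < p.toReal := by
    rw [← ENNReal.toReal_one]
    exact (ENNReal.toReal_lt_toReal ENNReal.one_ne_top hp).2 h1
  obtain ⟨C, hC, h⟩ := _root_.exists_norm_sub_rpow_le hr (half_pos hε)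
  refine ⟨C, hC, fun f g hf hg => ?_⟩
  have hfi := Lp.integrable_norm_rpow h0 hp f
  have hgi := Lp.integrable_norm_rpow h0 hp g
  have hfgi := Lp.integrable_norm_rpow h0 hp ((1 / 2 : ℝ) • (f + g))
  have key : ‖f - g‖ ^ p.toReal ≤ ε / 2 * (‖f‖ ^ p.toReal + ‖g‖ ^ p.toReal) +
      C * ((‖f‖ ^ p.toReal + ‖g‖ ^ p.toReal) / 2 - ‖(1 / 2 : ℝ) • (f + g)‖ ^ p.toReal) := by
    simp only [Lp.norm_rpow_eq_integral h0 hp]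
    have hI : Integrable (fun x => ‖f x‖ ^ p.toReal + ‖g x‖ ^ p.toReal) μ := hfi.add hgi
    have hI' : Integrable (fun x => ε / 2 * (‖f x‖ ^ p.toReal + ‖g x‖ ^ p.toReal)) μ :=
      hI.const_mul _
    have hJ : Integrable (fun x => (‖f x‖ ^ p.toReal + ‖g x‖ ^ p.toReal) / 2) μ := hI.div_const 2
    have hJ' : Integrable (fun x => C * ((‖f x‖ ^ p.toReal + ‖g x‖ ^ p.toReal) / 2 -
        ‖((1 / 2 : ℝ) • (f + g) : Lp ℂ p μ) x‖ ^ p.toReal)) μ := (hJ.sub hfgi).const_mul _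
    rw [← integral_add hfi hgi, ← integral_const_mul, ← integral_div, ← integral_sub hJ hfgi,
      ← integral_const_mul, ← integral_add hI' hJ']
    refine integral_mono_ae (Lp.integrable_norm_rpow h0 hp (f - g)) (hI'.add hJ') ?_
    filter_upwards [Lp.coeFn_sub f g, Lp.coeFn_add f g, Lp.coeFn_smul (1 / 2 : ℝ) (f + g)]
      with x hx1 hx2 hx3
    have := h (f x) (g x)
    simp only [hx1, hx3, Pi.sub_apply, Pi.smul_apply, hx2, Pi.add_apply]
    exact this
  have hf' : ‖f‖ ^ p.toReal ≤ 1 := Real.rpow_le_one (norm_nonneg _) hf (by linarith)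
  have hg' : ‖g‖ ^ p.toReal ≤ 1 := Real.rpow_le_one (norm_nonneg _) hg (by linarith)
  refine key.trans (add_le_add ?_ (mul_le_mul_of_nonneg_left ?_ hC))
  · nlinarith
  · linarith

/-- Every functional on `L_p`, `1 < p < ∞`, attains its norm. -/
theorem MeasureTheory.Lp.exists_norming [Fact (1 ≤ p)] (h1 : 1 < p) (hp : p ≠ ∞)
    (φ : StrongDual ℂ (Lp ℂ p μ)) (hφ : ‖φ‖ = 1) :
    ∃ f : Lp ℂ p μ, ‖f‖ = 1 ∧ (φ f).re = 1 := by
  have hr : 1 < p.toReal := by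
    rw [← ENNReal.toReal_one]
    exact (ENNReal.toReal_lt_toReal ENNReal.one_ne_top hp).2 h1
  have hex : ∀ n : ℕ, ∃ f : Lp ℂ p μ, ‖f‖ ≤ 1 ∧ 1 - 1 / ((n : ℝ) + 1) ≤ (φ f).re := by
    intro n
    have hlt : 1 - 1 / ((n : ℝ) + 1) < ‖φ‖ := by
      rw [hφ]
      have : (0 : ℝ) < 1 / ((n : ℝ) + 1) := by positivity
      linarith
    obtain ⟨f, hf1, hf2⟩ := φ.exists_lt_apply_of_lt_opNorm hlt
    by_cases hz : φ f = 0
    · exact ⟨f, hf1.le, by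
        have h0 : ‖φ f‖ = 0 := norm_eq_zero.2 hz
        rw [h0] at hf2
        rw [hz]
        exact hf2.le⟩
    · have hnz : (‖φ f‖ : ℂ) ≠ 0 := by exact_mod_cast (norm_pos_iff.2 hz).ne'
      -- A unimodular factor makes the value of `φ` equal to `‖φ f‖`, so that real parts can be
      -- compared.
      refine ⟨((starRingEnd ℂ) (φ f) / ‖φ f‖) • f, ?_, ?_⟩
      · rw [norm_smul, norm_div, RCLike.norm_conj, Complex.norm_real, norm_norm,
          div_self (norm_pos_iff.2 hz).ne', one_mul]
        exact hf1.le
      · have : φ (((starRingEnd ℂ) (φ f) / ‖φ f‖) • f) = ‖φ f‖ := by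
          rw [map_smul, smul_eq_mul, div_mul_eq_mul_div, mul_comm, Complex.mul_conj',
            sq, mul_div_assoc, div_self hnz, mul_one]
        rw [this, Complex.ofReal_re]
        exact hf2.le
  choose f hf1 hf2 using hex
  have hbound : ∀ g : Lp ℂ p μ, (φ g).re ≤ ‖g‖ := fun g =>
    ((Complex.re_le_norm _).trans (φ.le_opNorm g)).trans (by rw [hφ, one_mul])
  have htend : Tendsto (fun n : ℕ => 1 - 1 / ((n : ℝ) + 1)) atTop (𝓝 1) := by
    simpa using (tendsto_const_nhds (x := (1 : ℝ))).sub tendsto_one_div_add_atTop_nhds_zero_nat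
  -- Midpoints of almost norming vectors are almost norming, so their norms are close to one and
  -- uniform convexity forces the vectors together.
  have hcauchy : CauchySeq f := by
    refine Metric.cauchySeq_iff.2 fun η hη => ?_
    have hηr : 0 < η ^ p.toReal := Real.rpow_pos_of_pos hη _
    obtain ⟨C, hC, hconv⟩ := Lp.exists_norm_sub_rpow_le (μ := μ) h1 hp (half_pos hηr)
    have hlim : Tendsto (fun n : ℕ => η ^ p.toReal / 2 +
        C * (1 - (1 - 1 / ((n : ℝ) + 1)) ^ p.toReal)) atTop (𝓝 (η ^ p.toReal / 2)) := by
      have := ((htend.rpow_const (p := p.toReal) (.inl one_ne_zero)).const_sub 1).const_mul C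
      simpa using this.const_add (η ^ p.toReal / 2)
    obtain ⟨N, hN⟩ := eventually_atTop.1 (hlim.eventually (gt_mem_nhds (half_lt_self hηr)))
    refine ⟨N, fun m hm n hn => ?_⟩
    have hmono : ∀ k, N ≤ k → 1 - 1 / ((N : ℝ) + 1) ≤ (φ (f k)).re := by
      intro k hk
      refine le_trans ?_ (hf2 k)
      have : 1 / ((k : ℝ) + 1) ≤ 1 / ((N : ℝ) + 1) := by gcongr
      linarith
    have hmid : 1 - 1 / ((N : ℝ) + 1) ≤ ‖(1 / 2 : ℝ) • (f m + f n)‖ := by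
      refine le_trans ?_ (hbound _)
      have : φ ((1 / 2 : ℝ) • (f m + f n)) = (1 / 2 : ℝ) • (φ (f m) + φ (f n)) := by
        rw [← map_add]
        exact (φ.restrictScalars ℝ).map_smul _ _
      rw [this, Complex.smul_re, Complex.add_re, smul_eq_mul]
      linarith [hmono m hm, hmono n hn]
    have hnn : 0 ≤ 1 - 1 / ((N : ℝ) + 1) := by
      have : 1 / ((N : ℝ) + 1) ≤ 1 := by
        rw [div_le_one (by positivity)]
        linarith [N.cast_nonneg (α := ℝ)]
      linarith
    have hpow := Real.rpow_le_rpow hnn hmid (by linarith : 0 ≤ p.toReal)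
    have := hconv (f m) (f n) (hf1 m) (hf1 n)
    have hlt : ‖f m - f n‖ ^ p.toReal < η ^ p.toReal := by
      refine lt_of_le_of_lt (this.trans ?_) (hN N le_rfl)
      gcongr
    rw [NormedAddCommGroup.dist_eq, neg_add_eq_sub, norm_sub_rev]
    exact (Real.rpow_lt_rpow_iff (norm_nonneg _) hη.le (by linarith : 0 < p.toReal)).1 hlt
  obtain ⟨g, hg⟩ := cauchySeq_tendsto_of_complete hcauchy
  have hre : 1 ≤ (φ g).re :=
    le_of_tendsto_of_tendsto' htend
      ((Complex.continuous_re.comp φ.continuous).continuousAt.tendsto.comp hg) hf2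
  have hn : ‖g‖ ≤ 1 := le_of_tendsto' hg.norm hf1
  have := hbound g
  exact ⟨g, le_antisymm hn (hre.trans this), le_antisymm (this.trans hn) hre⟩

/-! ### The duality of `L_p` and `L_q`. -/

section LpDensity

variable {Ω : Type v} [MeasurableSpace Ω] {μ : Measure Ω} {p q : ℝ≥0∞}

theorem Real.HolderConjugate.ne_top_of_toReal (hpq : p.toReal.HolderConjugate q.toReal) :
    p ≠ ∞ := by
  rintro rfl
  simpa using hpq.pos

theorem Real.HolderConjugate.one_lt_of_toReal (hpq : p.toReal.HolderConjugate q.toReal) :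
    1 < p := by
  have := hpq.lt
  rw [← ENNReal.toReal_one] at this
  exact (ENNReal.toReal_lt_toReal ENNReal.one_ne_top hpq.ne_top_of_toReal).1 this

/-- The `L_p` norm to the power `p` is differentiable along lines. -/
theorem MeasureTheory.Lp.hasDerivAt_norm_rpow [Fact (1 ≤ p)] (h1 : 1 < p) (hp : p ≠ ∞)
    (g f : Lp ℂ p μ) :
    HasDerivAt (fun t : ℝ => ‖g + t • f‖ ^ p.toReal)
      (∫ x, p.toReal * ‖g x‖ ^ (p.toReal - 2) * inner ℝ (g x) (f x) ∂μ) 0 := by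
  have h0 : p ≠ 0 := (zero_lt_one.trans h1).ne'
  have hr : 1 < p.toReal := by
    rw [← ENNReal.toReal_one]
    exact (ENNReal.toReal_lt_toReal ENNReal.one_ne_top hp).2 h1
  set r := p.toReal
  have hgm : Measurable g := (Lp.stronglyMeasurable g).measurable
  have hfm : Measurable f := (Lp.stronglyMeasurable f).measurable
  let F : ℝ → Ω → ℝ := fun t x => ‖g x + t • f x‖ ^ r
  let F' : ℝ → Ω → ℝ := fun t x =>
    r * ‖g x + t • f x‖ ^ (r - 2) * inner ℝ (g x + t • f x) (f x)
  have hF : (fun t : ℝ => ‖g + t • f‖ ^ r) = fun t => ∫ x, F t x ∂μ := by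
    funext t
    rw [Lp.norm_rpow_eq_integral h0 hp]
    refine integral_congr_ae ?_
    filter_upwards [Lp.coeFn_add g (t • f), Lp.coeFn_smul t f] with x hx1 hx2
    simp only [hx1, hx2, Pi.add_apply, Pi.smul_apply, F, r]
  -- This dominates the derivative for `|t| < 1`, because `|u|^(r-2) |⟨u, f⟩| ≤ |u|^(r-1) |f|` with
  -- `u = g + t f`.
  have hbound : Integrable (fun x => r * (‖g x‖ + ‖f x‖) ^ r) μ := by
    have := (((Lp.memLp g).norm.add (Lp.memLp f).norm).integrable_norm_rpow h0 hp).const_mul r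
    refine this.congr (ae_of_all _ fun x => ?_)
    have hnn : 0 ≤ ‖g x‖ + ‖f x‖ := by positivity
    simp only [Pi.add_apply, Real.norm_of_nonneg hnn, r]
  have key := (hasDerivAt_integral_of_dominated_loc_of_deriv_le (F := F) (F' := F') (x₀ := 0)
    (μ := μ) (Metric.ball_mem_nhds (0 : ℝ) one_pos)
    (.of_forall fun t => ((hgm.add (hfm.const_smul t)).norm.pow_const r).aestronglyMeasurable)
    (by simpa [F] using Lp.integrable_norm_rpow h0 hp g)
    (by
      simp only [F', zero_smul, add_zero]
      exact (((hgm.norm.pow_const _).const_mul r).mul (hgm.inner hfm)).aestronglyMeasurable)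
    (ae_of_all _ fun x t ht => ?_) hbound (ae_of_all _ fun x t _ => ?_)).2
  · rw [hF]
    simpa only [F', zero_smul, add_zero] using key
  · have ht' : |t| ≤ 1 := by
      rw [Metric.mem_ball, dist_zero_right, Real.norm_eq_abs] at ht
      exact ht.le
    have hu : ‖g x + t • f x‖ ≤ ‖g x‖ + ‖f x‖ := by
      refine (norm_add_le _ _).trans (add_le_add le_rfl ?_)
      rw [norm_smul, Real.norm_eq_abs]
      exact mul_le_of_le_one_left (norm_nonneg _) ht'
    have hfle : ‖f x‖ ≤ ‖g x‖ + ‖f x‖ := le_add_of_nonneg_left (norm_nonneg _)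
    set s := ‖g x‖ + ‖f x‖
    have hs : 0 ≤ s := by positivity
    -- The exponent `r - 2` may be negative, so the zeros are treated separately.
    have hpow : ‖g x + t • f x‖ ^ (r - 2) * ‖g x + t • f x‖ = ‖g x + t • f x‖ ^ (r - 1) := by
      by_cases hz : ‖g x + t • f x‖ = 0
      · rw [hz, mul_zero, Real.zero_rpow (by linarith)]
      · rw [← Real.rpow_add_one hz]
        ring_nf
    have hpow' : s ^ (r - 1) * s = s ^ r := by
      by_cases hz : s = 0
      · rw [hz, mul_zero, Real.zero_rpow (by linarith)]
      · rw [← Real.rpow_add_one hz]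
        ring_nf
    calc ‖F' t x‖ = r * ‖g x + t • f x‖ ^ (r - 2) * |inner ℝ (g x + t • f x) (f x)| := by
          simp only [F', Real.norm_eq_abs, abs_mul]
          rw [abs_of_nonneg (by linarith : 0 ≤ r), abs_of_nonneg (by positivity)]
      _ ≤ r * ‖g x + t • f x‖ ^ (r - 2) * (‖g x + t • f x‖ * ‖f x‖) := by
          gcongr
          exact abs_real_inner_le_norm _ _
      _ = r * (‖g x + t • f x‖ ^ (r - 1) * ‖f x‖) := by rw [← hpow]; ring
      _ ≤ r * (s ^ (r - 1) * s) := by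
          gcongr
      _ = r * s ^ r := by rw [hpow']
  · have hd : HasDerivAt (fun t : ℝ => g x + t • f x) (f x) t := by
      simpa using ((hasDerivAt_id t).smul_const (f x)).const_add (g x)
    have := (hasFDerivAt_norm_rpow (g x + t • f x) hr).comp_hasDerivAt t hd
    exact HasDerivAt.congr_deriv (f := fun t => F t x) this rfl

/-- The dual of `L_p` is `L_q` for conjugate `1 < p, q < ∞`, over an arbitrary measure space. -/
theorem MeasureTheory.Lp.exists_density [Fact (1 ≤ p)] (hpq : p.toReal.HolderConjugate q.toReal)
    (φ : StrongDual ℂ (Lp ℂ p μ)) :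
    ∃ h : Ω → ℂ, MemLp h q μ ∧ ∀ f : Lp ℂ p μ, φ f = ∫ x, h x * f x ∂μ := by
  have h1 := hpq.one_lt_of_toReal
  have hp := hpq.ne_top_of_toReal
  have hq := hpq.symm.ne_top_of_toReal
  have hq0 : q ≠ 0 := (zero_lt_one.trans hpq.symm.one_lt_of_toReal).ne'
  have h0 : p ≠ 0 := (zero_lt_one.trans h1).ne'
  have hr := hpq.lt
  have : ENNReal.HolderConjugate p q :=
    ENNReal.HolderTriple.of_toReal (by rw [ENNReal.toReal_one]; exact hpq)
  by_cases hφ : φ = 0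
  · exact ⟨0, MemLp.zero, by simp [hφ]⟩
  have hφn : ‖φ‖ ≠ 0 := norm_ne_zero_iff.2 hφ
  let ψ : StrongDual ℂ (Lp ℂ p μ) := ((‖φ‖⁻¹ : ℝ) : ℂ) • φ
  have hψ : ‖ψ‖ = 1 := by
    rw [norm_smul, Complex.norm_real, norm_inv, norm_norm, inv_mul_cancel₀ hφn]
  obtain ⟨g, hg1, hg2⟩ := Lp.exists_norming h1 hp ψ hψ
  have hgm : Measurable g := (Lp.stronglyMeasurable g).measurable
  -- The candidate is read off from the derivative of the norm at the norming vector `g`; it lies in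
  -- `L_q` because `(p - 1) q = p`.
  let h : Ω → ℂ := fun x => ((‖g x‖ ^ (p.toReal - 2) : ℝ) : ℂ) * (starRingEnd ℂ) (g x)
  have hhm : Measurable h :=
    (Complex.measurable_ofReal.comp (hgm.norm.pow_const _)).mul
      (Complex.continuous_conj.measurable.comp hgm)
  have hnorm : ∀ x, ‖h x‖ = ‖g x‖ ^ (p.toReal - 1) := by
    intro x
    simp only [h]
    rw [norm_mul, Complex.norm_real, RCLike.norm_conj, Real.norm_of_nonneg (by positivity)]
    by_cases hz : ‖g x‖ = 0
    · rw [hz, mul_zero, Real.zero_rpow (by linarith)]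
    · rw [← Real.rpow_add_one hz]
      ring_nf
  have hh : MemLp h q μ := by
    rw [← integrable_norm_rpow_iff hhm.aestronglyMeasurable hq0 hq]
    refine (Lp.integrable_norm_rpow h0 hp g).congr (ae_of_all _ fun x => ?_)
    simp only [hnorm]
    rw [← Real.rpow_mul (norm_nonneg _), hpq.sub_one_mul_conj]
  have hint : ∀ f : Lp ℂ p μ, Integrable (fun x => h x * f x) μ := fun f =>
    hh.integrable_mul (Lp.memLp f)
  have hre : ∀ f : Lp ℂ p μ, (ψ f).re = (∫ x, h x * f x ∂μ).re := by
    intro f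
    have hd := Lp.hasDerivAt_norm_rpow h1 hp g f
    -- Since `‖g + t f‖ ≥ 1 + t Re ψ(f)`, Bernoulli's inequality `s^p ≥ 1 + p (s - 1)` gives the
    -- minimum; its vanishing derivative identifies `Re ψ(f)`.
    have hmin : IsLocalMin (fun t : ℝ => ‖g + t • f‖ ^ p.toReal - t * (p.toReal * (ψ f).re)) 0 := by
      refine .of_forall fun t => ?_
      have h2 : (ψ (g + t • f)).re ≤ ‖g + t • f‖ :=
        ((Complex.re_le_norm _).trans (ψ.le_opNorm _)).trans (by rw [hψ, one_mul])
      have h3 : ψ (g + t • f) = ψ g + t • ψ f := by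
        rw [map_add]
        congr 1
        exact (ψ.restrictScalars ℝ).map_smul _ _
      rw [h3, Complex.add_re, hg2, Complex.smul_re, smul_eq_mul] at h2
      have h4 := one_add_mul_self_le_rpow_one_add (s := ‖g + t • f‖ - 1)
        (by linarith [norm_nonneg (g + t • f)]) hr.le
      rw [add_sub_cancel] at h4
      have h5 := mul_le_mul_of_nonneg_left h2 (by linarith : 0 ≤ p.toReal)
      simp only [zero_smul, add_zero, hg1, Real.one_rpow, zero_mul, sub_zero]
      linarith
    have hz := hmin.hasDerivAt_eq_zero
      (hd.sub ((hasDerivAt_id (0 : ℝ)).mul_const (p.toReal * (ψ f).re)))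
    have h6 : ∫ x, p.toReal * ‖g x‖ ^ (p.toReal - 2) * inner ℝ (g x) (f x) ∂μ =
        p.toReal * (∫ x, h x * f x ∂μ).re := by
      have h7 : (∫ x, h x * f x ∂μ).re = ∫ x, (h x * f x).re ∂μ := (integral_re (hint f)).symm
      rw [h7, ← integral_const_mul]
      refine integral_congr_ae (ae_of_all _ fun x => ?_)
      simp only [h]
      rw [mul_assoc (Complex.ofReal _), Complex.re_ofReal_mul, Complex.inner, mul_assoc,
        mul_comm (f x)]
    rw [h6, one_mul, ← mul_sub] at hz
    rcases mul_eq_zero.1 hz with h8 | h8 <;> linarith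
  have heq : ∀ f : Lp ℂ p μ, ψ f = ∫ x, h x * f x ∂μ := by
    intro f
    refine Complex.ext (hre f) ?_
    have h9 := hre (-Complex.I • f)
    have h10 : ∫ x, h x * (-Complex.I • f : Lp ℂ p μ) x ∂μ = -Complex.I * ∫ x, h x * f x ∂μ := by
      rw [← integral_const_mul]
      refine integral_congr_ae ?_
      filter_upwards [Lp.coeFn_smul (-Complex.I) f] with x hx
      rw [hx, Pi.smul_apply, smul_eq_mul]
      ring
    rw [h10, map_smul, smul_eq_mul] at h9
    simpa using h9
  refine ⟨fun x => (‖φ‖ : ℂ) * h x, hh.const_mul _, fun f => ?_⟩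
  have : φ f = (‖φ‖ : ℂ) * ψ f := by
    have hc : (‖φ‖ : ℂ) ≠ 0 := by exact_mod_cast hφn
    simp [ψ, hc]
  rw [this, heq, ← integral_const_mul]
  refine integral_congr_ae (ae_of_all _ fun x => ?_)
  simp only [mul_assoc]

end LpDensity

/-! ### Property (𝔸) for `L_p`, `1 < p < ∞`. -/

theorem sum_indicator_of_mem {Ω ι E : Type*} [Fintype ι] [AddCommMonoid E] {A : ι → Set Ω}
    (hd : Pairwise (Function.onFun Disjoint A)) (g : ι → Ω → E) {x : Ω} {i : ι} (hx : x ∈ A i) :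
    ∑ k, (A k).indicator (g k) x = g i x := by
  rw [Finset.sum_eq_single i, Set.indicator_of_mem hx]
  · exact fun k _ hk => Set.indicator_of_notMem (Set.disjoint_left.1 (hd hk.symm) hx) _
  · simp

theorem sum_indicator_of_notMem {Ω ι E : Type*} [Fintype ι] [AddCommMonoid E] {A : ι → Set Ω}
    (g : ι → Ω → E) {x : Ω} (hx : ∀ i, x ∉ A i) : ∑ k, (A k).indicator (g k) x = 0 :=
  Finset.sum_eq_zero fun k _ => Set.indicator_of_notMem (hx k) _

section Lp

variable {Ω : Type v} [MeasurableSpace Ω] {μ : Measure Ω} {p q : ℝ≥0∞}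

/-- Finitely many simple functions are combinations of indicator functions of disjoint sets. -/
theorem exists_common_level_sets {J : Type*} [Fintype J] (s : J → SimpleFunc Ω ℂ)
    (hs : ∀ j, (s j).FinMeasSupp μ) :
    ∃ (R : Finset (J → ℂ)) (A : R → Set Ω), (∀ i, MeasurableSet (A i)) ∧ (∀ i, μ (A i) ≠ ∞) ∧
      (∀ i, μ (A i) ≠ 0) ∧ Pairwise (Function.onFun Disjoint A) ∧
      ∀ j, ∃ c : R → ℂ, s j =ᵐ[μ] fun x => ∑ i, (A i).indicator (fun _ => c i) x := by
  classical
  let T : Ω → J → ℂ := fun x j => s j x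
  let R₀ : Finset (J → ℂ) := Fintype.piFinset fun j => (s j).range
  have hT : ∀ x, T x ∈ R₀ := fun x => Fintype.mem_piFinset.2 fun j => (s j).mem_range_self x
  have hpre : ∀ v, T ⁻¹' {v} = ⋂ j, s j ⁻¹' {v j} := by
    intro v
    ext x
    simp [T, funext_iff]
  -- The value zero is excluded because its level set may have infinite measure, and null level sets
  -- because their indicators cannot be normalized.
  refine ⟨R₀.filter fun v => v ≠ 0 ∧ μ (T ⁻¹' {v}) ≠ 0, fun v => T ⁻¹' {(v : J → ℂ)}, fun v => ?_,
    fun v => ?_, fun v => (Finset.mem_filter.1 v.2).2.2, fun v v' h => ?_, fun j =>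
      ⟨fun v => (v : J → ℂ) j, ?_⟩⟩
  · beta_reduce
    rw [hpre]
    exact MeasurableSet.iInter fun j => (s j).measurableSet_preimage _
  · obtain ⟨j, hj⟩ := Function.ne_iff.1 (Finset.mem_filter.1 v.2).2.1
    refine ((measure_mono ?_).trans_lt ((hs j).meas_preimage_singleton_ne_zero hj)).ne
    beta_reduce
    rw [hpre]
    exact Set.iInter_subset _ j
  · refine Set.disjoint_left.2 fun x hx hx' => h (Subtype.ext ?_)
    exact hx.symm.trans hx'
  · have hae : ∀ᵐ x ∂μ, ∀ v ∈ R₀, μ (T ⁻¹' {v}) = 0 → T x ≠ v := by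
      refine (Finset.eventually_all R₀).2 fun v _ => ?_
      by_cases h : μ (T ⁻¹' {v}) = 0
      · filter_upwards [measure_eq_zero_iff_ae_notMem.1 h] with x hx _
        exact hx
      · exact .of_forall fun x h' => absurd h' h
    filter_upwards [hae] with x hx
    by_cases h0 : T x = 0
    · have : s j x = 0 := congrFun h0 j
      rw [this, sum_indicator_of_notMem]
      intro v hv
      exact (Finset.mem_filter.1 v.2).2.1 ((show T x = v from hv).symm.trans h0)
    · have hmem : T x ∈ R₀.filter fun v => v ≠ 0 ∧ μ (T ⁻¹' {v}) ≠ 0 :=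
        Finset.mem_filter.2 ⟨hT x, h0, fun h => hx _ (hT x) h rfl⟩
      exact (sum_indicator_of_mem (A := fun v : R₀.filter fun v => v ≠ 0 ∧ μ (T ⁻¹' {v}) ≠ 0 =>
        T ⁻¹' {(v : J → ℂ)}) (fun v v' h => Set.disjoint_left.2 fun y hy hy' =>
          h (Subtype.ext (hy.symm.trans hy'))) (fun v _ => (v : J → ℂ) j) (x := x)
          (i := ⟨T x, hmem⟩) rfl).symm

/-- The indicator function of `A`, normalized in `L_p`. -/
noncomputable def normalizedIndicator (p : ℝ≥0∞) {A : Set Ω} (hA : MeasurableSet A)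
    (hμ : μ A ≠ ∞) : Lp ℂ p μ :=
  indicatorConstLp p hA hμ ((μ.real A ^ (-p.toReal⁻¹) : ℝ) : ℂ)

theorem coeFn_normalizedIndicator {A : Set Ω} (hA : MeasurableSet A) (hμ : μ A ≠ ∞) :
    normalizedIndicator p hA hμ =ᵐ[μ] A.indicator fun _ => ((μ.real A ^ (-p.toReal⁻¹) : ℝ) : ℂ) :=
  indicatorConstLp_coeFn

variable {ι : Type*} [Fintype ι] {A : ι → Set Ω} (hA : ∀ i, MeasurableSet (A i))
  (hfin : ∀ i, μ (A i) ≠ ∞)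

theorem coeFn_sum_normalizedIndicator (c : ι → ℂ) :
    (∑ i, c i • normalizedIndicator p (hA i) (hfin i) : Lp ℂ p μ) =ᵐ[μ] fun x =>
      ∑ i, (A i).indicator (fun _ => c i * ((μ.real (A i) ^ (-p.toReal⁻¹) : ℝ) : ℂ)) x := by
  have h1 : ∀ᵐ x ∂μ, ∀ i, (c i • normalizedIndicator p (hA i) (hfin i) : Lp ℂ p μ) x =
      (A i).indicator (fun _ => c i * ((μ.real (A i) ^ (-p.toReal⁻¹) : ℝ) : ℂ)) x := by
    refine ae_all_iff.2 fun i => ?_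
    filter_upwards [Lp.coeFn_smul (c i) (normalizedIndicator p (hA i) (hfin i)),
      coeFn_normalizedIndicator (p := p) (hA i) (hfin i)] with x hx1 hx2
    rw [hx1, Pi.smul_apply, hx2]
    by_cases hx : x ∈ A i
    · rw [Set.indicator_of_mem hx, Set.indicator_of_mem hx, smul_eq_mul]
    · rw [Set.indicator_of_notMem hx, Set.indicator_of_notMem hx, smul_zero]
  filter_upwards [Lp.coeFn_finsetSum Finset.univ
    fun i => (c i • normalizedIndicator p (hA i) (hfin i) : Lp ℂ p μ), h1] with x hx1 hx2
  rw [hx1, Finset.sum_apply]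
  exact Finset.sum_congr rfl fun i _ => hx2 i

theorem exists_toLp_eq_sum_normalizedIndicator (hpos : ∀ i, μ (A i) ≠ 0) {s : Ω → ℂ}
    (hs : MemLp s p μ) {c : ι → ℂ}
    (h : s =ᵐ[μ] fun x => ∑ i, (A i).indicator (fun _ => c i) x) :
    ∃ d : ι → ℂ, hs.toLp s = ∑ i, d i • normalizedIndicator p (hA i) (hfin i) := by
  refine ⟨fun i => c i * ((μ.real (A i) ^ p.toReal⁻¹ : ℝ) : ℂ), Lp.ext ?_⟩
  filter_upwards [hs.coeFn_toLp, h, coeFn_sum_normalizedIndicator (p := p) hA hfin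
    fun i => c i * ((μ.real (A i) ^ p.toReal⁻¹ : ℝ) : ℂ)] with x hx1 hx2 hx3
  rw [hx1, hx2, hx3]
  refine Finset.sum_congr rfl fun i _ => ?_
  have hm : 0 < μ.real (A i) := ENNReal.toReal_pos (hpos i) (hfin i)
  have : ((μ.real (A i) ^ p.toReal⁻¹ : ℝ) : ℂ) * ((μ.real (A i) ^ (-p.toReal⁻¹) : ℝ) : ℂ) = 1 := by
    rw [← Complex.ofReal_mul, ← Real.rpow_add hm, add_neg_cancel, Real.rpow_zero,
      Complex.ofReal_one]
  rw [mul_assoc, this, mul_one]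

/-- Disjointness and normalization make the span isometric to a finite-dimensional `ℓ_p`, on which
signed permutations are isometries. -/
theorem norm_sum_normalizedIndicator_rpow [Fact (1 ≤ p)] (h0 : p ≠ 0) (hp : p ≠ ∞)
    (hpos : ∀ i, μ (A i) ≠ 0) (hd : Pairwise (Function.onFun Disjoint A)) (c : ι → ℂ) :
    ‖∑ i, c i • normalizedIndicator p (hA i) (hfin i)‖ ^ p.toReal = ∑ i, ‖c i‖ ^ p.toReal := by
  have hr : 0 < p.toReal := ENNReal.toReal_pos h0 hp
  rw [Lp.norm_rpow_eq_integral h0 hp]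
  have h1 : (fun x => ‖(∑ i, c i • normalizedIndicator p (hA i) (hfin i) : Lp ℂ p μ) x‖ ^ p.toReal)
      =ᵐ[μ] fun x => ∑ i, (A i).indicator (fun _ => ‖c i‖ ^ p.toReal * (μ.real (A i))⁻¹) x := by
    filter_upwards [coeFn_sum_normalizedIndicator (p := p) hA hfin c] with x hx
    rw [hx]
    by_cases hx' : ∃ i, x ∈ A i
    · obtain ⟨i, hi⟩ := hx'
      rw [sum_indicator_of_mem hd _ hi, sum_indicator_of_mem hd _ hi, norm_mul, Complex.norm_real,
        Real.norm_of_nonneg (by positivity), Real.mul_rpow (norm_nonneg _) (by positivity),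
        ← Real.rpow_mul (by positivity), neg_mul, inv_mul_cancel₀ hr.ne', Real.rpow_neg_one]
    · rw [sum_indicator_of_notMem _ (not_exists.1 hx'), sum_indicator_of_notMem _
        (not_exists.1 hx'), norm_zero, Real.zero_rpow hr.ne']
  rw [integral_congr_ae h1, integral_finsetSum]
  · refine Finset.sum_congr rfl fun i _ => ?_
    have hm : 0 < μ.real (A i) := ENNReal.toReal_pos (hpos i) (hfin i)
    rw [integral_indicator_const _ (hA i), smul_eq_mul]
    field_simp
  · exact fun i _ => (integrable_indicator_iff (hA i)).2 (integrableOn_const (hfin i))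

variable [Fact (1 ≤ p)] [Fact (1 ≤ q)] [ENNReal.HolderConjugate q p]

variable (μ p q) in
/-- The pairing `(h, f) ↦ ∫ h f` of `L_q` and `L_p`. -/
noncomputable def lpMulPairing : Lp ℂ q μ →L[ℂ] StrongDual ℂ (Lp ℂ p μ) :=
  (ContinuousLinearMap.mul ℂ ℂ).lpPairing μ q p

theorem lpMulPairing_apply (h : Lp ℂ q μ) (f : Lp ℂ p μ) :
    lpMulPairing μ p q h f = ∫ x, h x * f x ∂μ :=
  (ContinuousLinearMap.mul ℂ ℂ).lpPairing_eq_integral h f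

theorem lpMulPairing_normalizedIndicator {B : Set Ω} (hB : MeasurableSet B) (hμ : μ B ≠ ∞)
    (f : Lp ℂ p μ) : lpMulPairing μ p q (normalizedIndicator q hB hμ) f =
      ((μ.real B ^ (-q.toReal⁻¹) : ℝ) : ℂ) * ∫ x in B, f x ∂μ := by
  rw [lpMulPairing_apply, ← integral_const_mul, ← integral_indicator hB]
  refine integral_congr_ae ?_
  filter_upwards [coeFn_normalizedIndicator (p := q) hB hμ] with x hx
  rw [hx]
  by_cases h : x ∈ B
  · rw [Set.indicator_of_mem h, Set.indicator_of_mem h]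
  · rw [Set.indicator_of_notMem h, Set.indicator_of_notMem h, zero_mul]

/-- Hölder's inequality on `B` against the constant `1`, whose `L_q` norm the normalization cancels.
-/
theorem norm_lpMulPairing_normalizedIndicator_rpow_le (hpq : p.toReal.HolderConjugate q.toReal)
    {B : Set Ω} (hB : MeasurableSet B) (hμ : μ B ≠ ∞) (h0 : μ B ≠ 0) (f : Lp ℂ p μ) :
    ‖lpMulPairing μ p q (normalizedIndicator q hB hμ) f‖ ^ p.toReal ≤
      ∫ x in B, ‖f x‖ ^ p.toReal ∂μ := by
  have hm : 0 < μ.real B := ENNReal.toReal_pos h0 hμ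
  have hfinite : IsFiniteMeasure (μ.restrict B) := isFiniteMeasure_restrict.2 hμ
  have hp := hpq.ne_top_of_toReal
  have hp0 : ENNReal.ofReal p.toReal = p := ENNReal.ofReal_toReal hp
  have hI : 0 ≤ ∫ x in B, ‖f x‖ ^ p.toReal ∂μ := integral_nonneg fun _ => by positivity
  have h1 := integral_mul_norm_le_Lp_mul_Lq (μ := μ.restrict B) (f := f) (g := fun _ => (1 : ℂ)) hpq
    (by rw [hp0]; exact (Lp.memLp f).restrict B) (memLp_const _)
  simp only [norm_one, mul_one, Real.one_rpow, integral_const, smul_eq_mul, one_div,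
    measureReal_restrict_apply_univ] at h1
  have h2 : ‖lpMulPairing μ p q (normalizedIndicator q hB hμ) f‖ ≤
      (∫ x in B, ‖f x‖ ^ p.toReal ∂μ) ^ p.toReal⁻¹ := by
    rw [lpMulPairing_normalizedIndicator, norm_mul, Complex.norm_real,
      Real.norm_of_nonneg (by positivity)]
    calc μ.real B ^ (-q.toReal⁻¹) * ‖∫ x in B, f x ∂μ‖
        ≤ μ.real B ^ (-q.toReal⁻¹) *
          ((∫ x in B, ‖f x‖ ^ p.toReal ∂μ) ^ p.toReal⁻¹ * μ.real B ^ q.toReal⁻¹) := by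
          gcongr
          exact (norm_integral_le_integral_norm _).trans h1
      _ = (μ.real B ^ (-q.toReal⁻¹) * μ.real B ^ q.toReal⁻¹) *
          (∫ x in B, ‖f x‖ ^ p.toReal ∂μ) ^ p.toReal⁻¹ := by ring
      _ = _ := by rw [← Real.rpow_add hm, neg_add_cancel, Real.rpow_zero, one_mul]
  calc _ ≤ ((∫ x in B, ‖f x‖ ^ p.toReal ∂μ) ^ p.toReal⁻¹) ^ p.toReal :=
        Real.rpow_le_rpow (norm_nonneg _) h2 hpq.nonneg
    _ = _ := by rw [← Real.rpow_mul hI, inv_mul_cancel₀ hpq.ne_zero, Real.rpow_one]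

/-- The coordinate map into `ℓ_p` is contractive, because the cells are disjoint; this is half of
the bound `1` for signed permutations. -/
theorem sum_norm_lpMulPairing_rpow_le (hpq : p.toReal.HolderConjugate q.toReal)
    (hpos : ∀ i, μ (A i) ≠ 0) (hd : Pairwise (Function.onFun Disjoint A)) (f : Lp ℂ p μ) :
    ∑ i, ‖lpMulPairing μ p q (normalizedIndicator q (hA i) (hfin i)) f‖ ^ p.toReal ≤
      ‖f‖ ^ p.toReal := by
  have hp := hpq.ne_top_of_toReal
  have h0 : p ≠ 0 := (zero_lt_one.trans hpq.one_lt_of_toReal).ne'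
  have hi := Lp.integrable_norm_rpow h0 hp f
  calc _ ≤ ∑ i, ∫ x in A i, ‖f x‖ ^ p.toReal ∂μ := Finset.sum_le_sum fun i _ =>
        norm_lpMulPairing_normalizedIndicator_rpow_le hpq (hA i) (hfin i) (hpos i) f
    _ = ∫ x in ⋃ i, A i, ‖f x‖ ^ p.toReal ∂μ :=
        (integral_iUnion_fintype hA hd fun i => hi.integrableOn).symm
    _ ≤ ∫ x, ‖f x‖ ^ p.toReal ∂μ :=
        setIntegral_le_integral hi (ae_of_all _ fun x => by positivity)
    _ = _ := (Lp.norm_rpow_eq_integral h0 hp f).symm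

theorem lpMulPairing_normalizedIndicator_normalizedIndicator {κ : Type*} [DecidableEq κ]
    {A : κ → Set Ω} (hA : ∀ i, MeasurableSet (A i)) (hfin : ∀ i, μ (A i) ≠ ∞)
    (hpq : p.toReal.HolderConjugate q.toReal) (hpos : ∀ i, μ (A i) ≠ 0)
    (hd : Pairwise (Function.onFun Disjoint A)) (i j : κ) :
    lpMulPairing μ p q (normalizedIndicator q (hA j) (hfin j))
      (normalizedIndicator p (hA i) (hfin i)) = if i = j then 1 else 0 := by
  rw [lpMulPairing_normalizedIndicator,
    integral_congr_ae (ae_restrict_of_ae (coeFn_normalizedIndicator (p := p) (hA i) (hfin i))),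
    setIntegral_indicator (hA i), setIntegral_const]
  split_ifs with h
  · subst h
    have hm : 0 < μ.real (A i) := ENNReal.toReal_pos (hpos i) (hfin i)
    rw [Set.inter_self, Complex.real_smul, ← Complex.ofReal_mul, ← Complex.ofReal_mul,
      mul_left_comm, ← Real.rpow_add hm, ← neg_add, add_comm, hpq.inv_add_inv_eq_one,
      Real.rpow_neg_one, mul_inv_cancel₀ hm.ne', Complex.ofReal_one]
  · rw [(hd (Ne.symm h)).inter_eq, measureReal_empty, zero_smul, mul_zero]

end Lp

theorem hasPropertyA_Lp {Ω : Type u} [MeasurableSpace Ω] (μ : Measure Ω) {p : ℝ≥0∞}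
    [Fact (1 ≤ p)] (h1 : 1 < p) (hp : p ≠ ∞) : HasPropertyA (Lp ℂ p μ) := by
  classical
  have hr : 1 < p.toReal := by
    rw [← ENNReal.toReal_one]
    exact (ENNReal.toReal_lt_toReal ENNReal.one_ne_top hp).2 h1
  have h0 : p ≠ 0 := (zero_lt_one.trans h1).ne'
  obtain ⟨q, hpq⟩ : ∃ q : ℝ≥0∞, p.toReal.HolderConjugate q.toReal := by
    have := Real.HolderConjugate.conjExponent hr
    exact ⟨ENNReal.ofReal (Real.conjExponent p.toReal), by
      rwa [ENNReal.toReal_ofReal this.symm.nonneg]⟩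
  have hq1 := hpq.symm.one_lt_of_toReal
  have hq := hpq.symm.ne_top_of_toReal
  have hq0 : q ≠ 0 := (zero_lt_one.trans hq1).ne'
  have : Fact (1 ≤ q) := ⟨hq1.le⟩
  have : ENNReal.HolderConjugate q p :=
    ENNReal.HolderTriple.of_toReal (by rw [ENNReal.toReal_one]; exact hpq.symm)
  refine HasPropertyA.of_local.{u, u} 1 fun F Φ ε hε => ?_
  choose d hd hdφ using fun φ : StrongDual ℂ (Lp ℂ p μ) => Lp.exists_density hpq φ
  have hφd : ∀ φ, φ = lpMulPairing μ p q ((hd φ).toLp _) := by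
    intro φ
    ext f
    rw [hdφ, lpMulPairing_apply]
    refine integral_congr_ae ?_
    filter_upwards [(hd φ).coeFn_toLp] with x hx
    rw [hx]
  set K := ‖lpMulPairing μ p q‖
  have hK : 0 ≤ K := norm_nonneg (lpMulPairing μ p q)
  -- Errors in `L_q` reach the dual multiplied by at most `K`; the added `1` avoids division by
  -- zero.
  have hδ : 0 < ε / (K + 1) := by positivity
  choose s hs hsm using fun f : Lp ℂ p μ => (Lp.memLp f).exists_simpleFunc_eLpNorm_sub_lt hp
    (ENNReal.ofReal_pos.2 hε).ne'
  choose t ht htm using fun φ : StrongDual ℂ (Lp ℂ p μ) =>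
    (hd φ).exists_simpleFunc_eLpNorm_sub_lt hq (ENNReal.ofReal_pos.2 hδ).ne'
  -- Taking the level sets of the approximants in `L_p` and in `L_q` together makes one system serve
  -- vectors and functionals.
  obtain ⟨R, A, hA, hfin, hpos, hdis, hc⟩ := exists_common_level_sets (μ := μ)
    (Sum.elim (fun f : F => s f) fun φ : Φ => t φ) (by
      rintro (f | φ)
      · exact (SimpleFunc.memLp_iff_finMeasSupp h0 hp).1 (hsm f)
      · exact (SimpleFunc.memLp_iff_finMeasSupp hq0 hq).1 (htm φ))
  refine ⟨R, inferInstance, inferInstance, fun i => normalizedIndicator p (hA i) (hfin i),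
    fun i => lpMulPairing μ p q (normalizedIndicator q (hA i) (hfin i)),
    lpMulPairing_normalizedIndicator_normalizedIndicator hA hfin hpq hpos hdis,
    fun σ τ y => ?_, fun f hf => ?_, fun φ hφ => ?_⟩
  · rw [one_mul, ← Real.rpow_le_rpow_iff (norm_nonneg _) (norm_nonneg _) hpq.pos]
    simp only [smul_smul]
    rw [norm_sum_normalizedIndicator_rpow hA hfin h0 hp hpos hdis]
    refine le_trans (le_of_eq ?_) (sum_norm_lpMulPairing_rpow_le hA hfin hpq hpos hdis y)
    rw [← Equiv.sum_comp τ
      fun i => ‖lpMulPairing μ p q (normalizedIndicator q (hA i) (hfin i)) y‖ ^ p.toReal]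
    refine Finset.sum_congr rfl fun i _ => ?_
    have : ‖((σ i : ℤ) : ℂ)‖ = 1 := by
      rcases Int.units_eq_one_or (σ i) with h | h <;> simp [h]
    rw [norm_mul, this, one_mul]
  · obtain ⟨c, hc⟩ := hc (.inl ⟨f, hf⟩)
    obtain ⟨b, hb⟩ := exists_toLp_eq_sum_normalizedIndicator hA hfin hpos (hsm f) hc
    refine ⟨b, ?_⟩
    rw [← hb, Lp.norm_def]
    refine ENNReal.toReal_le_of_le_ofReal hε.le (le_trans (le_of_eq (eLpNorm_congr_ae ?_)) (hs f).le)
    filter_upwards [Lp.coeFn_sub f ((hsm f).toLp _), (hsm f).coeFn_toLp] with x hx1 hx2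
    rw [hx1, Pi.sub_apply, Pi.sub_apply, hx2]
  · obtain ⟨c, hc⟩ := hc (.inr ⟨φ, hφ⟩)
    obtain ⟨b, hb⟩ := exists_toLp_eq_sum_normalizedIndicator hA hfin hpos (htm φ) hc
    refine ⟨b, ?_⟩
    have hle : ‖(hd φ).toLp _ - (htm φ).toLp _‖ ≤ ε / (K + 1) := by
      rw [← MemLp.toLp_sub, Lp.norm_toLp]
      exact ENNReal.toReal_le_of_le_ofReal hδ.le (ht φ).le
    have heq : φ - ∑ i, b i • lpMulPairing μ p q (normalizedIndicator q (hA i) (hfin i)) =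
        lpMulPairing μ p q ((hd φ).toLp _ - (htm φ).toLp _) := by
      rw [map_sub, ← hφd φ, hb, map_sum]
      simp only [map_smul]
    rw [heq]
    calc _ ≤ K * ‖(hd φ).toLp _ - (htm φ).toLp _‖ := (lpMulPairing μ p q).le_opNorm _
      _ ≤ K * (ε / (K + 1)) := by gcongr
      _ ≤ ε := by
        rw [mul_div_assoc', div_le_iff₀ (by positivity)]
        nlinarith

theorem theorem4p7 (K : Type u) [TopologicalSpace K] [CompactSpace K] [T2Space K]
    (Ω : Type v) [MeasurableSpace Ω] (μ : Measure Ω) (p : ℝ≥0∞) [Fact (1 ≤ p)] :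
    (HasPropertyA C(K, ℂ) ∧ IsAmenable.{u, w} (approximableOperators C(K, ℂ))) ∧
    (HasPropertyA (Lp ℂ p μ) ∧ IsAmenable.{v, w} (approximableOperators (Lp ℂ p μ))) := by
  have hC := hasPropertyA_continuousMap K
  have hL : HasPropertyA (Lp ℂ p μ) := by
    rcases (Fact.out : 1 ≤ p).eq_or_lt with rfl | h1
    · exact hasPropertyA_L1 μ
    · by_cases hp : p = ∞
      · subst hp
        exact hasPropertyA_Linfty μ
      · exact hasPropertyA_Lp μ h1 hp
  exact ⟨⟨hC, hC.isAmenable⟩, ⟨hL, hL.isAmenable⟩⟩
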